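/- **Setting.** Let $d\ge 1$, $k\ge 0$, $T>0$, $\sigma>0$, $p>d+2$, $\mathbb{T}^d=\mathbb{R}^d/\mathbb{Z}^d$, $Q=\mathbb{T}^d\times[0,T]$, and $\mathcal{D}_1=\{m\in L^\infty(\mathbb{T}^d): m\ge 0,\ \int m=1\}$. Let $W^{2,1,p}(Q)=L^p(0,T;W^{2,p}(\mathbb{T}^d))\cap W^{1,p}(Q)$. The data are $L:Q\times\mathbb{R}^d\to\mathbb{R}$, $\phi:Q\to\mathbb{R}^{k\times d}$, $\Psi:[0,T]\times\mathbb{R}^k\to\mathbb{R}^k$, $f:Q\times\mathcal{D}_1\to\mathbb{R}$, $m_0\in\mathcal{D}_1$ and $g:\mathbb{T}^d\to\mathbb{R}$. Put $H(x,t,q)=\sup_{v\in\mathbb{R}^d}\{-\langle q,v\rangle-L(x,t,v)\}$. **Standing assumptions.** $L$ is differentiable in $v$; $L_v$ is differentiable in $x$ and in $v$; $\phi$ is differentiable in $x$. There is a constant $C>0$ such that, for all $x,y\in\mathbb{T}^d$, $t\in[0,T]$, $v,v_1,v_2\in\mathbb{R}^d$, $z\in\mathbb{R}^k$ and $m\in\mathcal{D}_1$: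 * $\langle L_v(x,t,v_2)-L_v(x,t,v_1),v_2-v_1\rangle\ge \frac1C|v_2-v_1|^2$; * $L(x,t,v)\le C|v|^2+C$ and $|L(y,t,v)-L(x,t,v)|\le C|y-x|(1+|v|^2)$; * $|\Psi(t,z)|\le C|z|+C$ and $|f(x,t,m)|\le C$. $\Psi(t,\cdot)=\nabla_z\Phi(t,\cdot)$ for some function $\Phi:[0,T]\times\mathbb{R}^k\to\mathbb{R}$ that is convex and differentiable in $z$, with $\Phi(t,0)=0$. For every $R>0$ there is $\alpha\in(0,1)$ such that $L,L_v,L_{vx},L_{vv}$ are of class $\mathcal{C}^\alpha$ on $Q\times B(0,R)$, $\Psi$ is of class $\mathcal{C}^\alpha$ on $[0,T]\times B(0,R)$, and $\phi,D_x\phi$ are of class $\mathcal{C}^\alpha$ on $Q$. There are $\alpha\in(0,1)$ and $C>0$ with $|f(x_2,t_2,m_2)-f(x_1,t_1,m_1)|\le C(|x_2-x_1|+|t_2-t_1|^\alpha+\|m_2-m_1\|_{L^\infty}^\alpha)$ for all $(x_i,t_i)\in Q$ and $m_i\in\mathcal{D}_1$. Finally $m_0,g\in\mathcal{C}^{2+\alpha}(\mathbb{T}^d)$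 for some $\alpha\in(0,1)$. **Monotonicity assumption.** There is a function $F:[0,T]\times\mathcal{D}_1\to\mathbb{R}$, measurable in $t$, such that for a.e. $t$, $F(t,m_0)=0$ and $$F(t,m_2)-F(t,m_1)\ge\int_{\mathbb{T}^d}f(x,t,m_1)(m_2(x)-m_1(x))\,dx\qquad\text{for all } m_1,m_2\in\mathcal{D}_1 .$$ **The system.** Let $(\bar u,\bar m,\bar v,\bar P)\in W^{2,1,p}(Q)^2\times L^\infty(Q;\mathbb{R}^d)\times L^\infty(0,T;\mathbb{R}^k)$ be the solution to $$\begin{cases}-\partial_t u-\sigma\Delta u+H(x,t,\nabla u+\phi^\top P)=f(x,t,m(t)),\\ \partial_t m-\sigma\Delta m+\operatorname{div}(vm)=0,\\ P(t)=\Psi\big(t,\int_{\mathbb{T}^d}\phi v m\,dx\big),\\ v=-H_p(x,t,\nabla u+\phi^\top P),\\ m(x,0)=m_0(x),\quad u(x,T)=g(x),\end{cases}$$ where the equations hold almost everywhere, the second one in the weak sense. Put $\tilde f(x,t)=f(x,t,\bar m(t))$. **Dual problem.** Let $\Phi^*(t,q)=\sup_{z\in\mathbb{R}^k}\langle q,z\rangle-\Phi(t,z)$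 and $F^*(t,\gamma)=\sup_{m\in\mathcal{D}_1}\int\gamma m\,dx-F(t,m)$. For $u\in W^{2,1,p}(Q)$, $P\in L^\infty(0,T;\mathbb{R}^k)$ and $\gamma\in L^\infty(Q)$ let $$D(u,P,\gamma)=\int_{\mathbb{T}^d}u(x,0)m_0(x)\,dx-\int_0^T\Phi^*(t,P(t))\,dt-\int_0^TF^*(t,\gamma(\cdot,t))\,dt\in\mathbb{R}\cup\{-\infty\}.$$ The dual problem is to maximize $D(u,P,\gamma)$ over all such triples subject to $$-\partial_t u-\sigma\Delta u+H(x,t,\nabla u+\phi^\top P)\le\gamma\ \text{ a.e. in } Q,\qquad u(x,T)\le g(x)\ \text{ for a.e. } x .$$ **Lemma.** The triple $(\bar u,\bar P,\tilde f)$ is a solution to the dual problem. Moreover, every solution $(u,P,\gamma)$ to the dual problem satisfies $P=\bar P$ (a.e. on $(0,T)$). If in addition $\gamma=\tilde f$ and the two inequality constraints hold as equalities, then $u=\bar u$. -/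

import Mathlib

open MeasureTheory Set Filter Topology
open scoped ContDiff ENNReal NNReal

noncomputable section

namespace MFGC

/-- Euclidean space `ℝⁿ`. -/
abbrev Vec (n : ℕ) : Type := EuclideanSpace ℝ (Fin n)

/-- The torus `𝕋ᵈ = ℝᵈ / ℤᵈ`, with its normalised Lebesgue measure. -/
abbrev Torus (d : ℕ) : Type := UnitAddTorus (Fin d)

/-- The canonical projection `ℝᵈ → 𝕋ᵈ`. Functions on the torus are differentiated, and compared
at two points, through their periodic lifts to `ℝᵈ`. -/
def proj {d : ℕ} (x : Vec d) : Torus d := fun i => (x i : UnitAddCircle)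

/-- The space-time cylinder `Q = 𝕋ᵈ × [0,T]`. -/
def cyl (d : ℕ) (T : ℝ) : Set (Torus d × ℝ) := univ ×ˢ Icc 0 T

/-! ### Weak derivatives and the space `W^{2,1,p}(Q)` -/

/-- Test functions on `𝕋ᵈ × (0,T)`: smooth, with compact support in time. -/
def IsTest {d : ℕ} (T : ℝ) (ψ : Torus d × ℝ → ℝ) : Prop :=
  ContDiff ℝ ∞ (fun z : Vec d × ℝ => ψ (proj z.1, z.2)) ∧
    ∃ a b : ℝ, 0 < a ∧ b < T ∧ ∀ (x : Torus d) (t : ℝ), t ∉ Icc a b → ψ (x, t) = 0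

/-- The classical partial derivative `∂ψ/∂xᵢ`. -/
def dx {d : ℕ} (i : Fin d) (ψ : Torus d × ℝ → ℝ) (z : Torus d × ℝ) : ℝ :=
  deriv (fun s : ℝ => ψ (z.1 + proj (EuclideanSpace.single i s), z.2)) 0

/-- The classical partial derivative `∂ψ/∂t`. -/
def dt {d : ℕ} (ψ : Torus d × ℝ → ℝ) (z : Torus d × ℝ) : ℝ :=
  deriv (fun s : ℝ => ψ (z.1, s)) z.2

/-- The classical spatial gradient `∇ψ`. -/
def dgrad {d : ℕ} (ψ : Torus d × ℝ → ℝ) (z : Torus d × ℝ) : Vec d :=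
  WithLp.toLp 2 (fun i => dx i ψ z)

/-- `w` is the weak derivative `∂u/∂xᵢ` on `𝕋ᵈ × (0,T)`. -/
def HasWeakDx {d : ℕ} (T : ℝ) (i : Fin d) (u w : Torus d × ℝ → ℝ) : Prop :=
  ∀ ψ : Torus d × ℝ → ℝ, IsTest T ψ →
    (∫ z in cyl d T, u z * dx i ψ z) = - (∫ z in cyl d T, w z * ψ z)

/-- `w` is the weak derivative `∂u/∂t` on `𝕋ᵈ × (0,T)`. -/
def HasWeakDt {d : ℕ} (T : ℝ) (u w : Torus d × ℝ → ℝ) : Prop :=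
  ∀ ψ : Torus d × ℝ → ℝ, IsTest T ψ →
    (∫ z in cyl d T, u z * dt ψ z) = - (∫ z in cyl d T, w z * ψ z)

/-- An element of `W^{2,1,p}(Q) = L^p(0,T; W^{2,p}(𝕋ᵈ)) ∩ W^{1,p}(Q)`: a function of `L^p(Q)`,
together with its weak derivatives `∂ₜu`, `∇u`, `D²u`, all in `L^p(Q)`. The derivatives are
determined by the function up to equality almost everywhere. -/
structure W21p (d : ℕ) (T p : ℝ) where
  toFun : Torus d × ℝ → ℝ
  ut : Torus d × ℝ → ℝ
  grad : Torus d × ℝ → Vec d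
  hess : Fin d → Fin d → Torus d × ℝ → ℝ
  memLp_toFun : MemLp toFun (ENNReal.ofReal p) (volume.restrict (cyl d T))
  memLp_ut : MemLp ut (ENNReal.ofReal p) (volume.restrict (cyl d T))
  memLp_grad : MemLp grad (ENNReal.ofReal p) (volume.restrict (cyl d T))
  memLp_hess : ∀ i j, MemLp (hess i j) (ENNReal.ofReal p) (volume.restrict (cyl d T))
  weak_ut : HasWeakDt T toFun ut
  weak_grad : ∀ i, HasWeakDx T i toFun (fun z => grad z i)
  weak_hess : ∀ i j, HasWeakDx T j (fun z => grad z i) (hess i j)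

/-- The (weak) Laplacian in the space variable. -/
def W21p.lap {d : ℕ} {T p : ℝ} (u : W21p d T p) (z : Torus d × ℝ) : ℝ := ∑ i, u.hess i i z

/-- The initial value `u(x,0)` of a function that is only defined almost everywhere: the limit of
its averages over `[0,h]`. It is `u(x,0)` if `u(x,·)` is continuous from the right at `0`. -/
def initialValue {d : ℕ} (u : Torus d × ℝ → ℝ) (x : Torus d) : ℝ :=
  limUnder (𝓝[>] (0 : ℝ)) (fun h : ℝ => h⁻¹ * ∫ s in (0 : ℝ)..h, u (x, s))

/-- The terminal value `u(x,T)`, as the limit of the averages over `[T-h,T]`. -/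
def terminalValue {d : ℕ} (T : ℝ) (u : Torus d × ℝ → ℝ) (x : Torus d) : ℝ :=
  limUnder (𝓝[>] (0 : ℝ)) (fun h : ℝ => h⁻¹ * ∫ s in (T - h)..T, u (x, s))

/-! ### Hölder classes and densities -/

/-- `h ∈ C^α(s)`: bounded and Hölder continuous with exponent `α` on `s`. -/
def IsHolderOn {X Y : Type*} [PseudoEMetricSpace X] [SeminormedAddCommGroup Y]
    (α : ℝ≥0) (s : Set X) (h : X → Y) : Prop :=
  (∃ C : ℝ, ∀ x ∈ s, ‖h x‖ ≤ C) ∧ ∃ C : ℝ≥0, HolderOnWith C α h s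

/-- `h ∈ C^{2+α}(𝕋ᵈ)`: the lift is `C²`, with `α`-Hölder second derivative (boundedness of the
lift and of its derivatives follows from periodicity). -/
def IsC2Holder {d : ℕ} (α : ℝ≥0) (h : Torus d → ℝ) : Prop :=
  ContDiff ℝ 2 (fun x : Vec d => h (proj x)) ∧
    ∃ C : ℝ≥0, HolderWith C α (iteratedFDeriv ℝ 2 (fun x : Vec d => h (proj x)))

/-- The set `𝒟₁(𝕋ᵈ)` of bounded probability densities. -/
def IsDensity {d : ℕ} (m : Torus d → ℝ) : Prop :=
  MemLp m ∞ volume ∧ (∀ᵐ x, 0 ≤ m x) ∧ (∫ x, m x) = 1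

/-! ### The data of the mean field game -/

/-- The data of the problem. A matrix `φ(x,t) ∈ ℝ^{k×d}` is seen as a linear map `ℝᵈ → ℝᵏ`; its
transpose is the adjoint map. Only the values for `t ∈ [0,T]` and `m ∈ 𝒟₁(𝕋ᵈ)` matter. -/
structure Data (d k : ℕ) where
  T : ℝ
  σ : ℝ
  L : Torus d → ℝ → Vec d → ℝ
  φ : Torus d → ℝ → (Vec d →L[ℝ] Vec k)
  Ψ : ℝ → Vec k → Vec k
  Φ : ℝ → Vec k → ℝ
  f : Torus d → ℝ → (Torus d → ℝ) → ℝ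
  m₀ : Torus d → ℝ
  g : Torus d → ℝ

namespace Data

variable {d k : ℕ} (𝒟 : Data d k)

/-- The gradient `L_v`. -/
def Lv (x : Torus d) (t : ℝ) (v : Vec d) : Vec d := gradient (fun w => 𝒟.L x t w) v

/-- The Hamiltonian `H(x,t,q) = sup_v -⟨q,v⟩ - L(x,t,v)`. -/
def H (x : Torus d) (t : ℝ) (q : Vec d) : ℝ := ⨆ v : Vec d, (-inner ℝ q v - 𝒟.L x t v)

/-- The gradient `H_p`. -/
def Hp (x : Torus d) (t : ℝ) (q : Vec d) : Vec d := gradient (fun r => 𝒟.H x t r) q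

/-- The vector `φ(x,t)ᵀ P`. -/
def φT (x : Torus d) (t : ℝ) (P : Vec k) : Vec d := ContinuousLinearMap.adjoint (𝒟.φ x t) P

/-- The standing assumptions on the data. -/
structure Assumptions : Prop where
  T_pos : 0 < 𝒟.T
  σ_pos : 0 < 𝒟.σ
  -- convexity
  L_diff : ∀ x, ∀ t ∈ Icc 0 𝒟.T, Differentiable ℝ (fun v => 𝒟.L x t v)
  L_strong : ∃ C > 0, ∀ x, ∀ t ∈ Icc 0 𝒟.T, ∀ v₁ v₂ : Vec d,
    (1 / C) * ‖v₂ - v₁‖ ^ 2 ≤ inner ℝ (𝒟.Lv x t v₂ - 𝒟.Lv x t v₁) (v₂ - v₁)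
  Φ_convex : ∀ t ∈ Icc 0 𝒟.T, ConvexOn ℝ univ (𝒟.Φ t)
  Φ_grad : ∀ t ∈ Icc 0 𝒟.T, ∀ z, HasGradientAt (𝒟.Φ t) (𝒟.Ψ t z) z
  Φ_zero : ∀ t ∈ Icc 0 𝒟.T, 𝒟.Φ t 0 = 0
  -- differentiability
  Lv_diff_x : ∀ t ∈ Icc 0 𝒟.T, ∀ v, Differentiable ℝ (fun y : Vec d => 𝒟.Lv (proj y) t v)
  Lv_diff_v : ∀ x, ∀ t ∈ Icc 0 𝒟.T, Differentiable ℝ (fun v => 𝒟.Lv x t v)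
  φ_diff : ∀ t ∈ Icc 0 𝒟.T, Differentiable ℝ (fun y : Vec d => 𝒟.φ (proj y) t)
  -- growth
  L_growth : ∃ C > 0, ∀ x, ∀ t ∈ Icc 0 𝒟.T, ∀ v, 𝒟.L x t v ≤ C * ‖v‖ ^ 2 + C
  L_lip : ∃ C > 0, ∀ x y : Vec d, ∀ t ∈ Icc 0 𝒟.T, ∀ v,
    |𝒟.L (proj y) t v - 𝒟.L (proj x) t v| ≤ C * ‖y - x‖ * (1 + ‖v‖ ^ 2)
  Ψ_growth : ∃ C > 0, ∀ t ∈ Icc 0 𝒟.T, ∀ z, ‖𝒟.Ψ t z‖ ≤ C * ‖z‖ + C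
  f_bounded : ∃ C > 0, ∀ x, ∀ t ∈ Icc 0 𝒟.T, ∀ m, IsDensity m → |𝒟.f x t m| ≤ C
  -- Hölder continuity
  holder : ∀ R > 0, ∃ α : ℝ≥0, 0 < α ∧ α < 1 ∧
    IsHolderOn α (univ ×ˢ Icc 0 𝒟.T ×ˢ Metric.closedBall 0 R)
      (fun z : Vec d × ℝ × Vec d => 𝒟.L (proj z.1) z.2.1 z.2.2) ∧
    IsHolderOn α (univ ×ˢ Icc 0 𝒟.T ×ˢ Metric.closedBall 0 R)
      (fun z : Vec d × ℝ × Vec d => 𝒟.Lv (proj z.1) z.2.1 z.2.2) ∧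
    IsHolderOn α (univ ×ˢ Icc 0 𝒟.T ×ˢ Metric.closedBall 0 R)
      (fun z : Vec d × ℝ × Vec d => fderiv ℝ (fun y : Vec d => 𝒟.Lv (proj y) z.2.1 z.2.2) z.1) ∧
    IsHolderOn α (univ ×ˢ Icc 0 𝒟.T ×ˢ Metric.closedBall 0 R)
      (fun z : Vec d × ℝ × Vec d => fderiv ℝ (fun v => 𝒟.Lv (proj z.1) z.2.1 v) z.2.2) ∧
    IsHolderOn α (Icc 0 𝒟.T ×ˢ Metric.closedBall 0 R)
      (fun z : ℝ × Vec k => 𝒟.Ψ z.1 z.2) ∧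
    IsHolderOn α (univ ×ˢ Icc 0 𝒟.T)
      (fun z : Vec d × ℝ => 𝒟.φ (proj z.1) z.2) ∧
    IsHolderOn α (univ ×ˢ Icc 0 𝒟.T)
      (fun z : Vec d × ℝ => fderiv ℝ (fun y : Vec d => 𝒟.φ (proj y) z.2) z.1)
  f_holder : ∃ α : ℝ, 0 < α ∧ α < 1 ∧ ∃ C > 0, ∀ x₁ x₂ : Vec d,
    ∀ t₁ ∈ Icc 0 𝒟.T, ∀ t₂ ∈ Icc 0 𝒟.T, ∀ m₁ m₂, IsDensity m₁ → IsDensity m₂ →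
      |𝒟.f (proj x₂) t₂ m₂ - 𝒟.f (proj x₁) t₁ m₁| ≤
        C * (‖x₂ - x₁‖ + |t₂ - t₁| ^ α + (eLpNorm (m₂ - m₁) ∞ volume).toReal ^ α)
  m₀_density : IsDensity 𝒟.m₀
  boundary_data : ∃ α : ℝ≥0, 0 < α ∧ α < 1 ∧ IsC2Holder α 𝒟.m₀ ∧ IsC2Holder α 𝒟.g

/-- `F` is a potential of the coupling `f`: the monotonicity assumption, with `F(t,m₀) = 0`. -/
structure IsPotential (F : ℝ → (Torus d → ℝ) → ℝ) : Prop where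
  meas : ∀ m, IsDensity m → AEMeasurable (fun t => F t m) (volume.restrict (Icc 0 𝒟.T))
  subgrad : ∀ᵐ t ∂(volume.restrict (Icc 0 𝒟.T)), ∀ m₁ m₂, IsDensity m₁ → IsDensity m₂ →
    (∫ x, 𝒟.f x t m₁ * (m₂ x - m₁ x)) ≤ F t m₂ - F t m₁
  normalised : ∀ᵐ t ∂(volume.restrict (Icc 0 𝒟.T)), F t 𝒟.m₀ = 0

/-- The function `f̃(x,t) = f(x,t,m(t))`. -/
def coupling (m : Torus d × ℝ → ℝ) (z : Torus d × ℝ) : ℝ := 𝒟.f z.1 z.2 (fun y => m (y, z.2))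

/-- The Hamilton-Jacobi-Bellman operator `-∂ₜu - σ Δu + H(x,t,∇u + φᵀP)`. -/
def hjb {p : ℝ} (u : W21p d 𝒟.T p) (P : ℝ → Vec k) (z : Torus d × ℝ) : ℝ :=
  - u.ut z - 𝒟.σ * u.lap z + 𝒟.H z.1 z.2 (u.grad z + 𝒟.φT z.1 z.2 (P z.2))

/-- `(u,m,v,P) ∈ W^{2,1,p}(Q)² × L^∞(Q;ℝᵈ) × L^∞(0,T;ℝᵏ)` is a solution to the mean field game
of controls. The divergence in the Fokker-Planck equation is the weak one. -/
structure IsSolution {p : ℝ} (u m : W21p d 𝒟.T p) (v : Torus d × ℝ → Vec d) (P : ℝ → Vec k) :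
    Prop where
  memLp_v : MemLp v ∞ (volume.restrict (cyl d 𝒟.T))
  memLp_P : MemLp P ∞ (volume.restrict (Icc 0 𝒟.T))
  hjb_eq : ∀ᵐ z ∂(volume.restrict (cyl d 𝒟.T)), 𝒟.hjb u P z = 𝒟.coupling m.toFun z
  fokker_planck : ∀ ψ : Torus d × ℝ → ℝ, IsTest 𝒟.T ψ →
    (∫ z in cyl d 𝒟.T, (m.ut z - 𝒟.σ * m.lap z) * ψ z)
      - (∫ z in cyl d 𝒟.T, inner ℝ (m.toFun z • v z) (dgrad ψ z)) = 0
  price : ∀ᵐ t ∂(volume.restrict (Icc 0 𝒟.T)),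
    P t = 𝒟.Ψ t (∫ x, m.toFun (x, t) • 𝒟.φ x t (v (x, t)))
  control : ∀ᵐ z ∂(volume.restrict (cyl d 𝒟.T)),
    v z = - 𝒟.Hp z.1 z.2 (u.grad z + 𝒟.φT z.1 z.2 (P z.2))
  initial : ∀ᵐ x, initialValue m.toFun x = 𝒟.m₀ x
  terminal : ∀ᵐ x, terminalValue 𝒟.T u.toFun x = 𝒟.g x

/-! ### The dual problem -/

/-- The convex conjugate `Φ*(t,q) ∈ ℝ ∪ {+∞}`. -/
def Φstar (t : ℝ) (q : Vec k) : EReal := ⨆ z : Vec k, ((inner ℝ q z - 𝒟.Φ t z : ℝ) : EReal)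

/-- The convex conjugate `F*(t,γ)` of `F(t,·)`, the supremum being over `𝒟₁(𝕋ᵈ)`. -/
def Fstar (F : ℝ → (Torus d → ℝ) → ℝ) (t : ℝ) (γ : Torus d → ℝ) : ℝ :=
  ⨆ m : {m : Torus d → ℝ // IsDensity m}, ((∫ x, γ x * m.1 x) - F t m.1)

/-- The dual criterion `D(u,P,γ) ∈ ℝ ∪ {-∞}`. As `Φ(t,0) = 0`, the conjugate `Φ*` takes values in
`[0,+∞]`, and so does its integral. -/
def dualValue (F : ℝ → (Torus d → ℝ) → ℝ) {p : ℝ}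
    (u : W21p d 𝒟.T p) (P : ℝ → Vec k) (γ : Torus d × ℝ → ℝ) : EReal :=
  ((∫ x, initialValue u.toFun x * 𝒟.m₀ x : ℝ) : EReal)
    - ((∫⁻ t in Icc 0 𝒟.T, (𝒟.Φstar t (P t)).toENNReal : ℝ≥0∞) : EReal)
    - ((∫ t in Icc 0 𝒟.T, Fstar F t (fun x => γ (x, t)) : ℝ) : EReal)

/-- Admissible triples of the dual problem. -/
structure DualFeasible {p : ℝ} (u : W21p d 𝒟.T p) (P : ℝ → Vec k) (γ : Torus d × ℝ → ℝ) :
    Prop where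
  memLp_P : MemLp P ∞ (volume.restrict (Icc 0 𝒟.T))
  memLp_γ : MemLp γ ∞ (volume.restrict (cyl d 𝒟.T))
  hjb_le : ∀ᵐ z ∂(volume.restrict (cyl d 𝒟.T)), 𝒟.hjb u P z ≤ γ z
  terminal_le : ∀ᵐ x, terminalValue 𝒟.T u.toFun x ≤ 𝒟.g x

/-- Solutions of the dual problem: admissible triples that maximise the dual criterion. -/
def IsDualSolution (F : ℝ → (Torus d → ℝ) → ℝ) {p : ℝ}
    (u : W21p d 𝒟.T p) (P : ℝ → Vec k) (γ : Torus d × ℝ → ℝ) : Prop :=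
  𝒟.DualFeasible u P γ ∧
    ∀ (u' : W21p d 𝒟.T p) (P' : ℝ → Vec k) (γ' : Torus d × ℝ → ℝ),
      𝒟.DualFeasible u' P' γ' → 𝒟.dualValue F u' P' γ' ≤ 𝒟.dualValue F u P γ

end Data

end MFGC

end

noncomputable section

/-! ### Fourier coefficients and weak derivatives on the torus -/

namespace MFGC

open UnitAddTorus

/-! The argument is weak duality with an explicit gap. Let `(u, P, γ)` be admissible, put w = u − ū,
and let a(t) = ∫ φ v̄ m̄ dx be the aggregate control. Since H is convex and v̄ = −H_p along the
equilibrium, subtracting the equation of ū from the inequality for u gives the linear inequality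
−∂ₜw − σΔw − ⟨v̄, ∇w + φᵀ(P − P̄)⟩ ≤ γ − f̃. Multiplying by m̄ ≥ 0, integrating and using the
Fokker-Planck equation leaves only boundary terms in w. The one at time T is nonpositive, so ∫
w(·,0) m₀ ≤ ∬ (γ − f̃) m̄ + ∫ ⟨a, P − P̄⟩ dt (`duality_le`).

Fenchel's inequality bounds the first term on the right by ∫ F*(γ) − F*(f̃), because monotonicity
makes m̄(t) a maximiser in F*(t, f̃(t)). Since P̄ = Ψ(a), the second term is ∫ Φ*(P) − Φ*(P̄) minus
the nonnegative Fenchel-Young defect of (P, a). Hence the equilibrium is optimal, and a second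
maximiser must have zero defect; differentiability of Φ then forces P = Ψ(a) = P̄ (`dualValue_le`).

For the last claim, u and ū solve the same Hamilton-Jacobi-Bellman equation with the same terminal
value. H is locally Lipschitz in q with a constant of linear growth, and Morrey's inequality bounds
the gradients in L²(0,T; L^∞). An L² energy estimate and a backward Grönwall argument give w = 0
(`hjb_unique`).

Two things support this. First, m̄(t) must be a probability density for a.e. t: positivity comes
from testing against the square of the negative part, mass conservation from the zero Fourier mode.
Second, the integrations by parts must be justified for functions that are only weakly
differentiable. In space this is done on almost every time slice through Fourier coefficients: a
weak derivative multiplies the coefficients by a frequency, and Parseval's identity gives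
integration by parts. In time, almost every x yields an absolutely continuous function of t, which
also gives a meaning to the initial and terminal values. -/

theorem volume_unitAddCircle :
    (volume : Measure UnitAddCircle) = AddCircle.haarAddCircle := by
  simp [AddCircle.volume_eq_smul_haarAddCircle]

instance : IsProbabilityMeasure (volume : Measure UnitAddCircle) := by
  rw [volume_unitAddCircle]; infer_instance

/-- Two measure structures on the circle are in play, the quotient Lebesgue measure and the Haar
measure, which agree only up to a proof. With the structure as a variable, Parseval's identity is
transported by substitution. -/
theorem hasSum_prod_mFourierCoeff_of_eq (inst : MeasureSpace UnitAddCircle)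
    (h : inst = ⟨AddCircle.haarAddCircle⟩) {ι : Type*} [Fintype ι]
    (f g : UnitAddTorus ι → ℂ) (hf : MemLp f 2 volume) (hg : MemLp g 2 volume) :
    HasSum (fun n : ι → ℤ => starRingEnd ℂ (∫ x, mFourier (-n) x • f x) *
      (∫ x, mFourier (-n) x • g x)) (∫ t, starRingEnd ℂ (f t) * g t) := by
  subst h
  letI : MeasureSpace UnitAddCircle := ⟨AddCircle.haarAddCircle⟩
  have h := hasSum_prod_mFourierCoeff (hf.toLp f) (hg.toLp g)
  have e1 : ∀ (f : UnitAddTorus ι → ℂ) (hf : MemLp f 2 volume) (n : ι → ℤ),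
      mFourierCoeff (hf.toLp f) n = ∫ x, mFourier (-n) x • f x := fun f hf n =>
    integral_congr_ae (by filter_upwards [hf.coeFn_toLp] with x hx; rw [hx])
  have e2 : ∫ t, starRingEnd ℂ (hf.toLp f t) * hg.toLp g t = ∫ t, starRingEnd ℂ (f t) * g t :=
    integral_congr_ae
      (by filter_upwards [hf.coeFn_toLp, hg.coeFn_toLp] with x hx hy; rw [hx, hy])
  simp only [e1] at h
  rwa [e2] at h

variable {d : ℕ}

/-- The integral of a real function on the torus against a character. -/
def ch (f : Torus d → ℝ) (n : Fin d → ℤ) : ℂ := ∫ x, (f x : ℂ) * mFourier n x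

/-- Parseval's identity. For real f, conjugating a coefficient reverses the frequency, which is why
`n` is paired with `-n`. -/
theorem hasSum_ch_mul_ch {f g : Torus d → ℝ} (hf : MemLp f 2 volume) (hg : MemLp g 2 volume) :
    HasSum (fun n => ch f n * ch g (-n)) ((∫ x, f x * g x : ℝ) : ℂ) := by
  have h := hasSum_prod_mFourierCoeff_of_eq (AddCircle.measureSpace 1)
    (congrArg (fun v => (⟨v⟩ : MeasureSpace UnitAddCircle)) volume_unitAddCircle)
    (fun x => (f x : ℂ)) (fun x => (g x : ℂ)) hf.ofReal hg.ofReal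
  convert! h using 1
  · ext n
    congr 1
    · rw [← integral_conj]
      refine integral_congr_ae (.of_forall fun x => ?_)
      simp [mFourier_neg, mul_comm]
    · exact integral_congr_ae (.of_forall fun x => mul_comm _ _)
  · rw [← integral_complex_ofReal]
    exact integral_congr_ae (.of_forall fun x => by simp)

theorem integrable_mul_mFourier {f : Torus d → ℝ} (hf : Integrable f) (n : Fin d → ℤ) :
    Integrable (fun x => (f x : ℂ) * mFourier n x) :=
  hf.ofReal.mul_bdd (c := 1) (mFourier n).continuous.aestronglyMeasurable
    (.of_forall fun x => ((mFourier n).norm_coe_le_norm x).trans mFourier_norm.le)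

/-- The pairing with an integrable f is continuous for the uniform norm and vanishes on
trigonometric polynomials, which are dense. -/
theorem integral_mul_continuous_eq_zero {f : Torus d → ℝ} (hf : Integrable f)
    (h : ∀ n, ch f n = 0) (g : C(Torus d, ℂ)) : ∫ x, (f x : ℂ) * g x = 0 := by
  have hint : ∀ g : C(Torus d, ℂ), Integrable (fun x => (f x : ℂ) * g x) := fun g =>
    hf.ofReal.mul_bdd (c := ‖g‖) g.continuous.aestronglyMeasurable
      (.of_forall fun x => g.norm_coe_le_norm x)
  let Λ : C(Torus d, ℂ) →ₗ[ℂ] ℂ :=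
    { toFun := fun g => ∫ x, (f x : ℂ) * g x
      map_add' := fun a b => by
        rw [← integral_add (hint a) (hint b)]
        exact integral_congr_ae (.of_forall fun x => by simp [mul_add])
      map_smul' := fun c a => by
        rw [RingHom.id_apply, smul_eq_mul, ← integral_const_mul]
        exact integral_congr_ae (.of_forall fun x => by simp; ring) }
  have hcont : Continuous Λ := by
    refine AddMonoidHomClass.continuous_of_bound Λ (∫ x, ‖(f x : ℂ)‖) fun g => ?_
    refine (norm_integral_le_integral_norm _).trans ?_
    rw [← integral_mul_const]
    refine integral_mono (hint g).norm (hf.ofReal.norm.mul_const _) fun x => ?_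
    rw [norm_mul]
    exact mul_le_mul_of_nonneg_left (g.norm_coe_le_norm x) (norm_nonneg _)
  have hker : IsClosed {g | Λ g = 0} := isClosed_eq hcont continuous_const
  have hs : (Submodule.span ℂ (range <| mFourier (d := Fin d))) ≤ LinearMap.ker Λ := by
    rw [Submodule.span_le]
    rintro _ ⟨n, rfl⟩
    exact h n
  have : (Submodule.span ℂ (range <| mFourier (d := Fin d))).topologicalClosure
      ≤ LinearMap.ker Λ := Submodule.topologicalClosure_minimal _ hs hker
  rw [span_mFourier_closure_eq_top] at this
  exact this (x := g) trivial

/-- The positive and negative parts of f are densities of two finite measures that integrate every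
bounded continuous function alike. The measures coincide, hence so do the densities. -/
theorem ae_eq_zero_of_ch {f : Torus d → ℝ} (hf : Integrable f) (h : ∀ n, ch f n = 0) :
    f =ᵐ[volume] 0 := by
  have hr : ∀ g : C(Torus d, ℝ), ∫ x, f x * g x = 0 := fun g => by
    have := integral_mul_continuous_eq_zero hf h ⟨fun x => (g x : ℂ), by fun_prop⟩
    have h2 : ∫ x, ((f x * g x : ℝ) : ℂ) = 0 := by
      rw [← this]; exact integral_congr_ae (.of_forall fun x => by simp)
    rw [integral_complex_ofReal] at h2
    exact_mod_cast h2
  let μ₁ := (volume : Measure (Torus d)).withDensity fun x => ENNReal.ofReal (f x)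
  let μ₂ := (volume : Measure (Torus d)).withDensity fun x => ENNReal.ofReal (-f x)
  have hm1 : AEMeasurable (fun x => ENNReal.ofReal (f x)) volume := hf.aemeasurable.ennreal_ofReal
  have hm2 : AEMeasurable (fun x => ENNReal.ofReal (-f x)) volume :=
    hf.neg.aemeasurable.ennreal_ofReal
  have : IsFiniteMeasure μ₁ := isFiniteMeasure_withDensity_ofReal hf.2
  have : IsFiniteMeasure μ₂ := isFiniteMeasure_withDensity_ofReal hf.neg.2
  have heq : μ₁ = μ₂ := by
    refine ext_of_forall_integral_eq_of_IsFiniteMeasure fun g => ?_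
    rw [integral_withDensity_eq_integral_toReal_smul₀ hm1 (.of_forall fun _ => by simp),
      integral_withDensity_eq_integral_toReal_smul₀ hm2 (.of_forall fun _ => by simp)]
    have hb : ∀ F : Torus d → ℝ, Integrable F → Integrable fun x => F x * g x := fun F hF =>
      hF.mul_bdd (c := ‖g‖) g.continuous.aestronglyMeasurable
        (.of_forall fun x => g.norm_coe_le_norm x)
    rw [← sub_eq_zero, ← integral_sub]
    · rw [← hr ⟨g, g.continuous⟩]
      refine integral_congr_ae (.of_forall fun x => ?_)
      simp only [smul_eq_mul, ENNReal.toReal_ofReal', ContinuousMap.coe_mk]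
      rw [← sub_mul]
      congr 1
      exact max_zero_sub_max_neg_zero_eq_self (f x)
    · simpa [ENNReal.toReal_ofReal'] using hb _ hf.pos_part
    · simpa [ENNReal.toReal_ofReal'] using hb _ hf.neg_part
  have := (withDensity_eq_iff hm1 hm2 (by
    simpa using (hf.lintegral_lt_top).ne)).1 heq
  filter_upwards [this] with x hx
  have h2 := congrArg ENNReal.toReal hx
  simp only [ENNReal.toReal_ofReal'] at h2
  have := max_zero_sub_max_neg_zero_eq_self (f x)
  simp only [Pi.zero_apply]; linarith

theorem ch_sub {f g : Torus d → ℝ} (hf : Integrable f) (hg : Integrable g) (n : Fin d → ℤ) :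
    ch (fun x => f x - g x) n = ch f n - ch g n := by
  rw [ch, ch, ch, ← integral_sub (integrable_mul_mFourier hf n) (integrable_mul_mFourier hg n)]
  exact integral_congr_ae (.of_forall fun x => by simp [sub_mul])

theorem ch_congr {f g : Torus d → ℝ} (h : f =ᵐ[volume] g) (n : Fin d → ℤ) : ch f n = ch g n :=
  integral_congr_ae (by filter_upwards [h] with x hx; rw [hx])

theorem ae_eq_of_ch {f g : Torus d → ℝ} (hf : Integrable f) (hg : Integrable g)
    (h : ∀ n, ch f n = ch g n) : f =ᵐ[volume] g := by
  have := ae_eq_zero_of_ch (hf.sub hg) fun n => by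
    rw [← sub_eq_zero.2 (h n), ← ch_sub hf hg]; rfl
  filter_upwards [this] with x hx
  simpa [sub_eq_zero] using hx

/-- `g` is the weak derivative `∂f/∂xᵢ` on the torus, tested against the characters. -/
def HasTorusDeriv (i : Fin d) (f g : Torus d → ℝ) : Prop :=
  ∀ n : Fin d → ℤ, ch g n = -(2 * Real.pi * Complex.I * n i) * ch f n

/-- On the Fourier side, integration by parts moves the factor n from one coefficient to the other;
the sign comes from the opposite frequency in Parseval's identity. -/
theorem HasTorusDeriv.integral_mul_eq {i : Fin d} {f g φ ψ : Torus d → ℝ}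
    (h : HasTorusDeriv i f g) (h' : HasTorusDeriv i φ ψ) (hf : MemLp f 2 volume)
    (hg : MemLp g 2 volume) (hφ : MemLp φ 2 volume) (hψ : MemLp ψ 2 volume) :
    ∫ x, g x * φ x = -∫ x, f x * ψ x := by
  have h1 := hasSum_ch_mul_ch hg hφ
  have h2 := (hasSum_ch_mul_ch hf hψ).neg
  have : (fun n => ch g n * ch φ (-n)) = fun n => -(ch f n * ch ψ (-n)) := by
    ext n
    rw [h n, h' (-n)]
    simp only [Pi.neg_apply, Int.cast_neg]
    ring
  rw [this] at h1
  exact_mod_cast h1.unique h2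

theorem measurable_proj : Measurable (proj : Vec d → Torus d) := by
  refine measurable_pi_lambda _ fun i => ?_
  exact AddCircle.measurable_mk'.comp (by fun_prop)

theorem mFourier_proj (n : Fin d → ℤ) (y : Vec d) :
    mFourier n (proj y) = Complex.exp (2 * Real.pi * Complex.I * ∑ i, n i * y i) := by
  simp only [mFourier, ContinuousMap.coe_mk, proj, fourier_coe_apply]
  rw [← Complex.exp_sum]
  congr 1
  push_cast
  rw [Finset.mul_sum]
  refine Finset.sum_congr rfl fun i _ => ?_
  ring

theorem mFourier_apply_add (n : Fin d → ℤ) (x y : Torus d) :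
    mFourier n (x + y) = mFourier n x * mFourier n y := by
  simp [mFourier, fourier_apply, Finset.prod_mul_distrib, AddCircle.toCircle_add]

theorem ch_translate (f : Torus d → ℝ) (a : Torus d) (n : Fin d → ℤ) :
    ch (fun x => f (x + a)) n = mFourier n (-a) * ch f n := by
  have := integral_add_right_eq_self (μ := (volume : Measure (Torus d)))
    (fun x => (f x : ℂ) * mFourier n (x + -a)) a
  simp only [add_neg_cancel_right] at this
  rw [ch, this, ch, ← integral_const_mul]
  refine integral_congr_ae (.of_forall fun x => ?_)
  simp only [mFourier_apply_add]; ring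

end MFGC

namespace MFGC

/-! ### One-dimensional calculus of absolutely continuous functions -/

/-- The function f is bounded on the interval, and η is Lipschitz on a compact interval containing
its values. -/
theorem absolutelyContinuousOnInterval_comp {f η : ℝ → ℝ} {a b : ℝ}
    (hf : AbsolutelyContinuousOnInterval f a b) (hη : ContDiff ℝ 1 η) :
    AbsolutelyContinuousOnInterval (fun t => η (f t)) a b := by
  obtain ⟨R, hR⟩ := hf.exists_bound
  obtain ⟨K, hK⟩ := hη.contDiffOn.exists_lipschitzOnWith (s := Icc (-R) R) (by decide)
    (convex_Icc _ _) isCompact_Icc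
  refine squeeze_zero' (.of_forall fun E => Finset.sum_nonneg fun i _ => dist_nonneg) ?_
    (by simpa using Filter.Tendsto.const_mul (K : ℝ) hf)
  filter_upwards [mem_inf_of_right (mem_principal_self _)] with E hE
  rw [Finset.mul_sum]
  refine Finset.sum_le_sum fun i hi => ?_
  refine hK.dist_le_mul _ (abs_le.1 (hR _ ?_)) _ (abs_le.1 (hR _ ?_))
  · exact (hE.1 i hi).1
  · exact (hE.1 i hi).2

variable {T : ℝ}

theorem intervalIntegrable_of_integrableOn_Icc {g : ℝ → ℝ} {T t : ℝ}
    (hg : IntegrableOn g (Icc 0 T)) (ht : t ∈ Icc 0 T) : IntervalIntegrable g volume 0 t := by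
  rw [intervalIntegrable_iff_integrableOn_Icc_of_le ht.1]
  exact hg.mono_set (Icc_subset_Icc_right ht.2)

theorem absolutelyContinuousOnInterval_primitive {g : ℝ → ℝ} (hT : 0 ≤ T)
    (hg : IntegrableOn g (Icc 0 T)) (c : ℝ) :
    AbsolutelyContinuousOnInterval (fun t => c + ∫ s in 0..t, g s) 0 T := by
  have h1 : AbsolutelyContinuousOnInterval (fun _ : ℝ => c) 0 T :=
    (contDiff_const (c := c)).contDiffOn.absolutelyContinuousOnInterval
  exact h1.add ((intervalIntegrable_of_integrableOn_Icc hg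
    ⟨hT, le_rfl⟩).absolutelyContinuousOnInterval_intervalIntegral left_mem_uIcc)

theorem continuousOn_primitive {g : ℝ → ℝ} (hT : 0 ≤ T) (hg : IntegrableOn g (Icc 0 T)) (c : ℝ) :
    ContinuousOn (fun t => c + ∫ s in 0..t, g s) (Icc 0 T) := by
  simpa [uIcc_of_le hT] using (absolutelyContinuousOnInterval_primitive hT hg c).continuousOn

theorem ae_hasDerivAt_primitive {g : ℝ → ℝ} (hT : 0 ≤ T) (hg : IntegrableOn g (Icc 0 T)) (c : ℝ) :
    ∀ᵐ t, t ∈ Icc 0 T → HasDerivAt (fun t => c + ∫ s in 0..t, g s) (g t) t := by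
  have := (intervalIntegrable_of_integrableOn_Icc hg ⟨hT, le_rfl⟩).ae_hasDerivAt_integral
  filter_upwards [this] with t ht h
  rw [uIcc_of_le hT] at ht
  exact (ht h 0 ⟨le_rfl, hT⟩).const_add c

/-- The chain rule for a primitive of an integrable function. -/
theorem comp_primitive_eq {g η : ℝ → ℝ} (hg : IntegrableOn g (Icc 0 T)) (hη : ContDiff ℝ 1 η)
    (c : ℝ) {t : ℝ} (ht : t ∈ Icc 0 T) :
    η (c + ∫ s in 0..t, g s) =
      η c + ∫ s in 0..t, deriv η (c + ∫ r in 0..s, g r) * g s := by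
  have hg' : IntegrableOn g (Icc 0 t) := hg.mono_set (Icc_subset_Icc_right ht.2)
  have h1 := (absolutelyContinuousOnInterval_comp
    (absolutelyContinuousOnInterval_primitive ht.1 hg' c) hη).integral_deriv_eq_sub
  simp only [intervalIntegral.integral_same, add_zero] at h1
  rw [← sub_eq_iff_eq_add', ← h1]
  refine intervalIntegral.integral_congr_ae ?_
  filter_upwards [ae_hasDerivAt_primitive ht.1 hg' c] with s hs hs'
  rw [uIoc_of_le ht.1] at hs'
  have := ((hη.differentiable one_ne_zero) _).hasDerivAt.comp s (hs ⟨hs'.1.le, hs'.2⟩)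
  exact this.deriv

/-- Integration by parts for primitives of integrable functions. -/
theorem primitive_mul_primitive_eq {g₁ g₂ : ℝ → ℝ} (hg₁ : IntegrableOn g₁ (Icc 0 T))
    (hg₂ : IntegrableOn g₂ (Icc 0 T)) (c₁ c₂ : ℝ) {t : ℝ} (ht : t ∈ Icc 0 T) :
    (c₁ + ∫ s in 0..t, g₁ s) * (c₂ + ∫ s in 0..t, g₂ s) =
      c₁ * c₂ + ∫ s in 0..t,
        (g₁ s * (c₂ + ∫ r in 0..s, g₂ r) + (c₁ + ∫ r in 0..s, g₁ r) * g₂ s) := by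
  have hg₁' : IntegrableOn g₁ (Icc 0 t) := hg₁.mono_set (Icc_subset_Icc_right ht.2)
  have hg₂' : IntegrableOn g₂ (Icc 0 t) := hg₂.mono_set (Icc_subset_Icc_right ht.2)
  have h1 := AbsolutelyContinuousOnInterval.integral_deriv_mul_eq_sub
    (absolutelyContinuousOnInterval_primitive ht.1 hg₁' c₁)
    (absolutelyContinuousOnInterval_primitive ht.1 hg₂' c₂)
  simp only [intervalIntegral.integral_same, add_zero] at h1
  rw [← sub_eq_iff_eq_add', ← h1]
  refine intervalIntegral.integral_congr_ae ?_
  filter_upwards [ae_hasDerivAt_primitive ht.1 hg₁' c₁,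
    ae_hasDerivAt_primitive ht.1 hg₂' c₂] with s hs₁ hs₂ hs'
  rw [uIoc_of_le ht.1] at hs'
  rw [(hs₁ ⟨hs'.1.le, hs'.2⟩).deriv, (hs₂ ⟨hs'.1.le, hs'.2⟩).deriv]

/-- Grönwall's inequality with an integrable coefficient. -/
theorem ae_le_zero_of_le_integral {y κ : ℝ → ℝ} (hκ : IntegrableOn κ (Icc 0 T))
    (hκ0 : ∀ t, 0 ≤ κ t) (hκy : IntegrableOn (fun t => κ t * y t) (Icc 0 T))
    (h : ∀ᵐ t ∂(volume.restrict (Icc 0 T)), y t ≤ ∫ s in 0..t, κ s * y s) :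
    ∀ᵐ t ∂(volume.restrict (Icc 0 T)), y t ≤ 0 := by
  -- The integrating factor is itself a primitive, so the product rule for primitives applies to it.
  have hE : ∀ s ∈ Icc 0 T, Real.exp (-∫ r in 0..s, κ r) =
      1 + ∫ r in 0..s, -Real.exp (-∫ r' in 0..r, κ r') * κ r := fun s hs => by
    have := comp_primitive_eq (η := fun x => Real.exp (-x)) hκ (by fun_prop) 0 hs
    simp only [zero_add, neg_zero, Real.exp_zero] at this
    rw [this]
    congr 1
    refine intervalIntegral.integral_congr fun r _ => ?_
    have : HasDerivAt (fun x : ℝ => Real.exp (-x)) (-Real.exp (-∫ r' in 0..r, κ r'))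
        (∫ r' in 0..r, κ r') := by
      simpa using (hasDerivAt_neg (∫ r' in 0..r, κ r')).exp
    rw [this.deriv]
  have hEint : IntegrableOn (fun r => -Real.exp (-∫ r' in 0..r, κ r') * κ r) (Icc 0 T) := by
    rcases le_or_gt 0 T with hT | hT
    · refine hκ.continuousOn_mul ?_ isCompact_Icc
      have : ContinuousOn (fun t => ∫ s in 0..t, κ s) (Icc 0 T) := by
        simpa using continuousOn_primitive hT hκ 0
      exact this.neg.rexp.neg
    · simp [hT.not_ge]
  filter_upwards [h, ae_restrict_mem measurableSet_Icc] with t hy ht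
  refine hy.trans ?_
  have h1 := primitive_mul_primitive_eq hκy hEint 0 1 ht
  rw [← hE t ht, zero_add, zero_mul, zero_add] at h1
  -- With Y = ∫ κy, the derivative of Y · exp(−∫κ) is κ (y − Y) exp(−∫κ), which is nonpositive by
  -- hypothesis.
  have h2 : (∫ s in 0..t, κ s * y s) * Real.exp (-∫ r in 0..t, κ r) ≤ 0 := by
    rw [h1, intervalIntegral.integral_of_le ht.1]
    refine integral_nonpos_of_ae ?_
    have h' := ae_mono (Measure.restrict_mono
      (Ioc_subset_Icc_self.trans (Icc_subset_Icc_right ht.2)) le_rfl) h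
    filter_upwards [h', ae_restrict_mem measurableSet_Ioc] with s hs hs'
    rw [← hE s ⟨hs'.1.le, hs'.2.trans ht.2⟩, zero_add, Pi.zero_apply]
    have := mul_nonneg (mul_nonneg (hκ0 s) (sub_nonneg.2 hs))
      (Real.exp_pos (-∫ r in 0..s, κ r)).le
    linarith
  exact nonpos_of_mul_nonpos_left h2 (Real.exp_pos _)

theorem exists_Icc_of_isCompact {K : Set ℝ} (hK : IsCompact K) (h : K ⊆ Ioo 0 T) :
    ∃ a b, 0 < a ∧ b < T ∧ K ⊆ Icc a b := by
  rcases K.eq_empty_or_nonempty with rfl | hne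
  -- This interval may be empty; only the two strict inequalities matter.
  · exact ⟨1, T - 1, one_pos, by linarith, empty_subset _⟩
  · exact ⟨sInf K, sSup K, (h (hK.sInf_mem hne)).1, (h (hK.sSup_mem hne)).2,
      fun x hx => ⟨csInf_le hK.bddBelow hx, le_csSup hK.bddAbove hx⟩⟩

/-- Smooth functions with compact support in `(0,T)`. -/
structure IsTimeTest (T : ℝ) (ζ : ℝ → ℝ) : Prop where
  contDiff : ContDiff ℝ ∞ ζ
  compact : HasCompactSupport ζ
  supp : tsupport ζ ⊆ Ioo 0 T

theorem ae_Icc_of_ae_Ioo {P : ℝ → Prop} (h : ∀ᵐ t, t ∈ Ioo 0 T → P t) :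
    ∀ᵐ t ∂(volume.restrict (Icc 0 T)), P t := by
  rw [restrict_Ioo_eq_restrict_Icc.symm, ae_restrict_iff' measurableSet_Ioo]
  exact h

theorem integral_Icc_mul_timeTest {E : Type*} [NormedAddCommGroup E] [NormedSpace ℝ E] (h : ℝ → E)
    {ζ : ℝ → ℝ} (hζ : tsupport ζ ⊆ Ioo 0 T) :
    ∫ t in Icc 0 T, ζ t • h t = ∫ t, ζ t • h t := by
  refine setIntegral_eq_integral_of_forall_compl_eq_zero fun t ht => ?_
  rw [image_eq_zero_of_notMem_tsupport fun h' => ht (Ioo_subset_Icc_self (hζ h')), zero_smul]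

theorem ae_eq_zero_of_integral_timeTest {E : Type*} [NormedAddCommGroup E] [NormedSpace ℝ E]
    [CompleteSpace E] {h : ℝ → E}
    (hh : IntegrableOn h (Icc 0 T)) (H : ∀ ζ, IsTimeTest T ζ → ∫ t in Icc 0 T, ζ t • h t = 0) :
    ∀ᵐ t ∂(volume.restrict (Icc 0 T)), h t = 0 := by
  refine ae_Icc_of_ae_Ioo (isOpen_Ioo.ae_eq_zero_of_integral_contDiff_smul_eq_zero
    (hh.mono_set Ioo_subset_Icc_self).locallyIntegrableOn fun g hg hg' hg'' => ?_)
  rw [← integral_Icc_mul_timeTest h hg'']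
  exact H g ⟨hg, hg', hg''⟩

/-- The du Bois-Reymond lemma. For a fixed bump η of integral one, g − (∫g) η has mean zero, so its
primitive is again a test function. Hence ∫ h g = (∫ h η)(∫ g) for every test function g. -/
theorem exists_ae_eq_const_of_integral_deriv_eq_zero {h : ℝ → ℝ} (hT : 0 < T)
    (hh : IntegrableOn h (Icc 0 T))
    (H : ∀ ζ, IsTimeTest T ζ → ∫ t in Icc 0 T, h t * deriv ζ t = 0) :
    ∃ k, ∀ᵐ t ∂(volume.restrict (Icc 0 T)), h t = k := by
  let B : ContDiffBump (T / 2) := ⟨T / 8, T / 4, by linarith, by linarith⟩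
  let η := B.normed volume
  have hη : IsTimeTest T η := ⟨B.contDiff_normed, B.hasCompactSupport_normed, by
    rw [B.tsupport_normed_eq, Real.closedBall_eq_Icc]
    rintro x ⟨h1, h2⟩
    simp only [B] at h1 h2
    constructor <;> linarith⟩
  have hint : ∀ g, IsTimeTest T g → IntegrableOn (fun t => h t * g t) (Icc 0 T) := fun g hg =>
    hh.mul_continuousOn hg.contDiff.continuous.continuousOn isCompact_Icc
  refine ⟨∫ t in Icc 0 T, h t * η t, ?_⟩
  set k := ∫ t in Icc 0 T, h t * η t with hk
  suffices ∀ᵐ t ∂(volume.restrict (Icc 0 T)), h t - k = 0 by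
    filter_upwards [this] with t ht; linarith
  refine ae_eq_zero_of_integral_timeTest (hh.sub (integrableOn_const (by simp))) fun g hg => ?_
  let I := ∫ t, g t
  have hI : ∫ t in Icc 0 T, g t = I := by
    simpa using integral_Icc_mul_timeTest (fun _ => (1 : ℝ)) hg.supp
  let θ : ℝ → ℝ := fun t => g t - I * η t
  have hθ : ContDiff ℝ ∞ θ := hg.contDiff.sub (contDiff_const.mul hη.contDiff)
  obtain ⟨a, b, ha, hb, hK⟩ := exists_Icc_of_isCompact (hg.compact.isCompact.union
    hη.compact.isCompact) (union_subset hg.supp hη.supp)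
  have hθ0 : ∀ t, t ∉ Icc a b → θ t = 0 := fun t ht => by
    simp only [θ]
    rw [image_eq_zero_of_notMem_tsupport fun h' => ht (hK (Or.inl h')),
      image_eq_zero_of_notMem_tsupport fun h' => ht (hK (Or.inr h'))]
    simp
  let ζ : ℝ → ℝ := fun t => ∫ s in a..t, θ s
  have hζ' : ∀ t, HasDerivAt ζ (θ t) t := fun t =>
    (hθ.continuous.integral_hasStrictDerivAt a t).hasDerivAt
  have hder : deriv ζ = θ := funext fun t => (hζ' t).deriv
  have hζc : ContDiff ℝ ∞ ζ :=
    contDiff_infty_iff_deriv.2 ⟨fun t => (hζ' t).differentiableAt, by rw [hder]; exact hθ⟩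
  have hθI : ∫ t, θ t = 0 := by
    simp only [θ]
    rw [integral_sub (hg.contDiff.continuous.integrable_of_hasCompactSupport hg.compact)
      ((hη.contDiff.continuous.integrable_of_hasCompactSupport hη.compact).const_mul I),
      integral_const_mul, B.integral_normed]
    simp [I]
  have hζ0 : ∀ t, t ∉ Icc a b → ζ t = 0 := fun t ht => by
    rcases lt_or_ge t a with h1 | h1
    · simp only [ζ]
      rw [intervalIntegral.integral_symm, intervalIntegral.integral_of_le h1.le,
        integral_Ioc_eq_integral_Ioo, setIntegral_congr_fun (g := fun _ => 0) measurableSet_Ioo]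
      · simp
      · exact fun s hs => hθ0 s fun h' => h'.1.not_gt hs.2
    · have h2 : b < t := not_le.1 fun h' => ht ⟨h1, h'⟩
      simp only [ζ]
      rw [intervalIntegral.integral_of_le h1, ← integral_Icc_eq_integral_Ioc, ← hθI]
      exact setIntegral_eq_integral_of_forall_compl_eq_zero fun s hs =>
        hθ0 s fun h' => hs ⟨h'.1, h'.2.trans h2.le⟩
  have hts : tsupport ζ ⊆ Icc a b := closure_minimal
    (fun t ht => by_contra fun h' => ht (hζ0 t h')) isClosed_Icc
  have hζ : IsTimeTest T ζ := ⟨hζc, isCompact_Icc.of_isClosed_subset (isClosed_tsupport _) hts,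
    hts.trans fun t ht => ⟨ha.trans_le ht.1, ht.2.trans_lt hb⟩⟩
  have h0 := H ζ hζ
  rw [hder] at h0
  have h1 : ∫ t in Icc 0 T, h t * θ t = (∫ t in Icc 0 T, h t * g t) - I * k := by
    rw [hk, ← integral_const_mul, ← integral_sub (hint g hg) ((hint η hη).const_mul I)]
    exact integral_congr_ae (.of_forall fun t => by simp only [θ]; ring)
  have h2 : ∫ t in Icc 0 T, g t • (h t - k) = (∫ t in Icc 0 T, h t * g t) - I * k := by
    rw [← hI, ← integral_mul_const, ← integral_sub (hint g hg)]
    · exact integral_congr_ae (.of_forall fun t => by simp only [smul_eq_mul]; ring)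
    · exact (hg.contDiff.continuous.continuousOn.integrableOn_compact isCompact_Icc).mul_const k
  rw [h2, ← h1, h0]

theorem IsTimeTest.deriv {ζ : ℝ → ℝ} (hζ : IsTimeTest T ζ) : IsTimeTest T (deriv ζ) :=
  ⟨(contDiff_infty_iff_deriv.1 hζ.contDiff).2, hζ.compact.deriv,
    tsupport_deriv_subset.trans hζ.supp⟩

/-- A function with an integrable weak derivative is a primitive of it, up to a constant. -/
theorem exists_ae_eq_primitive {c g : ℝ → ℝ} (hT : 0 < T) (hc : IntegrableOn c (Icc 0 T))
    (hg : IntegrableOn g (Icc 0 T))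
    (H : ∀ ζ, IsTimeTest T ζ →
      ∫ t in Icc 0 T, c t * deriv ζ t = -∫ t in Icc 0 T, g t * ζ t) :
    ∃ k, ∀ᵐ t ∂(volume.restrict (Icc 0 T)), c t = k + ∫ s in 0..t, g s := by
  have hD : ContinuousOn (fun t => ∫ s in 0..t, g s) (Icc 0 T) := by
    simpa using continuousOn_primitive hT.le hg 0
  -- Subtracting the primitive of g leaves a function whose weak derivative is zero.
  obtain ⟨k, hk⟩ := exists_ae_eq_const_of_integral_deriv_eq_zero
    (h := fun t => c t - ∫ s in 0..t, g s) hT (hc.sub (hD.integrableOn_compact isCompact_Icc))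
    fun ζ hζ => by
      have hζc := hζ.deriv.contDiff.continuous
      have hζ0 : ζ 0 = 0 := image_eq_zero_of_notMem_tsupport fun h => lt_irrefl _ (hζ.supp h).1
      have hζT : ζ T = 0 := image_eq_zero_of_notMem_tsupport fun h => lt_irrefl _ (hζ.supp h).2
      have hp : ∀ t, ∫ s in 0..t, deriv ζ s = ζ t := fun t => by
        rw [intervalIntegral.integral_deriv_eq_sub
          (fun s _ => hζ.contDiff.differentiable (by simp) s) (hζc.intervalIntegrable _ _), hζ0,
          sub_zero]
      have h1 := primitive_mul_primitive_eq hg (g₂ := deriv ζ)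
        (hζc.continuousOn.integrableOn_compact isCompact_Icc) 0 0 ⟨hT.le, le_rfl⟩
      simp only [hp, hζT, zero_add, mul_zero] at h1
      have i1 : IntegrableOn (fun t => g t * ζ t) (Icc 0 T) :=
        hg.mul_continuousOn hζ.contDiff.continuous.continuousOn isCompact_Icc
      have i2 : IntegrableOn (fun t => (∫ s in 0..t, g s) * deriv ζ t) (Icc 0 T) :=
        (hD.mul hζc.continuousOn).integrableOn_compact isCompact_Icc
      have i3 : IntegrableOn (fun t => c t * deriv ζ t) (Icc 0 T) :=
        hc.mul_continuousOn hζc.continuousOn isCompact_Icc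
      rw [intervalIntegral.integral_of_le hT.le, ← integral_Icc_eq_integral_Ioc,
        integral_add i1 i2] at h1
      simp only [sub_mul]
      rw [integral_sub i3 i2, H ζ hζ]
      linarith
  refine ⟨k, ?_⟩
  filter_upwards [hk] with t ht
  linarith

theorem tendsto_average_of_continuous {F : ℝ → ℝ} (hF : Continuous F) :
    Tendsto (fun h : ℝ => h⁻¹ * ∫ s in (0 : ℝ)..h, F s) (𝓝[>] 0) (𝓝 (F 0)) := by
  have := (hF.integral_hasStrictDerivAt 0 0).hasDerivAt.tendsto_slope_zero_right
  simpa using this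

/-- Extending the primitive by constants outside [0,T] yields a function continuous on ℝ, so the
limits of averages at both endpoints follow from the two-sided fundamental theorem of calculus. -/
theorem exists_continuous_ae_eq {f g : ℝ → ℝ} {c : ℝ} (hT : 0 < T) (hg : IntegrableOn g (Icc 0 T))
    (h : ∀ᵐ t ∂(volume.restrict (Icc 0 T)), f t = c + ∫ s in 0..t, g s) :
    ∃ F : ℝ → ℝ, Continuous F ∧ F 0 = c ∧ F T = c + ∫ s in 0..T, g s ∧
      ∀ᵐ t ∂(volume.restrict (Icc 0 T)), f t = F t := by
  have hc := continuousOn_primitive hT.le hg c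
  refine ⟨IccExtend hT.le ((Icc 0 T).domRestrict fun t => c + ∫ s in 0..t, g s),
    hc.domRestrict.Icc_extend', ?_, ?_, ?_⟩
  · rw [IccExtend_of_mem hT.le _ (left_mem_Icc.2 hT.le), domRestrict_apply]; simp
  · rw [IccExtend_of_mem hT.le _ (right_mem_Icc.2 hT.le), domRestrict_apply]
  · filter_upwards [h, ae_restrict_mem measurableSet_Icc] with t ht ht'
    rw [IccExtend_of_mem hT.le _ ht', domRestrict_apply, ht]

theorem tendsto_initial_average {f g : ℝ → ℝ} {c : ℝ} (hT : 0 < T) (hg : IntegrableOn g (Icc 0 T))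
    (h : ∀ᵐ t ∂(volume.restrict (Icc 0 T)), f t = c + ∫ s in 0..t, g s) :
    Tendsto (fun h : ℝ => h⁻¹ * ∫ s in (0 : ℝ)..h, f s) (𝓝[>] 0) (𝓝 c) := by
  obtain ⟨F, hF, h0, -, hae⟩ := exists_continuous_ae_eq hT hg h
  refine (h0 ▸ tendsto_average_of_continuous hF).congr' ?_
  filter_upwards [Ioo_mem_nhdsGT hT] with r hr
  congr 1
  rw [intervalIntegral.integral_of_le hr.1.le, intervalIntegral.integral_of_le hr.1.le]
  refine integral_congr_ae (ae_mono (Measure.restrict_mono ?_ le_rfl) (hae.mono fun _ h => h.symm))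
  exact fun s hs => ⟨hs.1.le, hs.2.trans hr.2.le⟩

theorem tendsto_terminal_average {f g : ℝ → ℝ} {c : ℝ} (hT : 0 < T)
    (hg : IntegrableOn g (Icc 0 T))
    (h : ∀ᵐ t ∂(volume.restrict (Icc 0 T)), f t = c + ∫ s in 0..t, g s) :
    Tendsto (fun h : ℝ => h⁻¹ * ∫ s in (T - h)..T, f s) (𝓝[>] 0)
      (𝓝 (c + ∫ s in 0..T, g s)) := by
  obtain ⟨F, hF, -, h1, hae⟩ := exists_continuous_ae_eq hT hg h
  have h2 := tendsto_average_of_continuous (F := fun s => F (T - s)) (by fun_prop)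
  simp only [sub_zero, h1] at h2
  refine h2.congr' ?_
  filter_upwards [Ioo_mem_nhdsGT hT] with r hr
  congr 1
  rw [intervalIntegral.integral_comp_sub_left (fun s => F s), sub_zero,
    intervalIntegral.integral_of_le (by linarith [hr.1]),
    intervalIntegral.integral_of_le (by linarith [hr.1])]
  refine integral_congr_ae (ae_mono (Measure.restrict_mono ?_ le_rfl) (hae.mono fun _ h => h.symm))
  exact fun s hs => ⟨by linarith [hs.1, hr.2], hs.2⟩

end MFGC

namespace MFGC

open UnitAddTorus

/-! ### Almost everywhere statements on products -/

section Prod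

variable {α β : Type*} [MeasurableSpace α] [MeasurableSpace β] {μ : Measure α} {ν : Measure β}
  [SFinite ν]

/-- This converse of Fubini for null sets needs a measurable exceptional set, hence the passage to
strongly measurable representatives. -/
theorem ae_prod_eq_of_ae_ae {f g : α × β → ℝ} (hf : AEStronglyMeasurable f (μ.prod ν))
    (hg : AEStronglyMeasurable g (μ.prod ν))
    (h : ∀ᵐ x ∂μ, ∀ᵐ y ∂ν, f (x, y) = g (x, y)) : f =ᵐ[μ.prod ν] g := by
  have h1 : hf.mk f =ᵐ[μ.prod ν] hg.mk g := by
    refine (Measure.ae_prod_iff_ae_ae ?_).2 ?_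
    · exact measurableSet_eq_fun hf.stronglyMeasurable_mk.measurable
        hg.stronglyMeasurable_mk.measurable
    · filter_upwards [h, Measure.ae_ae_of_ae_prod hf.ae_eq_mk,
        Measure.ae_ae_of_ae_prod hg.ae_eq_mk] with x h1 h2 h3
      filter_upwards [h1, h2, h3] with y h1 h2 h3
      rw [← h2, ← h3, h1]
  exact hf.ae_eq_mk.trans (h1.trans hg.ae_eq_mk.symm)

variable [SFinite μ]

theorem ae_swap_of_ae_prod {p : α × β → Prop} (h : ∀ᵐ z ∂μ.prod ν, p z) :
    ∀ᵐ y ∂ν, ∀ᵐ x ∂μ, p (x, y) := by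
  have : ∀ᵐ z ∂ν.prod μ, p z.swap := by
    rw [← Measure.prod_swap] at h
    exact ae_of_ae_map measurable_swap.aemeasurable h
  exact Measure.ae_ae_of_ae_prod this

theorem ae_prod_eq_of_ae_ae_swap {f g : α × β → ℝ} (hf : AEStronglyMeasurable f (μ.prod ν))
    (hg : AEStronglyMeasurable g (μ.prod ν))
    (h : ∀ᵐ y ∂ν, ∀ᵐ x ∂μ, f (x, y) = g (x, y)) : f =ᵐ[μ.prod ν] g := by
  have h1 := ae_prod_eq_of_ae_ae hf.prod_swap hg.prod_swap h
  have h2 : ∀ᵐ z ∂ν.prod μ, f z.swap = g z.swap := h1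
  have h3 := (Measure.measurePreserving_swap (μ := μ) (ν := ν)).quasiMeasurePreserving.ae h2
  exact h3.mono fun z hz => by simpa using hz

/-- The primitive is a partial integral over s of the indicator of s ≤ t times u(x,s), which is
jointly measurable in (x,t,s). -/
theorem aestronglyMeasurable_primitive {T : ℝ} {u : α × ℝ → ℝ}
    (hu : AEStronglyMeasurable u (μ.prod (volume.restrict (Icc 0 T)))) :
    AEStronglyMeasurable (fun z : α × ℝ => ∫ s in 0..z.2, u (z.1, s))
      (μ.prod (volume.restrict (Icc 0 T))) := by
  set ν := volume.restrict (Icc (0 : ℝ) T)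
  have hq : Measure.QuasiMeasurePreserving (fun w : (α × ℝ) × ℝ => (w.1.1, w.2))
      ((μ.prod ν).prod ν) (μ.prod ν) :=
    QuasiMeasurePreserving.prodMap (Measure.quasiMeasurePreserving_fst (μ := μ) (ν := ν))
      (Measure.QuasiMeasurePreserving.id ν)
  have h1 := (hu.comp_quasiMeasurePreserving hq).indicator
    (s := {w : (α × ℝ) × ℝ | w.2 ≤ w.1.2})
    (measurableSet_le measurable_snd (measurable_snd.comp measurable_fst))
  refine h1.integral_prod_right'.congr ?_
  have h0 : ∀ᵐ z ∂μ.prod ν, z.2 ∈ Icc 0 T :=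
    Measure.quasiMeasurePreserving_snd.ae (ae_restrict_mem measurableSet_Icc)
  filter_upwards [h0] with z hz
  rw [intervalIntegral.integral_of_le hz.1, ← integral_Icc_eq_integral_Ioc,
    ← integral_indicator measurableSet_Icc, ← integral_indicator measurableSet_Icc]
  refine integral_congr_ae (.of_forall fun s => ?_)
  by_cases h1 : s ∈ Icc 0 z.2
  · have h2 : s ∈ Icc 0 T := ⟨h1.1, h1.2.trans hz.2⟩
    simp [indicator, h2.1, h2.2, h1.2]
  · simp only [indicator, mem_Icc, mem_ofPred_eq, Function.comp]
    have : ¬(0 ≤ s ∧ s ≤ z.2) := h1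
    split_ifs <;> simp_all

end Prod

/-! ### Averages of translates, and the chain rule along lines -/

variable {d : ℕ}

theorem quasiMeasurePreserving_add {α : Type*} [MeasurableSpace α] {ν : Measure α} [SFinite ν]
    {a : α → Torus d} (ha : Measurable a) :
    Measure.QuasiMeasurePreserving (fun z : Torus d × α => z.1 + a z.2) (volume.prod ν) volume :=
  QuasiMeasurePreserving.prod_of_left (by fun_prop)
    (.of_forall fun s => (measurePreserving_add_right volume (a s)).quasiMeasurePreserving)

theorem integrable_mul_translate {α : Type*} [MeasurableSpace α] {ν : Measure α}
    [IsFiniteMeasure ν] {a : α → Torus d} (ha : Measurable a) {c : α → ℝ} (hc : Measurable c)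
    {C : ℝ} (hC : ∀ᵐ s ∂ν, |c s| ≤ C) {g : Torus d → ℝ} (hg : Integrable g) :
    Integrable (fun z : Torus d × α => c z.2 * g (z.1 + a z.2)) (volume.prod ν) := by
  have hm : AEStronglyMeasurable (fun z : Torus d × α => g (z.1 + a z.2)) (volume.prod ν) :=
    hg.aestronglyMeasurable.comp_quasiMeasurePreserving (quasiMeasurePreserving_add ha)
  have h1 : Integrable (fun z : Torus d × α => g (z.1 + a z.2)) (volume.prod ν) := by
    refine (integrable_prod_iff' hm).2 ⟨.of_forall fun s => hg.comp_add_right (a s), ?_⟩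
    have : ∀ s, ∫ x, ‖g (x + a s)‖ = ∫ x, ‖g x‖ := fun s =>
      integral_add_right_eq_self (fun x => ‖g x‖) (a s)
    simp only [this]
    exact integrable_const _
  refine h1.bdd_mul (c := C) (hc.comp measurable_snd).aestronglyMeasurable ?_
  exact Measure.quasiMeasurePreserving_snd.ae hC

theorem norm_mFourier_le (n : Fin d → ℤ) (x : Torus d) : ‖mFourier n x‖ ≤ 1 :=
  ((mFourier n).norm_coe_le_norm x).trans mFourier_norm.le

theorem ch_integral_prod {β : Type*} [MeasurableSpace β] {ν : Measure β}
    [SFinite ν] {G : Torus d × β → ℝ} (hG : Integrable G (volume.prod ν)) (n : Fin d → ℤ) :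
    ch (fun x => ∫ s, G (x, s) ∂ν) n = ∫ s, ch (fun x => G (x, s)) n ∂ν := by
  have h1 : Integrable (fun z : Torus d × β => (G z : ℂ) * mFourier n z.1) (volume.prod ν) := by
    refine hG.ofReal.mul_bdd (c := 1) ?_ (.of_forall fun z => norm_mFourier_le n z.1)
    exact ((mFourier n).continuous.measurable.comp measurable_fst).aestronglyMeasurable
  simp only [ch]
  rw [integral_integral_swap (f := fun s x => (G (x, s) : ℂ) * mFourier n x) (by
    exact h1.swap)]
  refine integral_congr_ae (.of_forall fun x => ?_)
  simp only
  rw [integral_mul_const, integral_complex_ofReal]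

/-- A weighted average of translates is a Fourier multiplier. The fundamental theorem of calculus
along lines and the representation behind Morrey's inequality both reduce to computing such a
multiplier. -/
theorem ch_integral_translate {α : Type*} [MeasurableSpace α] {ν : Measure α}
    [IsFiniteMeasure ν] {a : α → Torus d} (ha : Measurable a) {c : α → ℝ} (hc : Measurable c)
    {C : ℝ} (hC : ∀ᵐ s ∂ν, |c s| ≤ C) {g : Torus d → ℝ} (hg : Integrable g) (n : Fin d → ℤ) :
    ch (fun x => ∫ s, c s * g (x + a s) ∂ν) n =
      (∫ s, (c s : ℂ) * mFourier n (-a s) ∂ν) * ch g n := by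
  rw [ch_integral_prod (integrable_mul_translate ha hc hC hg), ← integral_mul_const]
  refine integral_congr_ae (.of_forall fun s => ?_)
  simp only
  rw [mul_assoc, ← ch_translate, ch, ch, ← integral_const_mul]
  refine integral_congr_ae (.of_forall fun x => ?_)
  simp only
  push_cast; ring

theorem exp_mul_sub_one_eq (κ : ℂ) {h : ℝ} (hh : 0 ≤ h) :
    κ * ∫ s in Icc 0 h, Complex.exp (κ * s) = Complex.exp (κ * h) - 1 := by
  rw [integral_Icc_eq_integral_Ioc, ← intervalIntegral.integral_of_le hh]
  rcases eq_or_ne κ 0 with rfl | hκ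
  · simp
  · rw [integral_exp_mul_complex hκ]
    field_simp
    simp

/-- The frequency of the character `n` in the direction `y`. -/
def freq (n : Fin d → ℤ) (y : Vec d) : ℂ := -(2 * Real.pi * Complex.I * ∑ i, n i * y i)

theorem mFourier_neg_proj_smul (n : Fin d → ℤ) (y : Vec d) (s : ℝ) :
    mFourier n (-proj (s • y)) = Complex.exp (freq n y * s) := by
  have : -proj (s • y) = proj (-(s • y)) := by ext i; simp [proj]
  rw [this, mFourier_proj, freq]
  congr 1
  push_cast [PiLp.neg_apply, PiLp.smul_apply, smul_eq_mul]
  rw [Finset.mul_sum, Finset.mul_sum, ← Finset.sum_neg_distrib, Finset.sum_mul]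
  exact Finset.sum_congr rfl fun i _ => by ring

theorem measurable_proj_smul (y : Vec d) : Measurable fun s : ℝ => proj (s • y) :=
  measurable_proj.comp (by fun_prop)

/-- The fundamental theorem of calculus along a line. -/
theorem ae_eq_add_integral_line {f G : Torus d → ℝ} {y : Vec d} (hf : Integrable f)
    (hG : Integrable G) (h : ∀ n, ch G n = freq n y * ch f n) {r : ℝ} (hr : 0 ≤ r) :
    (fun x => f (x + proj (r • y))) =ᵐ[volume]
      fun x => f x + ∫ s in Icc 0 r, G (x + proj (s • y)) := by
  have hm := measurable_proj_smul y
  have h1 := integrable_mul_translate (ν := volume.restrict (Icc 0 r)) hm (c := fun _ => 1)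
    measurable_const (C := 1) (by simp) hG
  simp only [one_mul] at h1
  -- Both sides have n-th coefficient (exp(κr) − 1) times that of f, where κ = `freq n y`.
  have key := ae_eq_of_ch (f := fun x => f (x + proj (r • y)) - f x)
    ((hf.comp_add_right _).sub hf) h1.integral_prod_left fun n => by
      rw [ch_sub (hf.comp_add_right _) hf, ch_translate, mFourier_neg_proj_smul]
      have := ch_integral_translate (ν := volume.restrict (Icc 0 r)) hm (c := fun _ => 1)
        measurable_const (C := 1) (by simp) hG n
      simp only [one_mul, Complex.ofReal_one] at this
      rw [this, h n]
      simp only [mFourier_neg_proj_smul]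
      have e := exp_mul_sub_one_eq (freq n y) hr
      linear_combination ch f n * (-e)
  filter_upwards [key] with x hx
  rw [← hx]; ring

theorem freq_single (n : Fin d → ℤ) (i : Fin d) :
    freq n (EuclideanSpace.single i 1) = -(2 * Real.pi * Complex.I * n i) := by
  simp [freq, Finset.sum_ite_eq']

/-- An irrational step r is needed so that exp(2πi n r) ≠ 1 for every nonzero integer n. -/
theorem exists_irrational_of_ae {P : ℝ → Prop}
    (h : ∀ᵐ r ∂(volume.restrict (Icc (0 : ℝ) 1)), P r) :
    ∃ r : ℝ, 0 < r ∧ Irrational r ∧ P r := by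
  have h1 : ∀ᵐ r ∂(volume.restrict (Icc (0 : ℝ) 1)), Irrational r :=
    ae_restrict_of_ae ((countable_range (Rat.cast : ℚ → ℝ)).ae_notMem volume)
  have : NeBot (ae (volume.restrict (Icc (0 : ℝ) 1))) := by
    rw [ae_neBot, Ne, Measure.restrict_eq_zero]; simp
  obtain ⟨r, h1, h2, h3⟩ := (h.and (h1.and (ae_restrict_mem measurableSet_Icc))).exists
  exact ⟨r, lt_of_le_of_ne h3.1 (fun h0 => h2 ⟨0, by simp [← h0]⟩), h2, h1⟩

/-- The chain rule for weak derivatives on the torus. -/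
theorem HasTorusDeriv.comp {i : Fin d} {f g : Torus d → ℝ} {η : ℝ → ℝ} (h : HasTorusDeriv i f g)
    (hη : ContDiff ℝ 1 η) (hf : Integrable f) (hg : Integrable g)
    (hηf : Integrable fun x => η (f x)) (hηg : Integrable fun x => deriv η (f x) * g x) :
    HasTorusDeriv i (fun x => η (f x)) (fun x => deriv η (f x) * g x) := by
  set y : Vec d := EuclideanSpace.single i 1
  have hm := measurable_proj_smul y
  set ν := volume.restrict (Icc (0 : ℝ) 1)
  have hI : ∀ k : Torus d → ℝ, Integrable k →
      Integrable (fun z : Torus d × ℝ => k (z.1 + proj (z.2 • y))) (volume.prod ν) := fun k hk => by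
    simpa using integrable_mul_translate (ν := ν) hm (c := fun _ => 1)
      measurable_const (C := 1) (by simp) hk
  have hfst : ∀ k : Torus d → ℝ, Integrable k →
      AEStronglyMeasurable (fun z : Torus d × ℝ => k z.1) (volume.prod ν) := fun k hk =>
    hk.aestronglyMeasurable.comp_quasiMeasurePreserving Measure.quasiMeasurePreserving_fst
  -- On almost every line in direction i, f coincides almost everywhere with a primitive of g, so
  -- the one-dimensional chain rule applies line by line.
  have hline : ∀ᵐ z ∂(volume.prod ν), f (z.1 + proj (z.2 • y)) =
      f z.1 + ∫ s in 0..z.2, g (z.1 + proj (s • y)) := by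
    refine ae_prod_eq_of_ae_ae_swap (hI f hf).aestronglyMeasurable
      ((hfst f hf).add (aestronglyMeasurable_primitive (hI g hg).aestronglyMeasurable)) ?_
    filter_upwards [ae_restrict_mem measurableSet_Icc] with r hr
    filter_upwards [ae_eq_add_integral_line hf hg (fun n => by rw [h n, freq_single]) hr.1] with x hx
    rw [hx, intervalIntegral.integral_of_le hr.1, integral_Icc_eq_integral_Ioc]
  have hline' : ∀ᵐ z ∂(volume.prod ν), η (f (z.1 + proj (z.2 • y))) =
      η (f z.1) + ∫ s in 0..z.2,
        deriv η (f (z.1 + proj (s • y))) * g (z.1 + proj (s • y)) := by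
    refine ae_prod_eq_of_ae_ae (hI _ hηf).aestronglyMeasurable ((hfst _ hηf).add
      (aestronglyMeasurable_primitive (hI _ hηg).aestronglyMeasurable)) ?_
    filter_upwards [Measure.ae_ae_of_ae_prod hline, (hI g hg).prod_right_ae] with x hx hgx
    filter_upwards [hx, ae_restrict_mem measurableSet_Icc] with r hr hr'
    rw [hr, comp_primitive_eq hgx hη _ hr']
    congr 1
    refine intervalIntegral.integral_congr_ae ?_
    rw [uIoc_of_le hr'.1]
    have := (ae_restrict_iff' measurableSet_Icc).1 hx
    filter_upwards [this] with s hs hs'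
    rw [hs ⟨hs'.1.le, hs'.2.trans hr'.2⟩]
  intro n
  -- For one fixed irrational r, the integrated chain rule is an identity between functions on the
  -- torus. Its coefficients give the claim multiplied by exp(κr) − 1, a factor that vanishes only
  -- when κ = 0.
  obtain ⟨r, hr0, hirr, hr⟩ := exists_irrational_of_ae (ae_swap_of_ae_prod hline')
  have e1 : ch (fun x => η (f (x + proj (r • y))) - η (f x)) n =
      ch (fun x => ∫ s in Icc 0 r, deriv η (f (x + proj (s • y))) * g (x + proj (s • y))) n := by
    refine ch_congr ?_ n
    filter_upwards [hr] with x hx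
    rw [hx, intervalIntegral.integral_of_le hr0.le, integral_Icc_eq_integral_Ioc]; ring
  have e2 := ch_integral_translate (ν := volume.restrict (Icc 0 r)) hm (c := fun _ => 1)
    measurable_const (C := 1) (by simp) hηg n
  simp only [one_mul, Complex.ofReal_one] at e2
  rw [ch_sub (hηf.comp_add_right (proj (r • y))) hηf, ch_translate (fun x => η (f x)), e2] at e1
  simp only [mFourier_neg_proj_smul] at e1
  have e3 := exp_mul_sub_one_eq (freq n y) hr0.le
  rw [← freq_single]
  change _ = freq n y * _
  rcases eq_or_ne (freq n y) 0 with h0 | h0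
  -- At zero frequency the identity reads 0 = r · ĝ(n) with r > 0, where ĝ(n) is the coefficient of
  -- the candidate derivative.
  · simp only [h0, zero_mul, Complex.exp_zero, one_mul, sub_self] at e1 ⊢
    rcases mul_eq_zero.1 e1.symm with h1 | h1
    · simp [hr0.le, hr0.ne'] at h1
    · exact h1
  · have hne : Complex.exp (freq n y * r) - 1 ≠ 0 := fun h1 => by
      rw [sub_eq_zero, Complex.exp_eq_one_iff] at h1
      obtain ⟨m, hm⟩ := h1
      rw [freq_single] at hm h0
      have hn : n i ≠ 0 := fun h' => h0 (by simp [h'])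
      have hπ : (2 * Real.pi * Complex.I : ℂ) ≠ 0 := by simp [Real.pi_ne_zero]
      have : ((-(n i : ℝ) * r : ℝ) : ℂ) = ((m : ℝ) : ℂ) := by
        apply mul_right_cancel₀ hπ
        push_cast
        linear_combination hm
      have h2 : (n i : ℝ) * r = -m := by
        have := Complex.ofReal_injective this
        linarith
      refine hirr ⟨-m / n i, ?_⟩
      push_cast
      rw [← h2]; field_simp
    apply mul_left_cancel₀ hne
    linear_combination (-ch (fun x => deriv η (f x) * g x) n) * e3 - freq n y * e1

end MFGC

namespace MFGC

open UnitAddTorus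

variable {d : ℕ}

/-! ### Morrey's inequality on the torus -/

/-- The uniform measure on the unit cube. -/
def cube (d : ℕ) : Measure (Fin d → ℝ) := Measure.pi fun _ => volume.restrict (Ioc (0 : ℝ) 1)

theorem cube_eq_restrict :
    cube d = (volume : Measure (Fin d → ℝ)).restrict (univ.pi fun _ => Ioc (0 : ℝ) 1) := by
  rw [cube, volume_pi, Measure.restrict_pi_pi]

instance : IsProbabilityMeasure (cube d) := by
  have : IsProbabilityMeasure (volume.restrict (Ioc (0 : ℝ) 1)) := ⟨by simp⟩
  rw [cube]; infer_instance

theorem measurePreserving_proj_toLp :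
    MeasurePreserving (fun y : Fin d → ℝ => (proj (WithLp.toLp 2 y) : Torus d)) (cube d) volume := by
  have := measurePreserving_pi (fun _ : Fin d => volume.restrict (Ioc (0 : ℝ) 1))
    (fun _ => (volume : Measure UnitAddCircle))
    (f := fun _ x => (x : UnitAddCircle)) (fun i => by
      have := UnitAddCircle.measurePreserving_mk 0
      rwa [zero_add] at this)
  exact this

theorem integral_mFourier (n : Fin d → ℤ) : ∫ x : Torus d, mFourier n x = if n = 0 then 1 else 0 := by
  split_ifs with h
  · simp [h, mFourier_zero]
  · obtain ⟨i, hi⟩ := Function.ne_iff.1 h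
    -- Translation by half a period changes the sign of the character but not its integral.
    let y : Vec d := EuclideanSpace.single i (1 / (2 * n i : ℝ))
    have hi' : (n i : ℂ) ≠ 0 := by exact_mod_cast hi
    have h1 : mFourier n (proj y) = -1 := by
      rw [mFourier_proj]
      have : ∑ j, (n j : ℝ) * y j = 1 / 2 := by
        rw [Finset.sum_eq_single i]
        · have : (n i : ℝ) ≠ 0 := by exact_mod_cast hi
          simp only [y, PiLp.single_apply, if_true]
          field_simp
        · intro j _ hj; simp [y, hj]
        · simp
      have h2 : ((∑ j, (n j : ℝ) * y j : ℝ) : ℂ) = 1 / 2 := by rw [this]; push_cast; rfl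
      push_cast at h2 ⊢
      rw [h2, ← Complex.exp_pi_mul_I]
      congr 1; ring
    have h2 := integral_add_right_eq_self (μ := (volume : Measure (Torus d)))
      (fun x => mFourier n x) (proj y)
    simp only [mFourier_apply_add, h1] at h2
    rw [integral_mul_const] at h2
    linear_combination (-1 / 2 : ℂ) * h2

theorem integral_cube_mFourier (n : Fin d → ℤ) :
    ∫ y, mFourier n (-proj (WithLp.toLp 2 y)) ∂(cube d) = if n = 0 then 1 else 0 := by
  have hmp := measurePreserving_proj_toLp (d := d)
  have h1 := integral_map (μ := cube d) hmp.measurable.aemeasurable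
    (f := fun x : Torus d => mFourier n (-x))
    (((mFourier n).continuous.comp continuous_neg).aestronglyMeasurable)
  have h2 : ∀ x : Torus d, mFourier n (-x) = mFourier (-n) x := fun x => by
    simp [mFourier, fourier_apply]
  rw [← h1, hmp.map_eq]
  simp only [h2, integral_mFourier, neg_eq_zero]

/-- Scaling by s ≤ 1 maps the cube into itself, and the Jacobian of the change of variables is s⁻ᵈ.
-/
theorem lintegral_cube_smul_le {Φ : (Fin d → ℝ) → ℝ≥0∞} (hΦ : Measurable Φ) {s : ℝ} (hs : 0 < s)
    (hs1 : s ≤ 1) :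
    ∫⁻ y, Φ (s • y) ∂(cube d) ≤ ENNReal.ofReal ((s ^ d)⁻¹) * ∫⁻ y, Φ y ∂(cube d) := by
  set S : Set (Fin d → ℝ) := univ.pi fun _ => Ioc (0 : ℝ) 1
  have hS : MeasurableSet S := MeasurableSet.univ_pi fun _ => measurableSet_Ioc
  rw [cube_eq_restrict, ← lintegral_indicator hS, ← lintegral_indicator hS]
  calc ∫⁻ y, S.indicator (fun y => Φ (s • y)) y ≤ ∫⁻ y, S.indicator Φ (s • y) := by
        refine lintegral_mono fun y => ?_
        by_cases hy : y ∈ S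
        · have : s • y ∈ S := fun i _ => ⟨mul_pos hs (hy i trivial).1,
            mul_le_one₀ hs1 (hy i trivial).1.le (hy i trivial).2⟩
          rw [indicator_of_mem hy, indicator_of_mem this]
        · rw [indicator_of_notMem hy]; exact zero_le
    _ = ∫⁻ y, S.indicator Φ y ∂(Measure.map (s • ·) volume) :=
        (lintegral_map (hΦ.indicator hS) (measurable_const_smul s)).symm
    _ = _ := by
        rw [Measure.map_addHaar_smul _ hs.ne', lintegral_smul_measure]
        simp [abs_of_pos hs]

/-- The constant in Morrey's inequality. -/
def morreyConst (d : ℕ) (p : ℝ) : ℝ≥0∞ :=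
  ∫⁻ s in Icc (0 : ℝ) 1, ENNReal.ofReal (s ^ (-(d / p)))

theorem morreyConst_ne_top {p : ℝ} (hp : d < p) : morreyConst d p ≠ ⊤ := by
  have hp0 : 0 < p := (Nat.cast_nonneg d).trans_lt hp
  have h1 : IntervalIntegrable (fun s : ℝ => s ^ (-(d / p))) volume 0 1 :=
    intervalIntegral.intervalIntegrable_rpow' (by
      rw [neg_lt_neg_iff, div_lt_one hp0]; exact hp)
  rw [intervalIntegrable_iff_integrableOn_Icc_of_le zero_le_one] at h1
  exact h1.lintegral_lt_top.ne

/-- For fixed s, the L¹ norm over the unit cube is at most the Lᵖ norm, and undoing the scaling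
costs s^(−d/p) after the p-th root. This power is integrable near 0 when d < p. -/
theorem lintegral_translate_le {p : ℝ} (hp : 1 ≤ p) {g : Torus d → ℝ} (hg : Measurable g)
    (x : Torus d) :
    ∫⁻ z : ℝ × (Fin d → ℝ), ‖g (x + proj (z.1 • WithLp.toLp 2 z.2))‖ₑ
      ∂((volume.restrict (Icc (0 : ℝ) 1)).prod (cube d)) ≤
    morreyConst d p * eLpNorm g (ENNReal.ofReal p) volume := by
  have hp0 : 0 < p := one_pos.trans_le hp
  have hpe : ENNReal.ofReal p ≠ 0 := by simpa using hp0
  have hm : Measurable fun z : ℝ × (Fin d → ℝ) => g (x + proj (z.1 • WithLp.toLp 2 z.2)) := by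
    refine hg.comp (measurable_const.add (measurable_proj.comp ?_))
    fun_prop
  rw [lintegral_prod _ hm.enorm.aemeasurable, morreyConst]
  rw [← lintegral_mul_const _ (by fun_prop)]
  refine lintegral_mono_ae ?_
  have hne : ∀ᵐ s ∂(volume.restrict (Icc (0 : ℝ) 1)), s ≠ 0 :=
    ae_restrict_of_ae (by simp [ae_iff])
  filter_upwards [ae_restrict_mem measurableSet_Icc, hne] with s hs hs0
  have hspos : 0 < s := lt_of_le_of_ne hs.1 (Ne.symm hs0)
  have hms : Measurable fun y : Fin d → ℝ => g (x + proj (s • WithLp.toLp 2 y)) :=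
    hm.comp measurable_prodMk_left
  have hm1 : Measurable fun y : Fin d → ℝ => g (x + proj (WithLp.toLp 2 y)) :=
    hg.comp (measurable_const.add (measurable_proj.comp (by fun_prop)))
  have h1 := eLpNorm_le_eLpNorm_of_exponent_le (p := 1) (q := ENNReal.ofReal p) (by simpa using hp)
    hms.aestronglyMeasurable (μ := cube d)
  rw [eLpNorm_one_eq_lintegral_enorm] at h1
  refine h1.trans ?_
  rw [eLpNorm_eq_lintegral_rpow_enorm_toReal hpe (by simp),
    eLpNorm_eq_lintegral_rpow_enorm_toReal hpe (by simp), ENNReal.toReal_ofReal hp0.le]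
  have h2 := lintegral_cube_smul_le (Φ := fun y => ‖g (x + proj (WithLp.toLp 2 y))‖ₑ ^ p)
    (hm1.enorm.pow_const p) hspos hs.2
  have h3 : ∫⁻ y, ‖g (x + proj (WithLp.toLp 2 y))‖ₑ ^ p ∂(cube d) = ∫⁻ x, ‖g x‖ₑ ^ p := by
    rw [← lintegral_add_left_eq_self (fun z => ‖g z‖ₑ ^ p) x,
      ← (measurePreserving_proj_toLp (d := d)).lintegral_comp
        (f := fun z => ‖g (x + z)‖ₑ ^ p) (by fun_prop)]
  rw [h3] at h2
  calc (∫⁻ y, ‖g (x + proj (s • WithLp.toLp 2 y))‖ₑ ^ p ∂(cube d)) ^ (1 / p)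
      ≤ (ENNReal.ofReal ((s ^ d)⁻¹) * ∫⁻ x, ‖g x‖ₑ ^ p) ^ (1 / p) :=
        ENNReal.rpow_le_rpow h2 (by positivity)
    _ = _ := by
        rw [ENNReal.mul_rpow_of_nonneg _ _ (by positivity),
          ENNReal.ofReal_rpow_of_pos (by positivity)]
        congr 2
        rw [Real.rpow_neg hs.1, ← Real.rpow_natCast, Real.inv_rpow (by positivity),
          ← Real.rpow_mul hs.1]
        congr 2; ring

/-- **Morrey's inequality** on the torus. -/
theorem ae_enorm_le_of_hasTorusDeriv {p : ℝ} (hp1 : 1 ≤ p) {f : Torus d → ℝ}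
    {g : Fin d → Torus d → ℝ} (hf : Integrable f)
    (hg : ∀ i, MemLp (g i) (ENNReal.ofReal p) volume) (h : ∀ i, HasTorusDeriv i f (g i)) :
    ∀ᵐ x, ‖f x‖ₑ ≤ ‖∫ x, f x‖ₑ + morreyConst d p * ∑ i, eLpNorm (g i) (ENNReal.ofReal p) volume := by
  -- The bound on averages of translates is used at every single x, so g must be genuinely
  -- measurable and not only almost everywhere.
  wlog hgm : ∀ i, Measurable (g i) generalizing g
  · have := this (g := fun i => (hg i).1.mk (g i)) (fun i => (hg i).ae_eq (hg i).1.ae_eq_mk)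
      (fun i n => by rw [← h i n]; exact ch_congr (hg i).1.ae_eq_mk.symm n)
      (fun i => (hg i).1.stronglyMeasurable_mk.measurable)
    filter_upwards [this] with x hx
    refine hx.trans_eq ?_
    simp only [fun i => eLpNorm_congr_ae (p := ENNReal.ofReal p) (hg i).1.ae_eq_mk]
  have hgi : ∀ i, Integrable (g i) := fun i => (hg i).integrable (by simpa using hp1)
  set ν := (volume.restrict (Icc (0 : ℝ) 1)).prod (cube d) with hν
  let a : ℝ × (Fin d → ℝ) → Torus d := fun z => proj (z.1 • WithLp.toLp 2 z.2)
  have ha : Measurable a := measurable_proj.comp (by fun_prop)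
  have hc : ∀ i : Fin d, Measurable fun z : ℝ × (Fin d → ℝ) => z.2 i := fun i => by fun_prop
  have hC : ∀ i : Fin d, ∀ᵐ z ∂ν, |z.2 i| ≤ 1 := fun i => by
    refine Measure.quasiMeasurePreserving_snd.ae (p := fun y : Fin d → ℝ => |y i| ≤ 1) ?_
    rw [cube_eq_restrict]
    filter_upwards [ae_restrict_mem (MeasurableSet.univ_pi fun _ => measurableSet_Ioc)] with y hy
    have := hy i trivial
    rw [abs_of_pos this.1]; exact this.2
  -- Averaging f(x+y) − f(x) = ∫₀¹ y·∇f(x+sy) ds over y in the unit cube gives ∫ f = f(x) + ∑ᵢ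
  -- Fᵢ(x).
  let F : Fin d → Torus d → ℝ := fun i x => ∫ z, z.2 i * g i (x + a z) ∂ν
  have hF : ∀ i, Integrable (F i) := fun i =>
    (integrable_mul_translate (ν := ν) ha (hc i) (hC i) (hgi i)).integral_prod_left
  -- The multiplier is the integral over the cube of exp(`freq n y`) − 1; the integral in s
  -- telescopes and the character has mean zero unless n = 0.
  have hchF : ∀ n, ch (fun x => ∑ i, F i x) n = ch f n * ((if n = 0 then 1 else 0) - 1) := fun n => by
    have e1 : ch (fun x => ∑ i, F i x) n = ∑ i, ch (F i) n := by
      simp only [ch]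
      rw [← integral_finsetSum _ fun i _ => integrable_mul_mFourier (hF i) n]
      refine integral_congr_ae (.of_forall fun x => ?_)
      simp only
      rw [← Finset.sum_mul]; push_cast; rfl
    have hint : ∀ i : Fin d, Integrable
        (fun z : ℝ × (Fin d → ℝ) => ((z.2 i : ℝ) : ℂ) * mFourier n (-a z)) ν := fun i => by
      refine Integrable.of_bound (C := 1) ?_ ?_
      · exact ((Complex.measurable_ofReal.comp (hc i)).mul
          ((mFourier n).continuous.measurable.comp ha.neg)).aestronglyMeasurable
      · filter_upwards [hC i] with z hz
        rw [norm_mul, Complex.norm_real]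
        exact mul_le_one₀ hz (norm_nonneg _) (norm_mFourier_le _ _)
    have e2 : ∀ i, ch (F i) n =
        (∫ z, (z.2 i : ℂ) * mFourier n (-a z) ∂ν) * ch (g i) n := fun i =>
      ch_integral_translate ha (hc i) (hC i) (hgi i) n
    have e3 : ∫ z, freq n (WithLp.toLp 2 z.2) * Complex.exp (freq n (WithLp.toLp 2 z.2) * z.1) ∂ν =
        ∑ i, -(2 * Real.pi * Complex.I * n i) * ∫ z, (z.2 i : ℂ) * mFourier n (-a z) ∂ν := by
      simp only [← integral_const_mul]
      rw [← integral_finsetSum _ fun i _ => (hint i).const_mul _]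
      refine integral_congr_ae (.of_forall fun z => ?_)
      simp only [a, mFourier_neg_proj_smul]
      simp only [← mul_assoc, ← Finset.sum_mul]
      congr 1
      rw [freq]; push_cast; rw [Finset.mul_sum, ← Finset.sum_neg_distrib]
      exact Finset.sum_congr rfl fun i _ => by ring
    have e4 : ∫ z, freq n (WithLp.toLp 2 z.2) * Complex.exp (freq n (WithLp.toLp 2 z.2) * z.1) ∂ν =
        (if n = 0 then 1 else 0) - 1 := by
      have hi : Integrable (fun z : ℝ × (Fin d → ℝ) =>
          freq n (WithLp.toLp 2 z.2) * Complex.exp (freq n (WithLp.toLp 2 z.2) * z.1)) ν := by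
        refine (integrable_finsetSum Finset.univ fun i _ =>
          (hint i).const_mul (-(2 * Real.pi * Complex.I * n i))).congr (.of_forall fun z => ?_)
        simp only [a, mFourier_neg_proj_smul]
        simp only [← mul_assoc, ← Finset.sum_mul]
        congr 1
        rw [freq]; push_cast; rw [Finset.mul_sum, ← Finset.sum_neg_distrib]
        exact Finset.sum_congr rfl fun i _ => by ring
      rw [integral_prod_symm _ hi]
      simp only [integral_const_mul, exp_mul_sub_one_eq _ zero_le_one]
      rw [← integral_cube_mFourier n]
      have : ∀ y : Fin d → ℝ, Complex.exp (freq n (WithLp.toLp 2 y) * (1 : ℝ)) =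
          mFourier n (-proj (WithLp.toLp 2 y)) := fun y => by
        rw [← mFourier_neg_proj_smul, one_smul]
      simp only [this]
      rw [integral_sub _ (integrable_const _)]
      · simp
      · refine Integrable.of_bound (C := 1) ?_ (.of_forall fun y => norm_mFourier_le _ _)
        exact ((mFourier n).continuous.measurable.comp
          measurePreserving_proj_toLp.measurable.neg).aestronglyMeasurable
    rw [e1, ← e4, e3, Finset.mul_sum]
    refine Finset.sum_congr rfl fun i _ => ?_
    rw [e2, h i n]; ring
  have key : (fun x => f x + ∑ i, F i x) =ᵐ[volume] fun _ => ∫ x, f x := by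
    have hFs : Integrable fun x => ∑ i, F i x := integrable_finsetSum _ fun i _ => hF i
    refine ae_eq_of_ch (hf.add hFs) (integrable_const _) fun n => ?_
    have e1 : ch (fun x => f x + ∑ i, F i x) n = ch f n + ch (fun x => ∑ i, F i x) n := by
      simp only [ch]
      rw [← integral_add (integrable_mul_mFourier hf n) (integrable_mul_mFourier hFs n)]
      refine integral_congr_ae (.of_forall fun x => ?_)
      simp only
      rw [← add_mul]; push_cast; rfl
    rw [e1, hchF n]
    have e2 : ch (fun _ => ∫ x, f x) n = ((∫ x, f x : ℝ) : ℂ) * if n = 0 then 1 else 0 := by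
      rw [ch, integral_const_mul, integral_mFourier]
    rw [e2]
    split_ifs with hn
    · rw [hn, ch, ← integral_complex_ofReal]
      simp [mFourier_zero]
    · ring
  have hbound : ∀ i x, ‖F i x‖ₑ ≤ morreyConst d p * eLpNorm (g i) (ENNReal.ofReal p) volume :=
    fun i x => by
      refine (enorm_integral_le_lintegral_enorm _).trans
        ((lintegral_mono_ae ?_).trans (lintegral_translate_le hp1 (hgm i) x))
      filter_upwards [hC i] with z hz
      rw [enorm_mul]
      refine mul_le_of_le_one_left (zero_le) ?_
      rw [← ofReal_norm]
      exact ENNReal.ofReal_le_one.2 hz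
  filter_upwards [key] with x hx
  have : f x = (∫ x, f x) - ∑ i, F i x := by rw [← hx]; ring
  rw [this]
  refine enorm_sub_le.trans (add_le_add le_rfl ?_)
  rw [Finset.mul_sum]
  exact (enorm_sum_le _ _).trans (Finset.sum_le_sum fun i _ => hbound i x)

end MFGC

namespace MFGC

open UnitAddTorus

variable {d : ℕ} {T : ℝ}

/-! ### Slices of weakly differentiable functions on the cylinder -/

/-- The product measure on `𝕋ᵈ × [0,T]`. -/
def cylMeasure (d : ℕ) (T : ℝ) : Measure (Torus d × ℝ) :=
  (volume : Measure (Torus d)).prod (volume.restrict (Icc 0 T))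

theorem restrict_cyl : (volume : Measure (Torus d × ℝ)).restrict (cyl d T) = cylMeasure d T := by
  rw [cyl, cylMeasure, Measure.volume_eq_prod, ← Measure.prod_restrict, Measure.restrict_univ]

instance : IsFiniteMeasure (cylMeasure d T) := by
  rw [cylMeasure]; infer_instance

/-- The real trigonometric test function `Re (c eₙ(x)) ζ(t)`. -/
def trigTest (c : ℂ) (n : Fin d → ℤ) (ζ : ℝ → ℝ) (z : Torus d × ℝ) : ℝ :=
  (c * mFourier n z.1).re * ζ z.2

theorem isTest_trigTest (c : ℂ) (n : Fin d → ℤ) {ζ : ℝ → ℝ} (hζ : IsTimeTest T ζ) :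
    IsTest T (trigTest c n ζ) := by
  obtain ⟨a, b, ha, hb, hK⟩ := exists_Icc_of_isCompact hζ.compact.isCompact hζ.supp
  refine ⟨?_, a, b, ha, hb, fun x t ht => ?_⟩
  · simp only [trigTest, mFourier_proj]
    refine ContDiff.mul ?_ (hζ.contDiff.comp contDiff_snd)
    refine Complex.reCLM.contDiff.comp (contDiff_const.mul (ContDiff.cexp (contDiff_const.mul ?_)))
    have h1 : ContDiff ℝ ∞ fun z : Vec d × ℝ => ∑ i, (n i : ℝ) * z.1 i :=
      ContDiff.sum fun i _ => contDiff_const.mul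
        ((EuclideanSpace.proj i : Vec d →L[ℝ] ℝ).contDiff.comp contDiff_fst)
    exact Complex.ofRealCLM.contDiff.comp h1
  · simp only [trigTest]
    rw [image_eq_zero_of_notMem_tsupport fun h' => ht (hK h'), mul_zero]

theorem dt_trigTest (c : ℂ) (n : Fin d → ℤ) {ζ : ℝ → ℝ} (hζ : IsTimeTest T ζ)
    (z : Torus d × ℝ) :
    dt (trigTest c n ζ) z = (c * mFourier n z.1).re * deriv ζ z.2 := by
  simp only [dt, trigTest]
  exact deriv_const_mul _ (hζ.contDiff.differentiable (by simp) _)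

theorem dx_trigTest (c : ℂ) (n : Fin d → ℤ) (ζ : ℝ → ℝ) (i : Fin d) (z : Torus d × ℝ) :
    dx i (trigTest c n ζ) z =
      (c * ((2 * Real.pi * Complex.I * n i) * mFourier n z.1)).re * ζ z.2 := by
  simp only [dx, trigTest]
  set κ : ℂ := 2 * Real.pi * Complex.I * n i with hκ
  have h1 : ∀ s : ℝ, mFourier n (z.1 + proj (EuclideanSpace.single i s)) =
      mFourier n z.1 * Complex.exp (s * κ) := fun s => by
    rw [mFourier_apply_add, mFourier_proj]
    congr 2
    simp [hκ, PiLp.single_apply]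
    ring
  simp only [h1]
  have h2 : HasDerivAt (fun s : ℝ => c * (mFourier n z.1 * Complex.exp (s * κ)))
      (c * (mFourier n z.1 * κ)) 0 := by
    have h3 : HasDerivAt (fun s : ℝ => ((s : ℂ) * κ)) κ 0 := by
      simpa using (Complex.ofRealCLM.hasDerivAt (x := (0 : ℝ))).mul_const κ
    have h4 := h3.cexp
    simp only [Complex.ofReal_zero, zero_mul, Complex.exp_zero, one_mul] at h4
    exact (h4.const_mul _).const_mul _
  have h5 := (Complex.reCLM.hasFDerivAt.comp_hasDerivAt (0 : ℝ) h2).mul_const (ζ z.2)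
  have := h5.deriv
  simp only [Function.comp_def, Complex.reCLM_apply] at this
  rw [this]
  congr 3; ring

/-- Test functions are real; complex identities for coefficients are recovered from real parts by
varying the constant c. -/
theorem eq_zero_of_re_mul {w : ℂ} (h : ∀ c : ℂ, (c * w).re = 0) : w = 0 := by
  have h1 := h 1
  have h2 := h (-Complex.I)
  simp at h1 h2
  exact Complex.ext h1 h2

theorem ae_integral_slice_eq_zero {G : Torus d × ℝ → ℂ} (hG : Integrable G (cylMeasure d T))
    (h : ∀ ζ, IsTimeTest T ζ → ∀ c : ℂ, ∫ z, (c * G z).re * ζ z.2 ∂(cylMeasure d T) = 0) :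
    ∀ᵐ t ∂(volume.restrict (Icc 0 T)), ∫ x, G (x, t) = 0 := by
  refine ae_eq_zero_of_integral_timeTest hG.integral_prod_right fun ζ hζ => ?_
  obtain ⟨C, hC⟩ := hζ.contDiff.continuous.bounded_above_of_compact_support hζ.compact
  have hi : Integrable (fun z => ζ z.2 • G z) (cylMeasure d T) :=
    hG.bdd_smul C (hζ.contDiff.continuous.measurable.comp measurable_snd).aestronglyMeasurable
      (.of_forall fun z => hC z.2)
  have h1 : ∫ z, ζ z.2 • G z ∂(cylMeasure d T) = 0 := by
    refine eq_zero_of_re_mul fun c => ?_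
    rw [← integral_const_mul, ← RCLike.re_eq_complex_re, ← integral_re (hi.const_mul c),
      ← h ζ hζ c]
    refine integral_congr_ae (.of_forall fun z => ?_)
    simp only [RCLike.re_eq_complex_re, Complex.real_smul]
    rw [mul_left_comm, Complex.re_ofReal_mul, mul_comm]
  rw [cylMeasure, integral_prod_symm _ hi] at h1
  simpa only [integral_smul] using h1

theorem integrable_mul_mFourier_fst {u : Torus d × ℝ → ℝ} (hu : Integrable u (cylMeasure d T))
    (n : Fin d → ℤ) : Integrable (fun z => (u z : ℂ) * mFourier n z.1) (cylMeasure d T) :=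
  hu.ofReal.mul_bdd (c := 1)
    ((mFourier n).continuous.comp continuous_fst).aestronglyMeasurable
    (.of_forall fun z => norm_mFourier_le n z.1)

theorem integrable_mul_timeTest {u : Torus d × ℝ → ℝ} (hu : Integrable u (cylMeasure d T))
    {ζ : ℝ → ℝ} (hζ : IsTimeTest T ζ) : Integrable (fun z => u z * ζ z.2) (cylMeasure d T) := by
  obtain ⟨C, hC⟩ := hζ.contDiff.continuous.bounded_above_of_compact_support hζ.compact
  exact hu.mul_bdd (c := C)
    (hζ.contDiff.continuous.measurable.comp measurable_snd).aestronglyMeasurable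
    (.of_forall fun z => hC z.2)

theorem integrable_mul_re_timeTest {u : Torus d × ℝ → ℝ} (hu : Integrable u (cylMeasure d T))
    {ζ : ℝ → ℝ} (hζ : IsTimeTest T ζ) (c : ℂ) (n : Fin d → ℤ) :
    Integrable (fun z => u z * ((c * mFourier n z.1).re * ζ z.2)) (cylMeasure d T) := by
  have := integrable_mul_timeTest ((integrable_mul_mFourier_fst hu n).const_mul c).re hζ
  refine this.congr (.of_forall fun z => ?_)
  simp only [RCLike.re_eq_complex_re]
  rw [mul_left_comm, Complex.re_ofReal_mul, mul_assoc]

/-- Testing against characters times functions of t separates the variables. There are countably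
many frequencies, so one null set of times serves them all. -/
theorem ae_hasTorusDeriv_of_hasWeakDx {i : Fin d} {u w : Torus d × ℝ → ℝ}
    (hu : Integrable u (cylMeasure d T)) (hw : Integrable w (cylMeasure d T))
    (h : HasWeakDx T i u w) :
    ∀ᵐ t ∂(volume.restrict (Icc 0 T)),
      HasTorusDeriv i (fun x => u (x, t)) (fun x => w (x, t)) := by
  refine ae_all_iff.2 fun n => ?_
  obtain ⟨κ, hκ⟩ : ∃ κ : ℂ, κ = 2 * Real.pi * Complex.I * n i := ⟨_, rfl⟩
  have hu' := integrable_mul_mFourier_fst hu n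
  have hw' := integrable_mul_mFourier_fst hw n
  have := ae_integral_slice_eq_zero (G := fun z => κ * ((u z : ℂ) * mFourier n z.1) +
    (w z : ℂ) * mFourier n z.1) ((hu'.const_mul κ).add hw') fun ζ hζ c => by
      have h1 := h _ (isTest_trigTest c n hζ)
      simp only [dx_trigTest, ← hκ, restrict_cyl, trigTest] at h1
      have i1 := integrable_mul_re_timeTest hu hζ (c * κ) n
      have i2 := integrable_mul_re_timeTest hw hζ c n
      simp only [← mul_assoc c] at h1
      rw [eq_neg_iff_add_eq_zero, ← integral_add i1 i2] at h1
      rw [← h1]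
      refine integral_congr_ae (.of_forall fun z => ?_)
      simp only
      rw [mul_add, Complex.add_re, ← mul_assoc c κ, mul_left_comm (c * κ), mul_left_comm c,
        Complex.re_ofReal_mul, Complex.re_ofReal_mul]
      ring
  filter_upwards [this, hu'.prod_left_ae, hw'.prod_left_ae] with t ht h1 h2
  rw [integral_add (h1.const_mul κ) h2, integral_const_mul] at ht
  rw [← hκ]
  simp only [ch]
  linear_combination ht

theorem ae_ch_eq_of_weak_divergence {w : Torus d × ℝ → ℝ} {b : Fin d → Torus d × ℝ → ℝ}
    (hw : Integrable w (cylMeasure d T)) (hb : ∀ i, Integrable (b i) (cylMeasure d T))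
    (h : ∀ ψ, IsTest T ψ → (∫ z, w z * ψ z ∂(cylMeasure d T)) =
      ∫ z, ∑ i, b i z * dx i ψ z ∂(cylMeasure d T)) :
    ∀ᵐ t ∂(volume.restrict (Icc 0 T)), ∀ n : Fin d → ℤ,
      ch (fun x => w (x, t)) n =
        ∑ i, (2 * Real.pi * Complex.I * n i) * ch (fun x => b i (x, t)) n := by
  refine ae_all_iff.2 fun n => ?_
  obtain ⟨κ, hκ⟩ : ∃ κ : Fin d → ℂ, ∀ i, κ i = 2 * Real.pi * Complex.I * n i := ⟨_, fun _ => rfl⟩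
  have hb' := fun i => integrable_mul_mFourier_fst (hb i) n
  have hw' := integrable_mul_mFourier_fst hw n
  have := ae_integral_slice_eq_zero (G := fun z => (w z : ℂ) * mFourier n z.1 -
    ∑ i, κ i * ((b i z : ℂ) * mFourier n z.1))
    (hw'.sub (integrable_finsetSum _ fun i _ => (hb' i).const_mul (κ i))) fun ζ hζ c => by
      have h1 := h _ (isTest_trigTest c n hζ)
      simp only [dx_trigTest, ← hκ, trigTest] at h1
      have i1 := fun i => integrable_mul_re_timeTest (hb i) hζ (c * κ i) n
      have i2 := integrable_mul_re_timeTest hw hζ c n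
      simp only [← mul_assoc c] at h1
      rw [← sub_eq_zero,
        ← integral_sub i2 (integrable_finsetSum _ fun i _ => i1 i)] at h1
      rw [← h1]
      refine integral_congr_ae (.of_forall fun z => ?_)
      simp only
      rw [mul_sub, Complex.sub_re, Finset.mul_sum, Complex.re_sum, sub_mul, Finset.sum_mul,
        mul_left_comm c, Complex.re_ofReal_mul, mul_assoc]
      congr 1
      refine Finset.sum_congr rfl fun i _ => ?_
      rw [← mul_assoc c (κ i), mul_left_comm (c * κ i), Complex.re_ofReal_mul, mul_assoc]
  have h1 : ∀ᵐ t ∂(volume.restrict (Icc 0 T)), ∀ i,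
      Integrable (fun x => (b i (x, t) : ℂ) * mFourier n x) :=
    ae_all_iff.2 fun i => (hb' i).prod_left_ae
  filter_upwards [this, hw'.prod_left_ae, h1] with t ht h1 h2
  rw [integral_sub h1 (integrable_finsetSum _ fun i _ => (h2 i).const_mul (κ i)),
    integral_finsetSum _ fun i _ => (h2 i).const_mul (κ i)] at ht
  simp only [integral_const_mul] at ht
  simp only [ch, ← hκ]
  linear_combination ht

theorem integrable_primitive {u : Torus d × ℝ → ℝ} (hu : Integrable u (cylMeasure d T)) :
    Integrable (fun z => ∫ s in 0..z.2, u (z.1, s)) (cylMeasure d T) := by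
  have h1 : Integrable (fun z : Torus d × ℝ => ∫ s in Icc 0 T, ‖u (z.1, s)‖) (cylMeasure d T) :=
    (hu.norm.integral_prod_left).comp_fst _
  refine h1.mono' (aestronglyMeasurable_primitive hu.aestronglyMeasurable) ?_
  have h0 : ∀ᵐ z ∂(cylMeasure d T), z.2 ∈ Icc 0 T :=
    Measure.quasiMeasurePreserving_snd.ae (ae_restrict_mem measurableSet_Icc)
  have h2 : ∀ᵐ z ∂(cylMeasure d T), IntegrableOn (fun s => u (z.1, s)) (Icc 0 T) :=
    Measure.quasiMeasurePreserving_fst.ae hu.prod_right_ae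
  filter_upwards [h0, h2] with z hz hz'
  rw [intervalIntegral.integral_of_le hz.1, ← integral_Icc_eq_integral_Ioc]
  refine (norm_integral_le_integral_norm _).trans ?_
  exact setIntegral_mono_set hz'.norm (.of_forall fun _ => norm_nonneg _)
    (Icc_subset_Icc_right hz.2).eventuallyLE

theorem ch_primitive {u : Torus d × ℝ → ℝ} (hu : Integrable u (cylMeasure d T)) (n : Fin d → ℤ)
    {t : ℝ} (ht : t ∈ Icc 0 T) :
    ch (fun x => ∫ s in 0..t, u (x, s)) n = ∫ s in 0..t, ch (fun x => u (x, s)) n := by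
  rw [intervalIntegral.integral_of_le ht.1]
  simp only [intervalIntegral.integral_of_le ht.1]
  refine ch_integral_prod (hu.mono_measure ?_) n
  exact Measure.prod_mono le_rfl (Measure.restrict_mono
    (Ioc_subset_Icc_self.trans (Icc_subset_Icc_right ht.2)) le_rfl)

/-- A function with an integrable weak time derivative is absolutely continuous in time, for
almost every point of the torus. -/
theorem exists_initial_of_hasWeakDt (hT : 0 < T) {u w : Torus d × ℝ → ℝ}
    (hu : Integrable u (cylMeasure d T)) (hw : Integrable w (cylMeasure d T))
    (h : HasWeakDt T u w) :
    ∃ a : Torus d → ℝ, Integrable a ∧ ∀ᵐ x, ∀ᵐ t ∂(volume.restrict (Icc 0 T)),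
      u (x, t) = a x + ∫ s in 0..t, w (x, s) := by
  -- Each Fourier coefficient of u(·,t) is a function of t alone, weakly differentiable with
  -- derivative the coefficient of w, hence a constant plus a primitive.
  have hre : ∀ (n : Fin d → ℤ) (c : ℂ), ∃ k : ℝ, ∀ᵐ t ∂(volume.restrict (Icc 0 T)),
      (c * ch (fun x => u (x, t)) n).re = k + ∫ s in 0..t, (c * ch (fun x => w (x, s)) n).re := by
    intro n c
    have hu' := integrable_mul_mFourier_fst hu n
    have hw' := integrable_mul_mFourier_fst hw n
    refine exists_ae_eq_primitive hT (hu'.integral_prod_right.const_mul c).re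
      (hw'.integral_prod_right.const_mul c).re fun ζ hζ => ?_
    have h1 := h _ (isTest_trigTest c n hζ)
    simp only [dt_trigTest c n hζ, restrict_cyl, trigTest] at h1
    have key : ∀ (v : Torus d × ℝ → ℝ) (hv : Integrable v (cylMeasure d T)) (ξ : ℝ → ℝ)
        (hξ : IsTimeTest T ξ), ∫ z, v z * ((c * mFourier n z.1).re * ξ z.2) ∂(cylMeasure d T) =
          ∫ t in Icc 0 T, (c * ch (fun x => v (x, t)) n).re * ξ t := fun v hv ξ hξ => by
      have hi := integrable_mul_re_timeTest hv hξ c n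
      rw [cylMeasure, integral_prod_symm _ hi]
      refine integral_congr_ae ?_
      filter_upwards [(integrable_mul_mFourier_fst hv n).prod_left_ae] with t ht
      rw [ch, ← integral_const_mul, ← RCLike.re_eq_complex_re, ← integral_re (ht.const_mul c),
        ← integral_mul_const]
      refine integral_congr_ae (.of_forall fun x => ?_)
      simp only [RCLike.re_eq_complex_re]
      rw [mul_left_comm c, Complex.re_ofReal_mul, mul_assoc]
    rw [key u hu _ hζ.deriv, key w hw _ hζ] at h1
    exact h1
  have hch : ∀ n : Fin d → ℤ, ∃ k : ℂ, ∀ᵐ t ∂(volume.restrict (Icc 0 T)),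
      ch (fun x => u (x, t)) n - ch (fun x => ∫ s in 0..t, w (x, s)) n = k := by
    intro n
    obtain ⟨k₁, hk₁⟩ := hre n 1
    obtain ⟨k₂, hk₂⟩ := hre n (-Complex.I)
    refine ⟨⟨k₁, k₂⟩, ?_⟩
    have hw' := (integrable_mul_mFourier_fst hw n).integral_prod_right
    filter_upwards [hk₁, hk₂, ae_restrict_mem measurableSet_Icc] with t h1 h2 ht
    have hi : IntegrableOn (fun s => ch (fun x => w (x, s)) n) (Ioc 0 t) :=
      IntegrableOn.mono_set hw' (Ioc_subset_Icc_self.trans (Icc_subset_Icc_right ht.2))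
    rw [ch_primitive hw n ht, intervalIntegral.integral_of_le ht.1]
    rw [intervalIntegral.integral_of_le ht.1] at h1 h2
    have hc : ∀ c : ℂ, ∫ s in Ioc 0 t, (c * ch (fun x => w (x, s)) n).re =
        (c * ∫ s in Ioc 0 t, ch (fun x => w (x, s)) n).re := fun c => by
      rw [← integral_const_mul]
      exact integral_re (hi.const_mul c)
    rw [hc] at h1 h2
    simp only [one_mul] at h1
    simp only [neg_mul, Complex.neg_re, Complex.I_mul_re, neg_neg] at h2
    apply Complex.ext <;> simp only [Complex.sub_re, Complex.sub_im]
    · linarith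
    · linarith
  choose k hk using hch
  have hP := integrable_primitive hw
  have hgood : ∀ᵐ t ∂(volume.restrict (Icc 0 T)),
      (∀ n, ch (fun x => u (x, t)) n - ch (fun x => ∫ s in 0..t, w (x, s)) n = k n) ∧
      Integrable (fun x => u (x, t)) ∧ Integrable (fun x => ∫ s in 0..t, w (x, s)) := by
    filter_upwards [ae_all_iff.2 hk, hu.prod_left_ae, hP.prod_left_ae] with t h1 h2 h3
    exact ⟨h1, h2, h3⟩
  have : NeBot (ae (volume.restrict (Icc (0 : ℝ) T))) := by
    rw [ae_neBot, Ne, Measure.restrict_eq_zero]; simp [hT]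
  -- The coefficients of u(·,t) − ∫₀ᵗ w do not depend on t, so one good time t₀ provides the initial
  -- datum as an integrable function and no Fourier series has to be summed.
  obtain ⟨t₀, ht₀, hu₀, hw₀⟩ := hgood.exists
  refine ⟨fun x => u (x, t₀) - ∫ s in 0..t₀, w (x, s), hu₀.sub hw₀, ?_⟩
  refine Measure.ae_ae_of_ae_prod (p := fun z : Torus d × ℝ => u z =
    (u (z.1, t₀) - ∫ s in 0..t₀, w (z.1, s)) + ∫ s in 0..z.2, w (z.1, s))
    (ae_prod_eq_of_ae_ae_swap hu.aestronglyMeasurable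
      (((hu₀.sub hw₀).comp_fst _).add hP).aestronglyMeasurable ?_)
  filter_upwards [hgood] with t ht
  obtain ⟨h1, h2, h3⟩ := ht
  have := ae_eq_of_ch (h2.sub h3) (hu₀.sub hw₀) fun n => by
    have e1 := ch_sub h2 h3 n
    have e2 := ch_sub hu₀ hw₀ n
    rw [h1 n] at e1
    rw [ht₀ n] at e2
    exact e1.trans e2.symm
  filter_upwards [this] with x hx
  simp only [Pi.sub_apply] at hx
  linarith

end MFGC

namespace MFGC

open UnitAddTorus

variable {d : ℕ} {T : ℝ}

/-! ### Traces and energy identities -/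

/-- `u(x,·)` is, for almost every `x`, the primitive of `w(x,·)` with initial value `a x`. -/
structure HasTrace (T : ℝ) (u w : Torus d × ℝ → ℝ) (a : Torus d → ℝ) : Prop where
  integrable : Integrable u (cylMeasure d T)
  integrable_deriv : Integrable w (cylMeasure d T)
  integrable_initial : Integrable a
  ae_eq : ∀ᵐ x, ∀ᵐ t ∂(volume.restrict (Icc 0 T)), u (x, t) = a x + ∫ s in 0..t, w (x, s)

/-- For almost every x the limits of averages defining `initialValue` and `terminalValue` exist and
are the endpoint values of the absolutely continuous representative. -/
theorem hasTrace_of_hasWeakDt (hT : 0 < T) {u w : Torus d × ℝ → ℝ}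
    (hu : Integrable u (cylMeasure d T)) (hw : Integrable w (cylMeasure d T))
    (h : HasWeakDt T u w) :
    HasTrace T u w (initialValue u) ∧
      ∀ᵐ x, terminalValue T u x = initialValue u x + ∫ s in 0..T, w (x, s) := by
  obtain ⟨a, ha, hae⟩ := exists_initial_of_hasWeakDt hT hu hw h
  have h1 : ∀ᵐ x, initialValue u x = a x := by
    filter_upwards [hae, hw.prod_right_ae] with x hx hwx
    exact (tendsto_initial_average hT hwx hx).limUnder_eq
  have h2 : ∀ᵐ x, terminalValue T u x = a x + ∫ s in 0..T, w (x, s) := by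
    filter_upwards [hae, hw.prod_right_ae] with x hx hwx
    exact (tendsto_terminal_average hT hwx hx).limUnder_eq
  refine ⟨⟨hu, hw, ha.congr (h1.mono fun x hx => hx.symm), ?_⟩, ?_⟩
  · filter_upwards [hae, h1] with x hx hx1
    rwa [hx1]
  · filter_upwards [h2, h1] with x hx hx1
    rwa [hx1]

theorem HasTrace.sub {u₁ u₂ w₁ w₂ : Torus d × ℝ → ℝ} {a₁ a₂ : Torus d → ℝ}
    (h₁ : HasTrace T u₁ w₁ a₁) (h₂ : HasTrace T u₂ w₂ a₂) :
    HasTrace T (fun z => u₁ z - u₂ z) (fun z => w₁ z - w₂ z) (fun x => a₁ x - a₂ x) := by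
  refine ⟨h₁.integrable.sub h₂.integrable, h₁.integrable_deriv.sub h₂.integrable_deriv,
    h₁.integrable_initial.sub h₂.integrable_initial, ?_⟩
  filter_upwards [h₁.ae_eq, h₂.ae_eq, h₁.integrable_deriv.prod_right_ae,
    h₂.integrable_deriv.prod_right_ae] with x e₁ e₂ i₁ i₂
  filter_upwards [e₁, e₂, ae_restrict_mem measurableSet_Icc] with t e₁ e₂ ht
  rw [e₁, e₂, intervalIntegral.integral_sub (intervalIntegrable_of_integrableOn_Icc i₁ ht)
    (intervalIntegrable_of_integrableOn_Icc i₂ ht)]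
  ring

theorem HasTrace.comp_eq {u w : Torus d × ℝ → ℝ} {a : Torus d → ℝ} (h : HasTrace T u w a)
    {η : ℝ → ℝ} (hη : ContDiff ℝ 1 η) {r : ℝ} (hr : r ∈ Icc 0 T) :
    ∀ᵐ x, η (a x + ∫ s in 0..r, w (x, s)) =
      η (a x) + ∫ s in 0..r, deriv η (u (x, s)) * w (x, s) := by
  filter_upwards [h.ae_eq, h.integrable_deriv.prod_right_ae] with x hx hwx
  rw [comp_primitive_eq hwx hη _ hr]
  congr 1
  refine intervalIntegral.integral_congr_ae ?_
  rw [uIoc_of_le hr.1]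
  filter_upwards [(ae_restrict_iff' measurableSet_Icc).1 hx] with s hs hs'
  rw [hs ⟨hs'.1.le, hs'.2.trans hr.2⟩]

theorem HasTrace.ae_slice {u w : Torus d × ℝ → ℝ} {a : Torus d → ℝ} (h : HasTrace T u w a) :
    ∀ᵐ t ∂(volume.restrict (Icc 0 T)), ∀ᵐ x, u (x, t) = a x + ∫ s in 0..t, w (x, s) := by
  have := ae_prod_eq_of_ae_ae (μ := (volume : Measure (Torus d)))
    (ν := volume.restrict (Icc 0 T)) (f := u)
    (g := fun z => a z.1 + ∫ s in 0..z.2, w (z.1, s)) h.integrable.aestronglyMeasurable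
    ((h.integrable_initial.comp_fst _).add
      (integrable_primitive h.integrable_deriv)).aestronglyMeasurable h.ae_eq
  exact ae_swap_of_ae_prod this

theorem integral_primitive_eq {k : Torus d × ℝ → ℝ} (hk : Integrable k (cylMeasure d T)) {r : ℝ}
    (hr : r ∈ Icc 0 T) :
    Integrable (fun x => ∫ s in 0..r, k (x, s)) ∧
      ∫ x, (∫ s in 0..r, k (x, s)) = ∫ s in 0..r, ∫ x, k (x, s) := by
  have h1 : Integrable k ((volume : Measure (Torus d)).prod (volume.restrict (Ioc 0 r))) :=
    hk.mono_measure (Measure.prod_mono le_rfl (Measure.restrict_mono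
      (Ioc_subset_Icc_self.trans (Icc_subset_Icc_right hr.2)) le_rfl))
  simp only [intervalIntegral.integral_of_le hr.1]
  exact ⟨h1.integral_prod_left, integral_integral_swap (f := fun x s => k (x, s)) h1⟩

theorem HasTrace.integral_comp_eq (hT : 0 < T) {u w : Torus d × ℝ → ℝ} {a : Torus d → ℝ}
    (h : HasTrace T u w a) {η : ℝ → ℝ} (hη : ContDiff ℝ 1 η)
    (hηu : Integrable (fun z => η (u z)) (cylMeasure d T))
    (hηw : Integrable (fun z => deriv η (u z) * w z) (cylMeasure d T)) :
    (∀ᵐ t ∂(volume.restrict (Icc 0 T)), ∫ x, η (u (x, t)) =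
      (∫ x, η (a x)) + ∫ s in 0..t, ∫ x, deriv η (u (x, s)) * w (x, s)) ∧
    ∫ x, η (a x + ∫ s in 0..T, w (x, s)) =
      (∫ x, η (a x)) + ∫ s in 0..T, ∫ x, deriv η (u (x, s)) * w (x, s) := by
  have hgood : ∀ᵐ t ∂(volume.restrict (Icc 0 T)), t ∈ Icc 0 T ∧
      Integrable (fun x => η (u (x, t))) ∧ ∀ᵐ x, u (x, t) = a x + ∫ s in 0..t, w (x, s) := by
    filter_upwards [ae_restrict_mem measurableSet_Icc, hηu.prod_left_ae, h.ae_slice] with t h1 h2 h3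
    exact ⟨h1, h2, h3⟩
  have : NeBot (ae (volume.restrict (Icc (0 : ℝ) T))) := by
    rw [ae_neBot, Ne, Measure.restrict_eq_zero]; simp [hT]
  -- Integrability of η at time 0 is carried back from a good time t₀ by the integrated chain rule.
  have hia : Integrable fun x => η (a x) := by
    obtain ⟨t₀, ht₀, hi, he⟩ := hgood.exists
    refine (hi.sub (integral_primitive_eq hηw ht₀).1).congr ?_
    filter_upwards [he, h.comp_eq hη ht₀] with x h1 h2
    simp only [Pi.sub_apply]
    rw [h1, h2]; ring
  have key : ∀ r ∈ Icc 0 T, ∫ x, η (a x + ∫ s in 0..r, w (x, s)) =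
      (∫ x, η (a x)) + ∫ s in 0..r, ∫ x, deriv η (u (x, s)) * w (x, s) := fun r hr => by
    obtain ⟨i1, i2⟩ := integral_primitive_eq hηw hr
    rw [← i2, ← integral_add hia i1]
    exact integral_congr_ae (h.comp_eq hη hr)
  refine ⟨?_, key T ⟨hT.le, le_rfl⟩⟩
  filter_upwards [hgood] with t ht
  rw [← key t ht.1]
  exact integral_congr_ae (ht.2.2.mono fun x hx => congrArg η hx)

/-- Integration by parts in time on the cylinder. -/
theorem HasTrace.integral_mul_eq (hT : 0 < T) {u₁ u₂ w₁ w₂ : Torus d × ℝ → ℝ}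
    {a₁ a₂ : Torus d → ℝ} (h₁ : HasTrace T u₁ w₁ a₁) (h₂ : HasTrace T u₂ w₂ a₂)
    (ha : Integrable fun x => a₁ x * a₂ x)
    (hw : Integrable (fun z => w₁ z * u₂ z + u₁ z * w₂ z) (cylMeasure d T)) :
    ∫ x, (a₁ x + ∫ s in 0..T, w₁ (x, s)) * (a₂ x + ∫ s in 0..T, w₂ (x, s)) =
      (∫ x, a₁ x * a₂ x) + ∫ z, (w₁ z * u₂ z + u₁ z * w₂ z) ∂(cylMeasure d T) := by
  obtain ⟨i1, -⟩ := integral_primitive_eq hw ⟨hT.le, le_rfl⟩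
  have e : ∫ z, (w₁ z * u₂ z + u₁ z * w₂ z) ∂(cylMeasure d T) =
      ∫ x, ∫ s in 0..T, (w₁ (x, s) * u₂ (x, s) + u₁ (x, s) * w₂ (x, s)) := by
    rw [cylMeasure, integral_prod _ hw]
    simp only [intervalIntegral.integral_of_le hT.le, integral_Icc_eq_integral_Ioc]
  rw [e, ← integral_add ha i1]
  refine integral_congr_ae ?_
  filter_upwards [h₁.ae_eq, h₂.ae_eq, h₁.integrable_deriv.prod_right_ae,
    h₂.integrable_deriv.prod_right_ae] with x e₁ e₂ j₁ j₂
  rw [primitive_mul_primitive_eq j₁ j₂ _ _ ⟨hT.le, le_rfl⟩]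
  congr 1
  refine intervalIntegral.integral_congr_ae ?_
  rw [uIoc_of_le hT.le]
  filter_upwards [(ae_restrict_iff' measurableSet_Icc).1 e₁,
    (ae_restrict_iff' measurableSet_Icc).1 e₂] with s hs₁ hs₂ hs'
  rw [hs₁ ⟨hs'.1.le, hs'.2⟩, hs₂ ⟨hs'.1.le, hs'.2⟩]

/-! ### Regularity of almost every slice -/

theorem MemLp.ae_slice {E : Type*} [NormedAddCommGroup E] {p : ℝ} (hp : 0 < p)
    {u : Torus d × ℝ → E} (hu : MemLp u (ENNReal.ofReal p) (cylMeasure d T)) :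
    ∀ᵐ t ∂(volume.restrict (Icc 0 T)), MemLp (fun x => u (x, t)) (ENNReal.ofReal p) volume := by
  have hpe : ENNReal.ofReal p ≠ 0 := by simpa using hp
  have h1 := hu.integrable_norm_rpow hpe (by simp)
  have h2 : ∀ᵐ t ∂(volume.restrict (Icc 0 T)),
      AEStronglyMeasurable (fun x => u (x, t)) volume := hu.1.prod_swap.prodMk_left
  filter_upwards [h1.prod_left_ae, h2] with t ht ht'
  exact (integrable_norm_rpow_iff ht' hpe (by simp)).1 ht

theorem HasTorusDeriv.sub {i : Fin d} {f₁ f₂ g₁ g₂ : Torus d → ℝ} (h₁ : HasTorusDeriv i f₁ g₁)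
    (h₂ : HasTorusDeriv i f₂ g₂) (hf₁ : Integrable f₁) (hf₂ : Integrable f₂) (hg₁ : Integrable g₁)
    (hg₂ : Integrable g₂) :
    HasTorusDeriv i (fun x => f₁ x - f₂ x) (fun x => g₁ x - g₂ x) := fun n => by
  rw [ch_sub hf₁ hf₂, ch_sub hg₁ hg₂, h₁ n, h₂ n]; ring

/-- Pairing of a divergence with a weakly differentiable function. -/
theorem integral_mul_eq_sum_of_ch_eq {w φ : Torus d → ℝ} {b ψ : Fin d → Torus d → ℝ}
    (h : ∀ n : Fin d → ℤ, ch w n = ∑ i, (2 * Real.pi * Complex.I * n i) * ch (b i) n)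
    (hφ : ∀ i, HasTorusDeriv i φ (ψ i)) (hw2 : MemLp w 2 volume) (hb2 : ∀ i, MemLp (b i) 2 volume)
    (hφ2 : MemLp φ 2 volume) (hψ2 : ∀ i, MemLp (ψ i) 2 volume) :
    ∫ x, w x * φ x = ∑ i, ∫ x, b i x * ψ i x := by
  have h1 := hasSum_ch_mul_ch hw2 hφ2
  have h2 := hasSum_sum (s := Finset.univ) fun i _ => hasSum_ch_mul_ch (hb2 i) (hψ2 i)
  have : (fun n => ch w n * ch φ (-n)) = fun n => ∑ i, ch (b i) n * ch (ψ i) (-n) := by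
    ext n
    rw [h n, Finset.sum_mul]
    refine Finset.sum_congr rfl fun i _ => ?_
    rw [hφ i (-n)]
    simp only [Pi.neg_apply, Int.cast_neg]
    ring
  rw [this] at h1
  exact_mod_cast h1.unique h2

/-- The regularity in `x` shared by almost all slices of an element of `W^{2,1,p}(Q)`. -/
structure W21p.IsGoodSlice {p : ℝ} (u : W21p d T p) (t : ℝ) : Prop where
  memLp_toFun : MemLp (fun x => u.toFun (x, t)) (ENNReal.ofReal p) volume
  memLp_ut : MemLp (fun x => u.ut (x, t)) (ENNReal.ofReal p) volume
  memLp_grad : ∀ i, MemLp (fun x => u.grad (x, t) i) (ENNReal.ofReal p) volume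
  memLp_hess : ∀ i j, MemLp (fun x => u.hess i j (x, t)) (ENNReal.ofReal p) volume
  deriv_toFun : ∀ i, HasTorusDeriv i (fun x => u.toFun (x, t)) (fun x => u.grad (x, t) i)
  deriv_grad : ∀ i j, HasTorusDeriv j (fun x => u.grad (x, t) i) (fun x => u.hess i j (x, t))

theorem MemLp.vec_apply {α : Type*} [MeasurableSpace α] {μ : Measure α} {p : ℝ≥0∞}
    {f : α → Vec d} (hf : MemLp f p μ) (i : Fin d) : MemLp (fun x => f x i) p μ :=
  hf.mono ((PiLp.continuous_apply 2 _ i).comp_aestronglyMeasurable hf.1)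
    (.of_forall fun x => PiLp.norm_apply_le (f x) i)

section W21p

variable {p : ℝ} (u : W21p d T p)

theorem W21p.toFun_memLp : MemLp u.toFun (ENNReal.ofReal p) (cylMeasure d T) := by
  rw [← restrict_cyl]; exact u.memLp_toFun

theorem W21p.ut_memLp : MemLp u.ut (ENNReal.ofReal p) (cylMeasure d T) := by
  rw [← restrict_cyl]; exact u.memLp_ut

theorem W21p.grad_memLp (i : Fin d) :
    MemLp (fun z => u.grad z i) (ENNReal.ofReal p) (cylMeasure d T) := by
  rw [← restrict_cyl]; exact MemLp.vec_apply u.memLp_grad i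

theorem W21p.hess_memLp (i j : Fin d) :
    MemLp (u.hess i j) (ENNReal.ofReal p) (cylMeasure d T) := by
  rw [← restrict_cyl]; exact u.memLp_hess i j

theorem W21p.lap_memLp : MemLp u.lap (ENNReal.ofReal p) (cylMeasure d T) :=
  memLp_finsetSum _ fun i _ => u.hess_memLp i i

theorem W21p.ae_isGoodSlice (hp : 1 ≤ p) : ∀ᵐ t ∂(volume.restrict (Icc 0 T)), u.IsGoodSlice t := by
  have hp0 : 0 < p := one_pos.trans_le hp
  have hp1 : (1 : ℝ≥0∞) ≤ ENNReal.ofReal p := by simpa using hp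
  have h1 := ae_all_iff.2 fun i => MemLp.ae_slice hp0 (u.grad_memLp i)
  have h2 := ae_all_iff.2 fun i => ae_all_iff.2 fun j => MemLp.ae_slice hp0 (u.hess_memLp i j)
  have h3 := ae_all_iff.2 fun i => ae_hasTorusDeriv_of_hasWeakDx (u.toFun_memLp.integrable hp1)
    ((u.grad_memLp i).integrable hp1) (u.weak_grad i)
  have h4 := ae_all_iff.2 fun i => ae_all_iff.2 fun j => ae_hasTorusDeriv_of_hasWeakDx
    ((u.grad_memLp i).integrable hp1) ((u.hess_memLp i j).integrable hp1) (u.weak_hess i j)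
  filter_upwards [MemLp.ae_slice hp0 u.toFun_memLp, MemLp.ae_slice hp0 u.ut_memLp, h1, h2, h3,
    h4] with t k1 k2 k3 k4 k5 k6
  exact ⟨k1, k2, k3, k4, k5, k6⟩

theorem W21p.hasTrace (hp : 1 ≤ p) (hT : 0 < T) :
    HasTrace T u.toFun u.ut (initialValue u.toFun) ∧ ∀ᵐ x, terminalValue T u.toFun x =
      initialValue u.toFun x + ∫ s in 0..T, u.ut (x, s) :=
  have hp1 : (1 : ℝ≥0∞) ≤ ENNReal.ofReal p := by simpa using hp
  hasTrace_of_hasWeakDt hT (u.toFun_memLp.integrable hp1) (u.ut_memLp.integrable hp1) u.weak_ut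

end W21p

end MFGC

namespace MFGC

open UnitAddTorus

variable {d k : ℕ} {T p : ℝ}

/-! ### Powers of the negative part -/

/-- Powers of exponent at least two remove the kink of the negative part, so the C¹ chain rules
apply to them. -/
theorem hasDerivAt_negPart_pow (k : ℕ) (s : ℝ) :
    HasDerivAt (fun s : ℝ => max (-s) 0 ^ (k + 2)) (-((k + 2 : ℕ) : ℝ) * max (-s) 0 ^ (k + 1)) s := by
  rcases lt_trichotomy s 0 with h | rfl | h
  · have h1 : HasDerivAt (fun s : ℝ => (-s) ^ (k + 2)) (-((k + 2 : ℕ) : ℝ) * (-s) ^ (k + 1)) s := by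
      convert! (hasDerivAt_neg s).pow (k + 2) using 1
      simp; ring
    rw [max_eq_left (by linarith)]
    refine h1.congr_of_eventuallyEq ?_
    filter_upwards [Iio_mem_nhds h] with r hr
    rw [max_eq_left (by linarith [mem_Iio.1 hr])]
  · simp only [neg_zero, max_self, ne_eq, Nat.add_eq_zero_iff, one_ne_zero, and_false,
      not_false_eq_true, zero_pow, mul_zero]
    rw [hasDerivAt_iff_isLittleO_nhds_zero]
    have : (fun h : ℝ => h ^ (k + 2)) =o[𝓝 0] fun h => h := by
      simpa using Asymptotics.isLittleO_pow_pow (𝕜 := ℝ) (m := 1) (n := k + 2) (by omega)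
    refine (Asymptotics.IsBigO.of_bound 1 (.of_forall fun h => ?_)).trans_isLittleO this
    simp only [zero_add, neg_zero, max_self, ne_eq, Nat.add_eq_zero_iff, OfNat.ofNat_ne_zero,
      and_false, not_false_eq_true, zero_pow, sub_zero, smul_zero, norm_pow, one_mul]
    refine pow_le_pow_left₀ (norm_nonneg _) ?_ _
    rw [Real.norm_of_nonneg (le_max_right _ _), Real.norm_eq_abs]
    exact max_le (neg_le_abs h) (abs_nonneg h)
  · have h1 : HasDerivAt (fun _ : ℝ => (0 : ℝ)) 0 s := hasDerivAt_const _ _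
    rw [max_eq_right (by linarith), zero_pow (by omega), mul_zero]
    refine h1.congr_of_eventuallyEq ?_
    filter_upwards [Ioi_mem_nhds h] with r hr
    rw [max_eq_right (by linarith [mem_Ioi.1 hr]), zero_pow (by omega)]

theorem contDiff_negPart_pow (k : ℕ) : ContDiff ℝ 1 fun s : ℝ => max (-s) 0 ^ (k + 2) := by
  refine contDiff_one_iff_deriv.2 ⟨fun s => (hasDerivAt_negPart_pow k s).differentiableAt, ?_⟩
  rw [funext fun s => (hasDerivAt_negPart_pow k s).deriv]
  fun_prop

/-! ### The Fokker-Planck equation -/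

/-- The bound depends on the slice; it serves only to make products integrable and slices
essentially bounded. -/
theorem ae_bounded_slice (hp : (d : ℝ) < p) (hp1 : 1 ≤ p) {f : Torus d → ℝ}
    {g : Fin d → Torus d → ℝ} (hf : Integrable f)
    (hg : ∀ i, MemLp (g i) (ENNReal.ofReal p) volume) (h : ∀ i, HasTorusDeriv i f (g i)) :
    ∃ C : ℝ, ∀ᵐ x, |f x| ≤ C := by
  set K := ‖∫ x, f x‖ₑ + morreyConst d p * ∑ i, eLpNorm (g i) (ENNReal.ofReal p) volume with hK
  have hKt : K ≠ ⊤ := by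
    refine ENNReal.add_ne_top.2 ⟨by simp, ENNReal.mul_ne_top (morreyConst_ne_top hp) ?_⟩
    exact ENNReal.sum_ne_top.2 fun i _ => (hg i).2.ne
  refine ⟨K.toReal, ?_⟩
  filter_upwards [ae_enorm_le_of_hasTorusDeriv hp1 hf hg h] with x hx
  have := ENNReal.toReal_mono hKt hx
  simpa using this

theorem Data.IsSolution.ae_slice {𝒟 : Data d k} {u m : W21p d 𝒟.T p}
    {v : Torus d × ℝ → Vec d} {P : ℝ → Vec k} (hp : 1 ≤ p) (hsol : 𝒟.IsSolution u m v P) :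
    (∀ i, MemLp (fun z => m.toFun z * v z i) (ENNReal.ofReal p) (cylMeasure d 𝒟.T)) ∧
    ∀ᵐ t ∂(volume.restrict (Icc 0 𝒟.T)), ∀ n : Fin d → ℤ,
      ch (fun x => m.ut (x, t) - 𝒟.σ * m.lap (x, t)) n =
        ∑ i, (2 * Real.pi * Complex.I * n i) * ch (fun x => m.toFun (x, t) * v (x, t) i) n := by
  have hp1 : (1 : ℝ≥0∞) ≤ ENNReal.ofReal p := by simpa using hp
  have hv : MemLp v ⊤ (cylMeasure d 𝒟.T) := by rw [← restrict_cyl]; exact hsol.memLp_v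
  have hb : ∀ i, MemLp (fun z => m.toFun z * v z i) (ENNReal.ofReal p) (cylMeasure d 𝒟.T) :=
    fun i => (MemLp.vec_apply hv i).mul (p := ENNReal.ofReal p) (q := ⊤) (r := ENNReal.ofReal p)
      m.toFun_memLp
  refine ⟨hb, ?_⟩
  refine ae_ch_eq_of_weak_divergence (w := fun z => m.ut z - 𝒟.σ * m.lap z)
    ((m.ut_memLp.integrable hp1).sub ((m.lap_memLp.integrable hp1).const_mul _))
    (b := fun i z => m.toFun z * v z i) (fun i => (hb i).integrable hp1) fun ψ hψ => ?_
  have h1 := sub_eq_zero.1 (hsol.fokker_planck ψ hψ)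
  rw [restrict_cyl] at h1
  rw [h1]
  refine integral_congr_ae (.of_forall fun z => ?_)
  simp only [PiLp.inner_apply, dgrad, PiLp.smul_apply, smul_eq_mul, RCLike.inner_apply, conj_trivial]
  exact Finset.sum_congr rfl fun i _ => mul_comm _ _

theorem memLp_two_of_le (hp : 2 ≤ p) {f : Torus d → ℝ}
    (hf : MemLp f (ENNReal.ofReal p) volume) : MemLp f 2 volume :=
  hf.mono_exponent (by
    rw [show (2 : ℝ≥0∞) = ENNReal.ofReal 2 by simp]; exact ENNReal.ofReal_le_ofReal hp)

theorem integrable_mul_of_memLp_two {α : Type*} [MeasurableSpace α] {μ : Measure α} {f g : α → ℝ}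
    (hf : MemLp f 2 μ) (hg : MemLp g 2 μ) : Integrable (fun x => f x * g x) μ :=
  hf.integrable_mul hg

theorem W21p.IsGoodSlice.integral_lap_mul {u : W21p d T p} {t : ℝ} (hu : u.IsGoodSlice t)
    (hp : 2 ≤ p) {φ : Torus d → ℝ} {ψ : Fin d → Torus d → ℝ} (hφ : ∀ i, HasTorusDeriv i φ (ψ i))
    (hφ2 : MemLp φ 2 volume) (hψ2 : ∀ i, MemLp (ψ i) 2 volume) :
    ∫ x, u.lap (x, t) * φ x = -∑ i, ∫ x, u.grad (x, t) i * ψ i x := by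
  have h2 := fun {f : Torus d → ℝ} => memLp_two_of_le (d := d) (f := f) hp
  simp only [W21p.lap, Finset.sum_mul]
  rw [integral_finsetSum _ fun i _ => integrable_mul_of_memLp_two (h2 (hu.memLp_hess i i)) hφ2,
    ← Finset.sum_neg_distrib]
  exact Finset.sum_congr rfl fun i _ => (hu.deriv_grad i i).integral_mul_eq (hφ i)
    (h2 (hu.memLp_grad i)) (h2 (hu.memLp_hess i i)) hφ2 (hψ2 i)

theorem memLp_mul_of_bounded {f g : Torus d → ℝ} {q : ℝ≥0∞} (hf : MemLp f q volume)
    (hg : AEStronglyMeasurable g volume) {C : ℝ} (hC : ∀ᵐ x, |g x| ≤ C) :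
    MemLp (fun x => g x * f x) q volume :=
  hf.mul (p := ⊤) (memLp_top_of_bound hg C hC)

/-- With N the negative part of m, the equation is tested against N², whose gradient is −2N∇m. The
cube is chosen as energy because its derivative −3N² is still C¹ in m, hence an admissible test
function. In each of the d directions, Young's inequality absorbs the transport term into the
diffusion, leaving 6N · V²/(4σ) · m², and N m² = N³. -/
theorem integral_negPart_slice_le {m : W21p d T p} {t σ V : ℝ} {b : Fin d → Torus d → ℝ}
    (hm : m.IsGoodSlice t) (hσ : 0 < σ) (hp2 : 2 ≤ p) (hpd : (d : ℝ) < p)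
    (hb : ∀ i, AEStronglyMeasurable (b i) volume) (hV : ∀ i, ∀ᵐ x, |b i x| ≤ V)
    (hfp : ∀ n : Fin d → ℤ, ch (fun x => m.ut (x, t) - σ * m.lap (x, t)) n =
        ∑ i, (2 * Real.pi * Complex.I * n i) * ch (fun x => m.toFun (x, t) * b i x) n) :
    ∫ x, (-3 * max (-m.toFun (x, t)) 0 ^ 2) * m.ut (x, t) ≤
      (d * (6 * (V ^ 2 / (4 * σ)))) * ∫ x, max (-m.toFun (x, t)) 0 ^ 3 := by
  have h2 := fun {f : Torus d → ℝ} => memLp_two_of_le (d := d) (f := f) hp2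
  have hp1 : 1 ≤ p := by linarith
  have hp1' : (1 : ℝ≥0∞) ≤ ENNReal.ofReal p := by simpa using hp1
  set f : Torus d → ℝ := fun x => m.toFun (x, t) with hf
  set g : Fin d → Torus d → ℝ := fun i x => m.grad (x, t) i with hg
  obtain ⟨C, hC⟩ := ae_bounded_slice hpd hp1 (hm.memLp_toFun.integrable hp1') hm.memLp_grad
    hm.deriv_toFun
  have hfm : AEStronglyMeasurable f volume := hm.memLp_toFun.1
  let N : Torus d → ℝ := fun x => max (-f x) 0
  have hNm : AEStronglyMeasurable N volume := (by fun_prop : Continuous fun s : ℝ =>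
    max (-s) 0).comp_aestronglyMeasurable hfm
  have hN : ∀ᵐ x, |N x| ≤ C := by
    filter_upwards [hC] with x hx
    rw [abs_of_nonneg (le_max_right _ _)]
    exact max_le ((neg_le_abs _).trans hx) ((abs_nonneg _).trans hx)
  have hNpow : ∀ j : ℕ, MemLp (fun x => N x ^ j) 2 volume := fun j => by
    refine MemLp.of_bound (hNm.pow j) (C ^ j) ?_
    filter_upwards [hN] with x hx
    rw [norm_pow]; exact pow_le_pow_left₀ (norm_nonneg _) hx j
  have hg2 := fun i => h2 (hm.memLp_grad i)
  let ψ : Fin d → Torus d → ℝ := fun i x => (-2 * N x) * g i x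
  have hc2N : AEStronglyMeasurable (fun x => -2 * N x) volume := hNm.const_mul (-2)
  have hψ2 : ∀ i, MemLp (ψ i) 2 volume := fun i =>
    memLp_mul_of_bounded (hg2 i) hc2N (C := 2 * C) (by
      filter_upwards [hN] with x hx
      rw [abs_mul]; norm_num; exact hx)
  have hder : ∀ i, HasTorusDeriv i (fun x => N x ^ 2) (ψ i) := fun i => by
    have e : deriv (fun s : ℝ => max (-s) 0 ^ 2) = fun s => -2 * max (-s) 0 := by
      funext s
      rw [(hasDerivAt_negPart_pow 0 s).deriv]; norm_num
    have := (hm.deriv_toFun i).comp (contDiff_negPart_pow 0) (hm.memLp_toFun.integrable hp1')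
      ((hm.memLp_grad i).integrable hp1') ((hNpow 2).integrable (by norm_num)) (by
        simp only [zero_add, e]; exact (hψ2 i).integrable (by norm_num))
    simp only [zero_add, e] at this
    exact this
  have hfb : ∀ i, MemLp (fun x => f x * b i x) 2 volume := fun i => by
    simpa only [mul_comm] using memLp_mul_of_bounded (h2 hm.memLp_toFun) (hb i) (hV i)
  have hlap : MemLp (fun x => m.lap (x, t)) 2 volume :=
    memLp_finsetSum _ fun i _ => h2 (hm.memLp_hess i i)
  have hut := h2 hm.memLp_ut
  have e1 := integral_mul_eq_sum_of_ch_eq hfp hder (hut.sub (hlap.const_mul σ)) hfb (hNpow 2) hψ2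
  have e2 := hm.integral_lap_mul hp2 hder (hNpow 2) hψ2
  have e3 : ∫ x, (m.ut (x, t) - σ * m.lap (x, t)) * N x ^ 2 =
      (∫ x, m.ut (x, t) * N x ^ 2) - σ * ∫ x, m.lap (x, t) * N x ^ 2 := by
    rw [← integral_const_mul, ← integral_sub (integrable_mul_of_memLp_two hut (hNpow 2))
      ((integrable_mul_of_memLp_two hlap (hNpow 2)).const_mul σ)]
    exact integral_congr_ae (.of_forall fun x => by ring)
  have e4 : ∫ x, (-3 * max (-m.toFun (x, t)) 0 ^ 2) * m.ut (x, t) =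
      ∑ i, -3 * ((∫ x, f x * b i x * ψ i x) - σ * ∫ x, g i x * ψ i x) := by
    have : ∫ x, (-3 * max (-m.toFun (x, t)) 0 ^ 2) * m.ut (x, t) =
        -3 * ∫ x, m.ut (x, t) * N x ^ 2 := by
      rw [← integral_const_mul]
      exact integral_congr_ae (.of_forall fun x => by simp only [N, hf]; ring)
    rw [this, ← Finset.mul_sum, Finset.sum_sub_distrib, ← Finset.mul_sum]
    linear_combination (-3) * (e1 - e3 + σ * e2)
  rw [e4]
  have hterm : ∀ i, -3 * ((∫ x, f x * b i x * ψ i x) - σ * ∫ x, g i x * ψ i x) ≤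
      6 * (V ^ 2 / (4 * σ)) * ∫ x, N x ^ 3 := fun i => by
    have j1 : Integrable fun x => f x * b i x * ψ i x := (hfb i).integrable_mul (hψ2 i)
    have j2 : Integrable fun x => g i x * ψ i x := (hg2 i).integrable_mul (hψ2 i)
    rw [← integral_const_mul, ← integral_const_mul, ← integral_sub j1 (j2.const_mul σ),
      ← integral_const_mul]
    refine integral_mono_ae ((j1.sub (j2.const_mul σ)).const_mul _)
      (((hNpow 3).integrable (by norm_num)).const_mul _) ?_
    filter_upwards [hV i] with x hx
    simp only [ψ]
    have hN0 : 0 ≤ N x := le_max_right _ _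
    have hNf : N x * f x ^ 2 = N x ^ 3 := by
      simp only [N]
      rcases le_total (f x) 0 with h0 | h0
      · rw [max_eq_left (by linarith)]; ring
      · rw [max_eq_right (by linarith)]; ring
    have hb2 : b i x ^ 2 ≤ V ^ 2 := sq_le_sq' (by linarith [neg_abs_le (b i x)])
      ((le_abs_self _).trans hx)
    have key : f x * b i x * g i x - σ * g i x ^ 2 ≤ V ^ 2 / (4 * σ) * f x ^ 2 := by
      have h1 : f x * b i x * g i x - σ * g i x ^ 2 ≤ b i x ^ 2 / (4 * σ) * f x ^ 2 := by
        have : b i x ^ 2 / (4 * σ) * f x ^ 2 - (f x * b i x * g i x - σ * g i x ^ 2) =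
            (f x * b i x - 2 * σ * g i x) ^ 2 / (4 * σ) := by field_simp; ring
        have h0 : 0 ≤ (f x * b i x - 2 * σ * g i x) ^ 2 / (4 * σ) := by positivity
        linarith
      refine h1.trans ?_
      gcongr
    have h6 := mul_le_mul_of_nonneg_left key (mul_nonneg (by norm_num : (0 : ℝ) ≤ 6) hN0)
    calc -3 * (f x * b i x * (-2 * N x * g i x) - σ * (g i x * (-2 * N x * g i x)))
        = 6 * N x * (f x * b i x * g i x - σ * g i x ^ 2) := by ring
      _ ≤ 6 * N x * (V ^ 2 / (4 * σ) * f x ^ 2) := h6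
      _ = 6 * (V ^ 2 / (4 * σ)) * N x ^ 3 := by rw [← hNf]; ring
  refine (Finset.sum_le_sum fun i _ => hterm i).trans_eq ?_
  rw [Finset.sum_const, Finset.card_univ, Fintype.card_fin, nsmul_eq_mul]
  ring

theorem sq_mul_le_cube_add_cube {a b : ℝ} (ha : 0 ≤ a) (hb : 0 ≤ b) : a ^ 2 * b ≤ a ^ 3 + b ^ 3 := by
  rcases le_total a b with h | h
  · have := mul_le_mul_of_nonneg_right (pow_le_pow_left₀ ha h 2) hb
    nlinarith [pow_nonneg ha 3]
  · have := mul_le_mul_of_nonneg_left h (sq_nonneg a)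
    nlinarith [pow_nonneg hb 3]

/-- The Fokker-Planck equation preserves nonnegativity. -/
theorem ae_nonneg_of_fokkerPlanck {m : W21p d T p} {σ V : ℝ} {b : Fin d → Torus d × ℝ → ℝ}
    (hT : 0 < T) (hσ : 0 < σ) (hp3 : 3 ≤ p) (hpd : (d : ℝ) < p)
    (hb : ∀ i, AEStronglyMeasurable (b i) (cylMeasure d T))
    (hV : ∀ i, ∀ᵐ z ∂(cylMeasure d T), |b i z| ≤ V)
    (hfp : ∀ᵐ t ∂(volume.restrict (Icc 0 T)), ∀ n : Fin d → ℤ,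
      ch (fun x => m.ut (x, t) - σ * m.lap (x, t)) n =
        ∑ i, (2 * Real.pi * Complex.I * n i) * ch (fun x => m.toFun (x, t) * b i (x, t)) n)
    (h0 : ∀ᵐ x, 0 ≤ initialValue m.toFun x) :
    ∀ᵐ t ∂(volume.restrict (Icc 0 T)), ∀ᵐ x, 0 ≤ m.toFun (x, t) := by
  obtain ⟨htr, -⟩ := m.hasTrace (by linarith) hT
  have h3 : ∀ {f : Torus d × ℝ → ℝ}, MemLp f (ENNReal.ofReal p) (cylMeasure d T) →
      Integrable (fun z => |f z| ^ 3) (cylMeasure d T) := fun {f} hf => by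
    have : MemLp f (3 : ℕ) (cylMeasure d T) := hf.mono_exponent (by
      rw [show ((3 : ℕ) : ℝ≥0∞) = ENNReal.ofReal 3 by simp]; exact ENNReal.ofReal_le_ofReal hp3)
    simpa using this.integrable_norm_pow (by norm_num)
  have hmm := m.toFun_memLp.1
  have hN0 : ∀ s : ℝ, 0 ≤ max (-s) 0 := fun s => le_max_right _ _
  have hNle : ∀ s : ℝ, max (-s) 0 ≤ |s| := fun s => max_le (neg_le_abs s) (abs_nonneg s)
  have e : deriv (fun s : ℝ => max (-s) 0 ^ 3) = fun s => -3 * max (-s) 0 ^ 2 := by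
    funext s
    rw [(hasDerivAt_negPart_pow 1 s).deriv]; norm_num
  have hi1 : Integrable (fun z => max (-m.toFun z) 0 ^ 3) (cylMeasure d T) := by
    refine (h3 m.toFun_memLp).mono' ((by fun_prop : Continuous fun s : ℝ =>
      max (-s) 0 ^ 3).comp_aestronglyMeasurable hmm) (.of_forall fun z => ?_)
    rw [Real.norm_of_nonneg (pow_nonneg (hN0 _) 3)]
    exact pow_le_pow_left₀ (hN0 _) (hNle _) 3
  have hi2 : Integrable (fun z => -3 * max (-m.toFun z) 0 ^ 2 * m.ut z) (cylMeasure d T) := by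
    refine (((h3 m.toFun_memLp).add (h3 m.ut_memLp)).const_mul 3).mono'
      (((by fun_prop : Continuous fun s : ℝ => -3 * max (-s) 0 ^ 2).comp_aestronglyMeasurable
        hmm).mul m.ut_memLp.1) (.of_forall fun z => ?_)
    rw [norm_mul, norm_mul, Real.norm_of_nonneg (pow_nonneg (hN0 _) 2), Real.norm_eq_abs,
      Real.norm_eq_abs, mul_assoc]
    norm_num
    exact (mul_le_mul_of_nonneg_right (pow_le_pow_left₀ (hN0 _) (hNle _) 2) (abs_nonneg _)).trans
      (by simpa using sq_mul_le_cube_add_cube (abs_nonneg (m.toFun z)) (abs_nonneg (m.ut z)))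
  have hen := (htr.integral_comp_eq hT (contDiff_negPart_pow 1) hi1 (by
    simpa only [Nat.reduceAdd, e] using hi2)).1
  simp only [Nat.reduceAdd, e] at hen
  have hz : ∫ x, max (-initialValue m.toFun x) 0 ^ 3 = 0 := by
    rw [integral_congr_ae (g := fun _ => 0)]
    · simp
    · filter_upwards [h0] with x hx
      rw [max_eq_right (by linarith)]; norm_num
  -- The energy ∫ N³ starts from zero, so Grönwall's inequality with the constant coefficient K
  -- applies.
  rw [hz] at hen
  set K : ℝ := d * (6 * (V ^ 2 / (4 * σ))) with hK
  have hK0 : 0 ≤ K := by positivity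
  have hslice : ∀ᵐ t ∂(volume.restrict (Icc 0 T)),
      ∫ x, -3 * max (-m.toFun (x, t)) 0 ^ 2 * m.ut (x, t) ≤
        K * ∫ x, max (-m.toFun (x, t)) 0 ^ 3 := by
    filter_upwards [m.ae_isGoodSlice (by linarith), hfp,
      ae_all_iff.2 fun i => (hb i).prod_swap.prodMk_left,
      ae_all_iff.2 fun i => ae_swap_of_ae_prod (hV i)] with t h1 h2 h4 h5
    exact integral_negPart_slice_le h1 hσ (by linarith) hpd h4 h5 h2
  have hy := hi1.integral_prod_right
  have hy' := hi2.integral_prod_right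
  have hgr := ae_le_zero_of_le_integral (T := T) (κ := fun _ => K)
    (y := fun t => ∫ x, max (-m.toFun (x, t)) 0 ^ 3) (integrableOn_const (by simp)) (fun _ => hK0)
    (hy.const_mul K) (by
      filter_upwards [hen, ae_restrict_mem measurableSet_Icc] with t ht ht'
      rw [ht, zero_add, intervalIntegral.integral_of_le ht'.1,
        intervalIntegral.integral_of_le ht'.1]
      have hsub : Ioc 0 t ⊆ Icc 0 T := Ioc_subset_Icc_self.trans (Icc_subset_Icc_right ht'.2)
      exact setIntegral_mono_ae_restrict (IntegrableOn.mono_set hy' hsub)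
        (IntegrableOn.mono_set (hy.const_mul K) hsub)
        (ae_mono (Measure.restrict_mono hsub le_rfl) hslice))
  filter_upwards [hgr, hi1.prod_left_ae] with t ht hi
  have h1 : ∫ x, max (-m.toFun (x, t)) 0 ^ 3 = 0 :=
    le_antisymm ht (integral_nonneg fun x => pow_nonneg (hN0 _) 3)
  rw [integral_eq_zero_iff_of_nonneg (fun x => pow_nonneg (hN0 _) 3) hi] at h1
  filter_upwards [h1] with x hx
  have := (pow_eq_zero_iff (by norm_num)).1 hx
  have := max_eq_right_iff.1 this
  linarith

/-- The Fokker-Planck equation preserves mass. -/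
theorem ae_integral_eq_of_fokkerPlanck {m : W21p d T p} {σ : ℝ} {b : Fin d → Torus d × ℝ → ℝ}
    (hT : 0 < T) (hp : 2 ≤ p)
    (hfp : ∀ᵐ t ∂(volume.restrict (Icc 0 T)), ∀ n : Fin d → ℤ,
      ch (fun x => m.ut (x, t) - σ * m.lap (x, t)) n =
        ∑ i, (2 * Real.pi * Complex.I * n i) * ch (fun x => m.toFun (x, t) * b i (x, t)) n) :
    ∀ᵐ t ∂(volume.restrict (Icc 0 T)),
      ∫ x, m.toFun (x, t) = ∫ x, initialValue m.toFun x := by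
  have hp1 : (1 : ℝ≥0∞) ≤ ENNReal.ofReal p := by simpa using (by linarith : (1 : ℝ) ≤ p)
  obtain ⟨htr, -⟩ := m.hasTrace (by linarith) hT
  have hen := (htr.integral_comp_eq hT (η := fun s => s) contDiff_id htr.integrable (by
    simpa using htr.integrable_deriv)).1
  simp only [deriv_id'', one_mul] at hen
  have hch : ∀ f : Torus d → ℝ, ch f 0 = ((∫ x, f x : ℝ) : ℂ) := fun f => by
    rw [ch, ← integral_complex_ofReal]; simp [mFourier_zero]
  -- The zero Fourier mode of a divergence, and of a Laplacian, vanishes.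
  have hz : ∀ᵐ t ∂(volume.restrict (Icc 0 T)), ∫ x, m.ut (x, t) = 0 := by
    filter_upwards [hfp, m.ae_isGoodSlice (by linarith)] with t ht hm
    have h1 := ht 0
    simp only [Pi.zero_apply, Int.cast_zero, mul_zero, zero_mul, Finset.sum_const_zero] at h1
    rw [hch] at h1
    have h1' : ∫ x, (m.ut (x, t) - σ * m.lap (x, t)) = 0 := by exact_mod_cast h1
    have hl : ∫ x, m.lap (x, t) = 0 := by
      simp only [W21p.lap]
      rw [integral_finsetSum _ fun i _ => (hm.memLp_hess i i).integrable hp1]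
      refine Finset.sum_eq_zero fun i _ => ?_
      have := hm.deriv_grad i i 0
      rw [hch] at this
      simpa using this
    have hli : Integrable fun x => m.lap (x, t) :=
      integrable_finsetSum _ fun i _ => (hm.memLp_hess i i).integrable hp1
    rw [integral_sub (hm.memLp_ut.integrable hp1) (hli.const_mul σ), integral_const_mul, hl] at h1'
    linarith
  filter_upwards [hen, ae_restrict_mem measurableSet_Icc] with t ht ht'
  rw [ht, add_eq_left, intervalIntegral.integral_of_le ht'.1]
  refine integral_eq_zero_of_ae (ae_mono (Measure.restrict_mono
    (Ioc_subset_Icc_self.trans (Icc_subset_Icc_right ht'.2)) le_rfl) hz)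

end MFGC

namespace MFGC

/-! ### The Legendre transform of a strongly convex function -/

section Legendre

variable {E : Type*} [NormedAddCommGroup E] [InnerProductSpace ℝ E] [FiniteDimensional ℝ E]
  {ℓ : E → ℝ} {c : ℝ}

theorem hasDerivAt_comp_line (hℓ : Differentiable ℝ ℓ) (v h : E) (s : ℝ) :
    HasDerivAt (fun s : ℝ => ℓ (v + s • h)) (inner ℝ (gradient ℓ (v + s • h)) h) s := by
  have h1 := (hℓ (v + s • h)).hasGradientAt.hasFDerivAt
  have h2 : HasDerivAt (fun s : ℝ => v + s • h) h s := by
    simpa using ((hasDerivAt_id s).smul_const h).const_add v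
  exact h1.comp_hasDerivAt s h2

/-- On the segment from v to w, ℓ minus its quadratic minorant has nonnegative derivative by strong
monotonicity of the gradient. -/
theorem strong_convex_le (hℓ : Differentiable ℝ ℓ)
    (hc : ∀ v₁ v₂, c * ‖v₂ - v₁‖ ^ 2 ≤ inner ℝ (gradient ℓ v₂ - gradient ℓ v₁) (v₂ - v₁))
    (v w : E) :
    ℓ v + inner ℝ (gradient ℓ v) (w - v) + c / 2 * ‖w - v‖ ^ 2 ≤ ℓ w := by
  set h := w - v with hh
  let φ : ℝ → ℝ := fun s => ℓ (v + s • h) - s * inner ℝ (gradient ℓ v) h - c / 2 * ‖h‖ ^ 2 * s ^ 2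
  have hd : ∀ s, HasDerivAt φ (inner ℝ (gradient ℓ (v + s • h)) h - inner ℝ (gradient ℓ v) h
      - c * ‖h‖ ^ 2 * s) s := fun s => by
    have h1 := ((hasDerivAt_comp_line hℓ v h s).sub
      ((hasDerivAt_id s).mul_const (inner ℝ (gradient ℓ v) h))).sub
      ((hasDerivAt_pow 2 s).const_mul (c / 2 * ‖h‖ ^ 2))
    convert! h1 using 1
    simp; ring
  have hmono : MonotoneOn φ (Icc 0 1) := by
    refine monotoneOn_of_deriv_nonneg (convex_Icc 0 1)
      (fun s _ => (hd s).continuousAt.continuousWithinAt)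
      (fun s _ => (hd s).differentiableAt.differentiableWithinAt) fun s hs => ?_
    rw [interior_Icc] at hs
    rw [(hd s).deriv, ← inner_sub_left]
    have h1 := hc v (v + s • h)
    rw [add_sub_cancel_left, norm_smul, inner_smul_right, Real.norm_of_nonneg hs.1.le] at h1
    have h2 : s * (c * ‖h‖ ^ 2 * s) ≤ s * inner ℝ (gradient ℓ (v + s • h) - gradient ℓ v) h := by
      linarith
    linarith [le_of_mul_le_mul_left h2 hs.1]
  have := hmono (left_mem_Icc.2 zero_le_one) (right_mem_Icc.2 zero_le_one) zero_le_one
  simp only [φ, zero_smul, add_zero, one_smul, zero_mul, one_mul, one_pow, mul_one, ne_eq,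
    OfNat.ofNat_ne_zero, not_false_eq_true, zero_pow, mul_zero, sub_zero] at this
  rw [hh, add_sub_cancel, ← hh] at this
  linarith

/-- The maximiser in the Legendre transform. -/
theorem exists_legendre_argmax (hc0 : 0 < c) (hℓ : Differentiable ℝ ℓ)
    (hc : ∀ v₁ v₂, c * ‖v₂ - v₁‖ ^ 2 ≤ inner ℝ (gradient ℓ v₂ - gradient ℓ v₁) (v₂ - v₁))
    (q : E) :
    ∃ v, gradient ℓ v = -q ∧ ∀ w, -inner ℝ q w - ℓ w ≤ -inner ℝ q v - ℓ v := by
  have hcont : Continuous fun w => inner ℝ q w + ℓ w := by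
    have := hℓ.continuous
    fun_prop
  have hlow : ∀ w, c / 2 * ‖w‖ ^ 2 - (‖q‖ + ‖gradient ℓ 0‖) * ‖w‖ + ℓ 0 ≤ inner ℝ q w + ℓ w :=
    fun w => by
      have h1 := strong_convex_le hℓ hc 0 w
      rw [sub_zero] at h1
      have h2 := neg_le_of_abs_le (abs_real_inner_le_norm q w)
      have h3 := neg_le_of_abs_le (abs_real_inner_le_norm (gradient ℓ 0) w)
      linarith
  have htop : Tendsto (fun w => inner ℝ q w + ℓ w) (cocompact E) atTop := by
    refine tendsto_atTop_mono hlow ?_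
    have h1 : Tendsto (fun r : ℝ => c / 2 * r ^ 2 - (‖q‖ + ‖gradient ℓ 0‖) * r + ℓ 0) atTop atTop := by
      have h2 : Tendsto (fun r : ℝ => r * (c / 2 * r - (‖q‖ + ‖gradient ℓ 0‖)) + ℓ 0) atTop atTop := by
        refine tendsto_atTop_add_const_right _ _ (tendsto_id.atTop_mul_atTop₀ ?_)
        exact tendsto_atTop_add_const_right _ _ (tendsto_id.const_mul_atTop (by positivity))
      refine h2.congr fun r => by ring
    exact h1.comp (tendsto_norm_cocompact_atTop)
  obtain ⟨v, hv⟩ := hcont.exists_forall_le htop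
  refine ⟨v, ?_, fun w => by have := hv w; linarith⟩
  have hmin : IsLocalMin (fun w => inner ℝ q w + ℓ w) v := .of_forall hv
  have hd : HasFDerivAt (fun w => inner ℝ q w + ℓ w)
      (innerSL ℝ q + (InnerProductSpace.toDual ℝ E) (gradient ℓ v)) v :=
    ((innerSL ℝ q).hasFDerivAt).add (hℓ v).hasGradientAt.hasFDerivAt
  have h0 := hmin.hasFDerivAt_eq_zero hd
  rw [eq_neg_iff_add_eq_zero, add_comm]
  refine ext_inner_right ℝ fun w => ?_
  have := congrArg (fun L : E →L[ℝ] ℝ => L w) h0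
  simpa [inner_add_left] using this

/-- Properties of the Legendre transform of a differentiable strongly convex function. -/
theorem exists_legendre_map (hc0 : 0 < c) (hℓ : Differentiable ℝ ℓ)
    (hc : ∀ v₁ v₂, c * ‖v₂ - v₁‖ ^ 2 ≤ inner ℝ (gradient ℓ v₂ - gradient ℓ v₁) (v₂ - v₁)) :
    ∃ V : E → E, (∀ q, (⨆ v, (-inner ℝ q v - ℓ v)) = -inner ℝ q (V q) - ℓ (V q)) ∧
      (∀ q v, -inner ℝ q v - ℓ v ≤ ⨆ v, (-inner ℝ q v - ℓ v)) ∧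
      (∀ q, c * ‖V q‖ ≤ ‖q‖ + ‖gradient ℓ 0‖) ∧ ∀ q r, c * ‖V r - V q‖ ≤ ‖r - q‖ := by
  choose V hV hmax using exists_legendre_argmax hc0 hℓ hc
  have hbdd : ∀ q, BddAbove (range fun v => -inner ℝ q v - ℓ v) := fun q =>
    ⟨_, by rintro _ ⟨w, rfl⟩; exact hmax q w⟩
  have hcancel : ∀ a b : ℝ, 0 ≤ a → c * a ^ 2 ≤ b * a → 0 ≤ b → c * a ≤ b := fun a b ha h hb => by
    rcases ha.eq_or_lt with rfl | ha
    · simpa using hb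
    · refine le_of_mul_le_mul_right ?_ ha
      linarith
  refine ⟨V, fun q => le_antisymm (ciSup_le (hmax q)) (le_ciSup (hbdd q) (V q)),
    fun q v => le_ciSup (hbdd q) v, fun q => ?_, fun q r => ?_⟩
  · refine hcancel _ _ (norm_nonneg _) ?_ (by positivity)
    have h1 := hc 0 (V q)
    rw [sub_zero, hV] at h1
    refine h1.trans ((real_inner_le_norm _ _).trans ?_)
    gcongr
    exact (norm_sub_le _ _).trans_eq (by rw [norm_neg])
  · refine hcancel _ _ (norm_nonneg _) ?_ (norm_nonneg _)
    have h1 := hc (V q) (V r)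
    rw [hV, hV] at h1
    refine h1.trans ((real_inner_le_norm _ _).trans_eq ?_)
    rw [neg_sub_neg, norm_sub_rev q r]

/-- The maximiser at q is a competitor in the supremum at r. -/
theorem legendre_subgradient {E : Type*} [NormedAddCommGroup E] [InnerProductSpace ℝ E]
    {ℓ : E → ℝ} {V : E → E}
    (h1 : ∀ q, (⨆ v, (-inner ℝ q v - ℓ v)) = -inner ℝ q (V q) - ℓ (V q))
    (h2 : ∀ q v, -inner ℝ q v - ℓ v ≤ ⨆ v, (-inner ℝ q v - ℓ v)) (q r : E) :
    (⨆ v, (-inner ℝ q v - ℓ v)) - inner ℝ (V q) (r - q) ≤ ⨆ v, (-inner ℝ r v - ℓ v) := by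
  refine le_trans (le_of_eq ?_) (h2 r (V q))
  rw [h1 q, inner_sub_right, real_inner_comm (V q) q, real_inner_comm (V q) r]
  ring

/-- The subgradient inequalities at q and at r squeeze the first-order remainder between 0 and ⟨V r
− V q, q − r⟩, which is quadratic because V is Lipschitz. -/
theorem legendre_hasGradientAt {V : E → E} (hc0 : 0 < c)
    (h1 : ∀ q, (⨆ v, (-inner ℝ q v - ℓ v)) = -inner ℝ q (V q) - ℓ (V q))
    (h2 : ∀ q v, -inner ℝ q v - ℓ v ≤ ⨆ v, (-inner ℝ q v - ℓ v))
    (h4 : ∀ q r, c * ‖V r - V q‖ ≤ ‖r - q‖) (q : E) :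
    HasGradientAt (fun r => ⨆ v, (-inner ℝ r v - ℓ v)) (-V q) q := by
  rw [hasGradientAt_iff_isLittleO]
  refine (Asymptotics.IsBigO.of_bound c⁻¹ (.of_forall fun r => ?_)).trans_isLittleO
    (Asymptotics.isLittleO_pow_sub_sub q (one_lt_two))
  have e1 := legendre_subgradient h1 h2 q r
  have e2 := legendre_subgradient h1 h2 r q
  have e3 : inner ℝ (V r - V q) (q - r) ≤ c⁻¹ * ‖r - q‖ ^ 2 := by
    refine (real_inner_le_norm _ _).trans ?_
    rw [norm_sub_rev q r, pow_two, ← mul_assoc]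
    gcongr
    rw [le_inv_mul_iff₀ hc0]
    exact h4 q r
  have e5 : ∀ v : E, inner ℝ v (q - r) = -inner ℝ v (r - q) := fun v => by
    rw [← inner_neg_right, neg_sub]
  rw [inner_sub_left, e5, e5] at e3
  rw [e5] at e2
  simp only [inner_neg_left, sub_neg_eq_add]
  rw [Real.norm_of_nonneg (by linarith), Real.norm_of_nonneg (by positivity)]
  linarith

theorem legendre_abs_sub_le {E : Type*} [NormedAddCommGroup E] [InnerProductSpace ℝ E]
    {ℓ : E → ℝ} {c : ℝ} {V : E → E} {M : ℝ} (hc0 : 0 < c)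
    (h1 : ∀ q, (⨆ v, (-inner ℝ q v - ℓ v)) = -inner ℝ q (V q) - ℓ (V q))
    (h2 : ∀ q v, -inner ℝ q v - ℓ v ≤ ⨆ v, (-inner ℝ q v - ℓ v))
    (h3 : ∀ q, c * ‖V q‖ ≤ ‖q‖ + M) (q r : E) :
    |(⨆ v, (-inner ℝ r v - ℓ v)) - ⨆ v, (-inner ℝ q v - ℓ v)| ≤
      c⁻¹ * (‖q‖ + ‖r‖ + M) * ‖r - q‖ := by
  have e1 := legendre_subgradient h1 h2 q r
  have e2 := legendre_subgradient h1 h2 r q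
  have hV : ∀ q, ‖V q‖ ≤ c⁻¹ * (‖q‖ + M) := fun q => by
    rw [le_inv_mul_iff₀ hc0]; exact h3 q
  have e3 := (abs_real_inner_le_norm (V q) (r - q)).trans
    (mul_le_mul_of_nonneg_right (hV q) (norm_nonneg _))
  have e4 := (abs_real_inner_le_norm (V r) (q - r)).trans
    (mul_le_mul_of_nonneg_right (hV r) (norm_nonneg _))
  rw [norm_sub_rev q r] at e4
  have e5 : c⁻¹ * (‖q‖ + M) * ‖r - q‖ ≤ c⁻¹ * (‖q‖ + ‖r‖ + M) * ‖r - q‖ := by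
    gcongr; linarith [norm_nonneg r]
  have e6 : c⁻¹ * (‖r‖ + M) * ‖r - q‖ ≤ c⁻¹ * (‖q‖ + ‖r‖ + M) * ‖r - q‖ := by
    gcongr; linarith [norm_nonneg q]
  rw [abs_le] at e3 e4 ⊢
  constructor <;> linarith [e3.1, e3.2, e4.1, e4.2]

end Legendre

/-! ### The Hamiltonian -/

variable {d k : ℕ}

/-- A measurable section of the projection onto the torus. -/
def sec (x : Torus d) : Vec d :=
  WithLp.toLp 2 fun i => ((AddCircle.measurableEquivIoc 1 0 (x i) : Ioc (0 : ℝ) (0 + 1)) : ℝ)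

theorem measurable_sec : Measurable (sec : Torus d → Vec d) := by
  refine (WithLp.measurable_toLp 2 _).comp (measurable_pi_lambda _ fun i => ?_)
  exact measurable_subtype_coe.comp
    ((AddCircle.measurableEquivIoc 1 0).measurable.comp (measurable_pi_apply i))

theorem proj_sec (x : Torus d) : proj (sec x) = x := by
  ext i
  exact (AddCircle.measurableEquivIoc 1 0).symm_apply_apply (x i)

/-- Regularity in x is assumed on periodic lifts; composing with the measurable section `sec` brings
measurability down to the torus. -/
theorem aestronglyMeasurable_of_continuousOn_lift {E : Type*} [TopologicalSpace E]
    [TopologicalSpace.PseudoMetrizableSpace E] {T : ℝ} {F : Torus d → ℝ → E}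
    (hF : ContinuousOn (fun z : Vec d × ℝ => F (proj z.1) z.2) (univ ×ˢ Icc 0 T)) :
    AEStronglyMeasurable (fun z : Torus d × ℝ => F z.1 z.2) (cylMeasure d T) := by
  let κ : Torus d × ℝ → Vec d × ℝ := fun z => (sec z.1, z.2)
  have hκ : Measurable κ := (measurable_sec.comp measurable_fst).prodMk measurable_snd
  have hS : MeasurableSet ((univ : Set (Vec d)) ×ˢ Icc (0 : ℝ) T) :=
    MeasurableSet.univ.prod measurableSet_Icc
  have h0 : ∀ᵐ z ∂(cylMeasure d T), z.2 ∈ Icc 0 T :=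
    Measure.quasiMeasurePreserving_snd.ae (ae_restrict_mem measurableSet_Icc)
  have h1 : (Measure.map κ (cylMeasure d T)).restrict (univ ×ˢ Icc 0 T) =
      Measure.map κ (cylMeasure d T) := by
    refine Measure.restrict_eq_self_of_ae_mem ?_
    exact (ae_map_iff hκ.aemeasurable hS).2 (h0.mono fun z hz => ⟨trivial, hz⟩)
  have h2 := hF.aestronglyMeasurable (μ := Measure.map κ (cylMeasure d T)) hS
  rw [h1] at h2
  refine (h2.comp_measurable hκ).congr (.of_forall fun z => ?_)
  simp only [Function.comp, κ, proj_sec]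

theorem IsHolderOn.continuousOn {X Y : Type*} [PseudoEMetricSpace X] [SeminormedAddCommGroup Y]
    {α : ℝ≥0} {s : Set X} {h : X → Y} (hα : 0 < α) (hh : IsHolderOn α s h) : ContinuousOn h s := by
  obtain ⟨-, C, hC⟩ := hh
  exact hC.continuousOn hα

namespace Data

variable {𝒟 : Data d k}

/-- The constants are uniform in (x,t): they come only from the modulus of strong convexity and from
a uniform bound on L_v(x,t,0). -/
theorem Assumptions.exists_hamiltonian_map (h : 𝒟.Assumptions) :
    ∃ c > 0, ∃ M : ℝ, ∀ x, ∀ t ∈ Icc 0 𝒟.T,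
      (∃ V : Vec d → Vec d, ∀ q, HasGradientAt (𝒟.H x t) (-V q) q ∧
        ∀ r, 𝒟.H x t q - inner ℝ (V q) (r - q) ≤ 𝒟.H x t r) ∧
      ∀ q r, |𝒟.H x t r - 𝒟.H x t q| ≤ c * (‖q‖ + ‖r‖ + M) * ‖r - q‖ := by
  obtain ⟨C, hC0, hC⟩ := h.L_strong
  obtain ⟨α, -, -, -, ⟨⟨M, hM⟩, -⟩, -⟩ := h.holder 1 one_pos
  have hc0 : 0 < 1 / C := by positivity
  refine ⟨(1 / C)⁻¹, by positivity, M, fun x t ht => ?_⟩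
  obtain ⟨V, h1, h2, h3, h4⟩ := exists_legendre_map hc0 (h.L_diff x t ht) (hC x t ht)
  have hM' : ‖gradient (fun v => 𝒟.L x t v) 0‖ ≤ M := by
    have := hM (sec x, t, 0) ⟨trivial, ht, by simp⟩
    simpa only [proj_sec, Lv] using this
  exact ⟨⟨V, fun q => ⟨legendre_hasGradientAt hc0 h1 h2 h4 q, legendre_subgradient h1 h2 q⟩⟩,
    legendre_abs_sub_le hc0 h1 h2 fun q => (h3 q).trans (by gcongr)⟩

theorem Assumptions.hamiltonian_subgradient (h : 𝒟.Assumptions) {x : Torus d} {t : ℝ}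
    (ht : t ∈ Icc 0 𝒟.T) (q r : Vec d) :
    𝒟.H x t q + inner ℝ (𝒟.Hp x t q) (r - q) ≤ 𝒟.H x t r := by
  obtain ⟨c, -, M, hM⟩ := h.exists_hamiltonian_map
  obtain ⟨⟨V, hV⟩, -⟩ := hM x t ht
  obtain ⟨h1, h2⟩ := hV q
  have : 𝒟.Hp x t q = -V q := h1.gradient
  rw [this, inner_neg_left]
  linarith [h2 r]

theorem Assumptions.aestronglyMeasurable_L (h : 𝒟.Assumptions) (v : Vec d) :
    AEStronglyMeasurable (fun z : Torus d × ℝ => 𝒟.L z.1 z.2 v) (cylMeasure d 𝒟.T) := by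
  obtain ⟨α, hα, -, h1, -⟩ := h.holder (‖v‖ + 1) (by positivity)
  refine aestronglyMeasurable_of_continuousOn_lift (F := fun x t => 𝒟.L x t v) ?_
  exact (h1.continuousOn hα).comp (f := fun z : Vec d × ℝ => (z.1, z.2, v))
    (by fun_prop) fun z hz => ⟨trivial, hz.2, by simp⟩

theorem Assumptions.aestronglyMeasurable_φ (h : 𝒟.Assumptions) :
    AEStronglyMeasurable (fun z : Torus d × ℝ => 𝒟.φ z.1 z.2) (cylMeasure d 𝒟.T) := by
  obtain ⟨α, hα, -, -, -, -, -, -, h1, -⟩ := h.holder 1 one_pos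
  exact aestronglyMeasurable_of_continuousOn_lift (h1.continuousOn hα)

theorem Assumptions.exists_norm_φ_le (h : 𝒟.Assumptions) :
    ∃ C : ℝ, 0 ≤ C ∧ ∀ x, ∀ t ∈ Icc 0 𝒟.T, ‖𝒟.φ x t‖ ≤ C := by
  obtain ⟨α, hα, -, -, -, -, -, -, ⟨⟨C, hC⟩, -⟩, -⟩ := h.holder 1 one_pos
  have key : ∀ x, ∀ t ∈ Icc 0 𝒟.T, ‖𝒟.φ x t‖ ≤ C := fun x t ht => by
    have := hC (sec x, t) ⟨trivial, ht⟩
    simpa only [proj_sec] using this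
  exact ⟨C, (norm_nonneg _).trans (key 0 0 ⟨le_rfl, h.T_pos.le⟩), key⟩

theorem ae_snd_mem_Icc {T : ℝ} : ∀ᵐ z ∂(cylMeasure d T), z.2 ∈ Icc 0 T :=
  Measure.quasiMeasurePreserving_snd.ae (ae_restrict_mem measurableSet_Icc)

/-- Continuity of L in v lets the supremum run over a countable dense set. -/
theorem Assumptions.aestronglyMeasurable_H (h : 𝒟.Assumptions) {q : Torus d × ℝ → Vec d}
    (hq : AEStronglyMeasurable q (cylMeasure d 𝒟.T)) :
    AEStronglyMeasurable (fun z => 𝒟.H z.1 z.2 (q z)) (cylMeasure d 𝒟.T) := by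
  obtain ⟨S, hSc, hS⟩ := TopologicalSpace.exists_countable_dense (Vec d)
  have : Countable S := hSc.to_subtype
  have h1 : AEMeasurable (fun z => ⨆ v : S, (-inner ℝ (q z) (v : Vec d) - 𝒟.L z.1 z.2 v))
      (cylMeasure d 𝒟.T) := by
    refine AEMeasurable.iSup fun v => ?_
    exact ((hq.inner aestronglyMeasurable_const).neg.sub (h.aestronglyMeasurable_L v)).aemeasurable
  refine (h1.congr ?_).aestronglyMeasurable
  filter_upwards [ae_snd_mem_Icc] with z hz
  have hc : Continuous fun v => -inner ℝ (q z) v - 𝒟.L z.1 z.2 v := by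
    have := (h.L_diff z.1 z.2 hz).continuous
    fun_prop
  exact hS.ciSup' hc

end Data

end MFGC

namespace MFGC

/-! ### The conjugate of the price potential -/

theorem le_of_convexOn_of_hasGradientAt {E : Type*} [NormedAddCommGroup E] [InnerProductSpace ℝ E]
    [CompleteSpace E] {Φ : E → ℝ} {g z : E} (hΦ : ConvexOn ℝ univ Φ) (hg : HasGradientAt Φ g z)
    (w : E) : Φ z + inner ℝ g (w - z) ≤ Φ w := by
  have h1 : HasDerivAt (fun s : ℝ => Φ (z + s • (w - z))) (inner ℝ g (w - z)) 0 := by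
    have h2 : HasDerivAt (fun s : ℝ => z + s • (w - z)) (w - z) 0 := by
      simpa using ((hasDerivAt_id (0 : ℝ)).smul_const (w - z)).const_add z
    have h3 : HasFDerivAt Φ (InnerProductSpace.toDual ℝ E g) (z + (0 : ℝ) • (w - z)) := by
      simpa using hg.hasFDerivAt
    exact h3.comp_hasDerivAt (0 : ℝ) h2
  have hc : ConvexOn ℝ univ (fun s : ℝ => Φ (z + s • (w - z))) := by
    have := hΦ.comp_affineMap (AffineMap.lineMap z w : ℝ →ᵃ[ℝ] E)
    refine this.congr fun s _ => ?_
    simp [AffineMap.lineMap_apply, add_comm]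
  have := hc.le_slope_of_hasDerivAt (mem_univ 0) (mem_univ 1) zero_lt_one h1
  simp [slope_def_field] at this
  linarith

variable {d k : ℕ}

theorem IsDensity.integrable {m : Torus d → ℝ} (hm : IsDensity m) : Integrable m :=
  hm.1.integrable (by simp)

theorem IsDensity.integral_abs {m : Torus d → ℝ} (hm : IsDensity m) : ∫ x, |m x| = 1 := by
  refine Eq.trans (integral_congr_ae ?_) hm.2.2
  filter_upwards [hm.2.1] with x hx using abs_of_nonneg hx

theorem abs_integral_mul_le {f g : Torus d → ℝ} {C : ℝ} (hC : ∀ᵐ x, |f x| ≤ C) (hg : Integrable g) :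
    |∫ x, f x * g x| ≤ C * ∫ x, |g x| := by
  rw [← integral_const_mul, ← Real.norm_eq_abs]
  refine norm_integral_le_of_norm_le (hg.abs.const_mul C) ?_
  filter_upwards [hC] with x hx
  rw [norm_mul]
  exact mul_le_mul_of_nonneg_right hx (norm_nonneg _)

theorem ae_bound_of_memLp_top {α E : Type*} [MeasurableSpace α] [NormedAddCommGroup E]
    {μ : Measure α} {f : α → E} (hf : MemLp f ⊤ μ) : ∃ C ≥ 0, ∀ᵐ z ∂μ, ‖f z‖ ≤ C := by
  refine ⟨(eLpNorm f ⊤ μ).toReal, ENNReal.toReal_nonneg, ?_⟩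
  filter_upwards [ae_le_eLpNormEssSup (f := f) (μ := μ)] with z hz
  have := ENNReal.toReal_mono hf.2.ne hz
  simpa using this

namespace Data

variable {𝒟 : Data d k}

theorem coe_le_Φstar (t : ℝ) (q z : Vec k) :
    ((inner ℝ q z - 𝒟.Φ t z : ℝ) : EReal) ≤ 𝒟.Φstar t q :=
  le_iSup (fun z : Vec k => ((inner ℝ q z - 𝒟.Φ t z : ℝ) : EReal)) z

theorem Assumptions.Φstar_nonneg (h : 𝒟.Assumptions) {t : ℝ} (ht : t ∈ Icc 0 𝒟.T) (q : Vec k) :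
    0 ≤ 𝒟.Φstar t q := by
  have := 𝒟.coe_le_Φstar t q 0
  simpa [h.Φ_zero t ht] using this

theorem Assumptions.Φstar_Ψ (h : 𝒟.Assumptions) {t : ℝ} (ht : t ∈ Icc 0 𝒟.T) (z : Vec k) :
    𝒟.Φstar t (𝒟.Ψ t z) = ((inner ℝ (𝒟.Ψ t z) z - 𝒟.Φ t z : ℝ) : EReal) := by
  refine le_antisymm (iSup_le fun w => EReal.coe_le_coe_iff.2 ?_) (coe_le_Φstar t _ z)
  have := le_of_convexOn_of_hasGradientAt (h.Φ_convex t ht) (h.Φ_grad t ht z) w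
  rw [inner_sub_right] at this
  linarith

/-- Equality in Fenchel-Young makes z a minimiser of Φ − ⟨q, ·⟩, so the gradient there is q.
Uniqueness of the price rests on this. -/
theorem Assumptions.eq_Ψ_of_Φstar_le (h : 𝒟.Assumptions) {t : ℝ} (ht : t ∈ Icc 0 𝒟.T)
    {q z : Vec k} (hq : 𝒟.Φstar t q ≤ ((inner ℝ q z - 𝒟.Φ t z : ℝ) : EReal)) : q = 𝒟.Ψ t z := by
  have hmin : IsLocalMin (fun w => 𝒟.Φ t w - inner ℝ q w) z := .of_forall fun w => by
    have := EReal.coe_le_coe_iff.1 ((coe_le_Φstar t q w).trans hq)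
    linarith
  have hd : HasFDerivAt (fun w => 𝒟.Φ t w - inner ℝ q w)
      ((InnerProductSpace.toDual ℝ _) (𝒟.Ψ t z) - innerSL ℝ q) z :=
    (h.Φ_grad t ht z).hasFDerivAt.sub (innerSL ℝ q).hasFDerivAt
  have h0 := hmin.hasFDerivAt_eq_zero hd
  refine ext_inner_right ℝ fun w => ?_
  have := congrArg (fun L : Vec k →L[ℝ] ℝ => L w) h0
  simp only [_root_.sub_apply, InnerProductSpace.toDual_apply_apply,
    innerSL_apply_apply, _root_.zero_apply] at this
  linarith

/-- The potential of the price is continuous in time. -/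
theorem Assumptions.continuousOn_Φ (h : 𝒟.Assumptions) (z : Vec k) :
    ContinuousOn (fun t => 𝒟.Φ t z) (Icc 0 𝒟.T) := by
  obtain ⟨α, hα, -, -, -, -, -, ⟨-, C, hC⟩, -⟩ := h.holder (‖z‖ + 1) (by positivity)
  have key : ∀ t ∈ Icc 0 𝒟.T, ∀ s ∈ Icc 0 𝒟.T,
      ‖𝒟.Φ s z - 𝒟.Φ t z‖ ≤ C * |s - t| ^ (α : ℝ) * ‖z‖ := fun t ht s hs => by
    -- Φ(s,·) − Φ(t,·) vanishes at 0 and its gradient is controlled by the Hölder modulus of Ψ in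
    -- time; the mean value inequality concludes.
    have h1 := (convex_closedBall (0 : Vec k) (‖z‖ + 1)).norm_image_sub_le_of_norm_hasFDerivWithin_le
      (f := fun w => 𝒟.Φ s w - 𝒟.Φ t w) (C := C * |s - t| ^ (α : ℝ)) (x := 0) (y := z)
      (fun w _ => ((h.Φ_grad s hs w).hasFDerivAt.sub (h.Φ_grad t ht w).hasFDerivAt).hasFDerivWithinAt)
      (fun w hw => by
        rw [← map_sub, LinearIsometryEquiv.norm_map, ← dist_eq_norm]
        refine (hC.dist_le (x := (s, w)) (y := (t, w)) ⟨hs, hw⟩ ⟨ht, hw⟩).trans_eq ?_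
        rw [Prod.dist_eq, dist_self, max_eq_left dist_nonneg, Real.dist_eq])
      (by simp; positivity) (by simp)
    simpa [h.Φ_zero s hs, h.Φ_zero t ht] using h1
  intro t ht
  rw [ContinuousWithinAt, tendsto_iff_norm_sub_tendsto_zero]
  have h2 : Tendsto (fun s : ℝ => C * |s - t| ^ (α : ℝ) * ‖z‖) (𝓝[Icc 0 𝒟.T] t) (𝓝 0) := by
    have : Continuous fun s : ℝ => C * |s - t| ^ (α : ℝ) * ‖z‖ := by
      have : Continuous fun s : ℝ => |s - t| ^ (α : ℝ) :=
        (by fun_prop : Continuous fun s : ℝ => |s - t|).rpow_const fun _ => .inr α.2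
      fun_prop
    have h3 := (this.tendsto t).mono_left (nhdsWithin_le_nhds (s := Icc 0 𝒟.T))
    simpa [Real.zero_rpow (NNReal.coe_pos.2 hα).ne'] using h3
  refine squeeze_zero' (.of_forall fun s => norm_nonneg _) ?_ h2
  filter_upwards [self_mem_nhdsWithin] with s hs using key t ht s hs

theorem Assumptions.continuous_Φ_right (h : 𝒟.Assumptions) {t : ℝ} (ht : t ∈ Icc 0 𝒟.T) :
    Continuous (𝒟.Φ t) :=
  continuous_iff_continuousAt.2 fun z => (h.Φ_grad t ht z).hasFDerivAt.continuousAt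

theorem Assumptions.aemeasurable_Φstar (h : 𝒟.Assumptions) {P : ℝ → Vec k}
    (hP : AEStronglyMeasurable P (volume.restrict (Icc 0 𝒟.T))) :
    AEMeasurable (fun t => 𝒟.Φstar t (P t)) (volume.restrict (Icc 0 𝒟.T)) := by
  obtain ⟨S, hSc, hS⟩ := TopologicalSpace.exists_countable_dense (Vec k)
  have : Countable S := hSc.to_subtype
  have h1 : AEMeasurable (fun t => ⨆ z : S, ((inner ℝ (P t) (z : Vec k) - 𝒟.Φ t z : ℝ) : EReal))
      (volume.restrict (Icc 0 𝒟.T)) := by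
    refine AEMeasurable.iSup fun v => ?_
    have := (hP.inner (aestronglyMeasurable_const (b := (v : Vec k)))).sub
      ((h.continuousOn_Φ v).aestronglyMeasurable measurableSet_Icc)
    exact measurable_coe_real_ereal.comp_aemeasurable this.aemeasurable
  refine h1.congr ?_
  filter_upwards [ae_restrict_mem measurableSet_Icc] with t ht
  have hc : Continuous fun z => ((inner ℝ (P t) z - 𝒟.Φ t z : ℝ) : EReal) := by
    have := h.continuous_Φ_right ht
    exact continuous_coe_real_ereal.comp (by fun_prop)
  exact hS.ciSup' hc

/-! ### The conjugate of the congestion potential -/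

theorem Assumptions.continuous_f (h : 𝒟.Assumptions) {t : ℝ} (ht : t ∈ Icc 0 𝒟.T)
    {m : Torus d → ℝ} (hm : IsDensity m) : Continuous fun y : Vec d => 𝒟.f (proj y) t m := by
  obtain ⟨α, hα, -, C, hC, hf⟩ := h.f_holder
  refine (LipschitzWith.of_dist_le_mul (K := C.toNNReal) fun x y => ?_).continuous
  have := hf y x t ht t ht m m hm hm
  rw [Real.dist_eq, Real.coe_toNNReal _ hC.le, dist_eq_norm]
  simpa [Real.zero_rpow hα.ne'] using this

theorem Assumptions.aestronglyMeasurable_f (h : 𝒟.Assumptions) {t : ℝ} (ht : t ∈ Icc 0 𝒟.T)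
    {m : Torus d → ℝ} (hm : IsDensity m) : AEStronglyMeasurable (fun x => 𝒟.f x t m) volume := by
  have := ((h.continuous_f ht hm).stronglyMeasurable.comp_measurable measurable_sec)
  simpa only [Function.comp_def, proj_sec] using this.aestronglyMeasurable

/-- The potential is Lipschitz continuous for the `L¹` distance. -/
theorem IsPotential.ae_lipschitz {F : ℝ → (Torus d → ℝ) → ℝ} (h : 𝒟.Assumptions)
    (hF : 𝒟.IsPotential F) : ∃ C ≥ 0, ∀ᵐ t ∂(volume.restrict (Icc 0 𝒟.T)),
      ∀ m₁ m₂, IsDensity m₁ → IsDensity m₂ → |F t m₂ - F t m₁| ≤ C * ∫ x, |m₂ x - m₁ x| := by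
  obtain ⟨C, hC0, hC⟩ := h.f_bounded
  refine ⟨C, hC0.le, ?_⟩
  filter_upwards [hF.subgrad, ae_restrict_mem measurableSet_Icc] with t ht htT m₁ m₂ h1 h2
  -- The subgradient inequality is used in both directions, with f bounded uniformly.
  have e1 := ht m₁ m₂ h1 h2
  have e2 := ht m₂ m₁ h2 h1
  have e3 := abs_integral_mul_le (f := fun x => 𝒟.f x t m₁) (.of_forall fun x => hC x t htT m₁ h1)
    (h2.integrable.sub h1.integrable)
  have e4 := abs_integral_mul_le (f := fun x => 𝒟.f x t m₂) (.of_forall fun x => hC x t htT m₂ h2)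
    (h1.integrable.sub h2.integrable)
  simp only [Pi.sub_apply] at e3 e4
  simp_rw [abs_sub_comm (m₁ _) (m₂ _)] at e4
  rw [abs_le] at e3 e4 ⊢
  constructor <;> linarith [e3.1, e3.2, e4.1, e4.2]

/-- Separability of L¹ reduces the supremum in F* to a countable one, which makes it measurable in
time. -/
theorem exists_dense_densities (hne : ∃ m : Torus d → ℝ, IsDensity m) :
    ∃ e : ℕ → Torus d → ℝ, (∀ j, IsDensity (e j)) ∧
      ∀ m, IsDensity m → ∀ ε > 0, ∃ j, ∫ x, |e j x - m x| < ε := by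
  let S : Set (Lp ℝ 1 (volume : Measure (Torus d))) := {f | IsDensity (f : Torus d → ℝ)}
  have hcongr : ∀ {m m' : Torus d → ℝ}, m =ᵐ[volume] m' → IsDensity m → IsDensity m' :=
    fun {m m'} he hm => ⟨hm.1.ae_eq he, by
      filter_upwards [he, hm.2.1] with x h1 h2; rwa [← h1], by rw [← integral_congr_ae he, hm.2.2]⟩
  have hS : ∀ {m : Torus d → ℝ} (hm : IsDensity m),
      (memLp_one_iff_integrable.2 hm.integrable).toLp m ∈ S :=
    fun {m} hm => hcongr (MemLp.coeFn_toLp _).symm hm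
  have : Fact ((1 : ℝ≥0∞) ≠ ⊤) := ⟨by simp⟩
  have hSne : Nonempty S := by
    obtain ⟨m, hm⟩ := hne
    exact ⟨⟨_, hS hm⟩⟩
  obtain ⟨e, he⟩ := TopologicalSpace.exists_dense_seq S
  refine ⟨fun j => (e j : Lp ℝ 1 (volume : Measure (Torus d))), fun j => (e j).2, fun m hm ε hε => ?_⟩
  obtain ⟨j, hj⟩ := Metric.denseRange_iff.1 he ⟨_, hS hm⟩ ε hε
  refine ⟨j, ?_⟩
  rw [dist_comm, Subtype.dist_eq, dist_eq_norm, L1.norm_eq_integral_norm] at hj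
  refine lt_of_le_of_lt (le_of_eq (integral_congr_ae ?_)) hj
  filter_upwards [Lp.coeFn_sub (e j : Lp ℝ 1 (volume : Measure (Torus d)))
    ((memLp_one_iff_integrable.2 hm.integrable).toLp m),
    MemLp.coeFn_toLp (memLp_one_iff_integrable.2 hm.integrable)] with x h1 h2
  rw [h1, Pi.sub_apply, h2, Real.norm_eq_abs]

/-- F* is a supremum of real numbers, which defaults to 0 when unbounded, so Fenchel's inequality
requires an upper bound. -/
theorem le_Fstar_of_bddAbove {F : ℝ → (Torus d → ℝ) → ℝ} {t : ℝ} {γ : Torus d → ℝ} {B : ℝ}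
    (hB : ∀ m, IsDensity m → (∫ x, γ x * m x) - F t m ≤ B) {m : Torus d → ℝ} (hm : IsDensity m) :
    (∫ x, γ x * m x) - F t m ≤ Fstar F t γ :=
  le_ciSup (f := fun m : {m : Torus d → ℝ // IsDensity m} => (∫ x, γ x * m.1 x) - F t m.1)
    ⟨B, by rintro _ ⟨m, rfl⟩; exact hB m.1 m.2⟩ ⟨m, hm⟩

/-- The conjugate of the congestion potential is integrable in time and satisfies the
Fenchel inequality. -/
theorem IsPotential.Fstar_integrable {F : ℝ → (Torus d → ℝ) → ℝ} (h : 𝒟.Assumptions)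
    (hF : 𝒟.IsPotential F) {γ : Torus d × ℝ → ℝ} (hγ : MemLp γ ⊤ (cylMeasure d 𝒟.T)) :
    Integrable (fun t => Fstar F t fun x => γ (x, t)) (volume.restrict (Icc 0 𝒟.T)) ∧
    ∀ᵐ t ∂(volume.restrict (Icc 0 𝒟.T)), ∀ m, IsDensity m →
      (∫ x, γ (x, t) * m x) - F t m ≤ Fstar F t fun x => γ (x, t) := by
  obtain ⟨C, hC0, hC⟩ := hF.ae_lipschitz h
  obtain ⟨e, he, hed⟩ := exists_dense_densities ⟨_, h.m₀_density⟩
  obtain ⟨G, hG0, hG⟩ := ae_bound_of_memLp_top hγ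
  -- The bound is G from γ, plus 2C because F is C-Lipschitz in L¹, F(t,m₀) = 0 and two densities
  -- are at L¹ distance at most 2.
  have key : ∀ᵐ t ∂(volume.restrict (Icc 0 𝒟.T)),
      (∀ m, IsDensity m → |(∫ x, γ (x, t) * m x) - F t m| ≤ G + 2 * C) ∧
      ∀ m m', IsDensity m → IsDensity m' →
        ((∫ x, γ (x, t) * m x) - F t m) - ((∫ x, γ (x, t) * m' x) - F t m') ≤
          (G + C) * ∫ x, |m' x - m x| := by
    filter_upwards [hC, hF.normalised, ae_swap_of_ae_prod hG, hγ.1.prod_swap.prodMk_left]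
      with t h1 h2 h3 h4
    refine ⟨fun m hm => ?_, fun m m' hm hm' => ?_⟩
    · have e1 := abs_integral_mul_le h3 hm.integrable
      have e2 := h1 𝒟.m₀ m h.m₀_density hm
      have e3 : ∫ x, |m x - 𝒟.m₀ x| ≤ 2 := by
        calc ∫ x, |m x - 𝒟.m₀ x| ≤ ∫ x, (|m x| + |𝒟.m₀ x|) :=
              integral_mono (hm.integrable.sub h.m₀_density.integrable).abs
                (hm.integrable.abs.add h.m₀_density.integrable.abs) fun x => abs_sub _ _
          _ = 2 := by
            rw [integral_add hm.integrable.abs h.m₀_density.integrable.abs, hm.integral_abs,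
              h.m₀_density.integral_abs]; norm_num
      rw [hm.integral_abs] at e1
      rw [h2, sub_zero] at e2
      have e4 := mul_le_mul_of_nonneg_left e3 hC0
      refine (abs_sub _ _).trans ?_
      linarith
    · have i1 : ∀ {m}, IsDensity m → Integrable fun x => γ (x, t) * m x := fun {m} hm =>
        hm.integrable.bdd_mul (c := G) h4 h3
      have e1 := abs_integral_mul_le h3 (hm'.integrable.sub hm.integrable)
      have e2 := h1 m m' hm hm'
      have e3 : ∫ x, γ (x, t) * (m' - m) x = (∫ x, γ (x, t) * m' x) - ∫ x, γ (x, t) * m x := by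
        rw [← integral_sub (i1 hm') (i1 hm)]
        exact integral_congr_ae (.of_forall fun x => by simp only [Pi.sub_apply]; ring)
      rw [e3] at e1
      simp only [Pi.sub_apply] at e1
      rw [add_mul]
      linarith [(abs_le.1 e1).1, (abs_le.1 e2).2]
  have hle : ∀ᵐ t ∂(volume.restrict (Icc 0 𝒟.T)), ∀ m, IsDensity m →
      (∫ x, γ (x, t) * m x) - F t m ≤ Fstar F t fun x => γ (x, t) := by
    filter_upwards [key] with t ht m hm
    exact le_Fstar_of_bddAbove (B := G + 2 * C) (fun m hm => (abs_le.1 (ht.1 m hm)).2) hm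
  have : Nonempty {m : Torus d → ℝ // IsDensity m} := ⟨⟨_, h.m₀_density⟩⟩
  refine ⟨?_, hle⟩
  have hmeas : AEMeasurable (fun t => ⨆ j, ((∫ x, γ (x, t) * e j x) - F t (e j)))
      (volume.restrict (Icc 0 𝒟.T)) := by
    refine AEMeasurable.iSup fun j => ?_
    have h1 : AEStronglyMeasurable (fun z : Torus d × ℝ => γ z * e j z.1) (cylMeasure d 𝒟.T) :=
      hγ.1.mul (he j).integrable.aestronglyMeasurable.comp_fst
    exact h1.prod_swap.integral_prod_right'.aemeasurable.sub (hF.meas _ (he j))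
  have heq : (fun t => ⨆ j, ((∫ x, γ (x, t) * e j x) - F t (e j)))
      =ᵐ[volume.restrict (Icc 0 𝒟.T)] fun t => Fstar F t fun x => γ (x, t) := by
    filter_upwards [key, hle] with t ht ht'
    have hb : BddAbove (range fun j => (∫ x, γ (x, t) * e j x) - F t (e j)) :=
      ⟨G + 2 * C, by rintro _ ⟨j, rfl⟩; exact (abs_le.1 (ht.1 _ (he j))).2⟩
    refine le_antisymm (ciSup_le fun j => ht' _ (he j)) (ciSup_le fun m => ?_)
    refine le_of_forall_pos_le_add fun ε hε => ?_
    -- The added 1 keeps the denominator positive when G = C = 0.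
    obtain ⟨j, hj⟩ := hed m.1 m.2 (ε / (G + C + 1)) (by positivity)
    have h1 := ht.2 m.1 (e j) m.2 (he j)
    have h2 := le_ciSup hb j
    have h3 : (G + C) * ∫ x, |e j x - m.1 x| ≤ ε := by
      rw [lt_div_iff₀ (by positivity)] at hj
      have : 0 ≤ ∫ x, |e j x - m.1 x| := integral_nonneg fun x => abs_nonneg _
      linarith
    linarith
  refine Integrable.of_bound (hmeas.congr heq).aestronglyMeasurable (G + 2 * C) ?_
  filter_upwards [key, hle] with t ht ht'
  refine abs_le.2 ⟨?_, ciSup_le fun m => (abs_le.1 (ht.1 _ m.2)).2⟩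
  exact (abs_le.1 (ht.1 _ h.m₀_density)).1.trans (ht' _ h.m₀_density)

/-- Monotonicity says that f(·,t,m) is a subgradient of F(t,·) at m; this is the reverse Fenchel
inequality, needed at the equilibrium. -/
theorem IsPotential.Fstar_coupling {F : ℝ → (Torus d → ℝ) → ℝ} (h : 𝒟.Assumptions)
    (hF : 𝒟.IsPotential F) : ∀ᵐ t ∂(volume.restrict (Icc 0 𝒟.T)), ∀ m, IsDensity m →
      Fstar F t (fun x => 𝒟.f x t m) ≤ (∫ x, 𝒟.f x t m * m x) - F t m := by
  obtain ⟨C, hC0, hC⟩ := h.f_bounded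
  have : Nonempty {m : Torus d → ℝ // IsDensity m} := ⟨⟨_, h.m₀_density⟩⟩
  filter_upwards [hF.subgrad, ae_restrict_mem measurableSet_Icc] with t ht htT m hm
  refine ciSup_le fun m' => ?_
  have i1 : ∀ {m'}, IsDensity m' → Integrable fun x => 𝒟.f x t m * m' x := fun {m'} hm' =>
    hm'.integrable.bdd_mul (c := C) (h.aestronglyMeasurable_f htT hm)
      (.of_forall fun x => hC x t htT m hm)
  have e1 := ht m m'.1 hm m'.2
  simp only [mul_sub] at e1
  rw [integral_sub (i1 m'.2) (i1 hm)] at e1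
  linarith

end Data

end MFGC

/-! ### Weak duality between the equilibrium and admissible triples -/

namespace MFGC

variable {d k : ℕ} {p : ℝ}

theorem terminalValue_nonneg {T : ℝ} {u w : Torus d × ℝ → ℝ} {a : Torus d → ℝ} (hT : 0 < T)
    (h : HasTrace T u w a) (h0 : ∀ᵐ z ∂(cylMeasure d T), 0 ≤ u z) :
    ∀ᵐ x, 0 ≤ a x + ∫ s in 0..T, w (x, s) := by
  filter_upwards [h.ae_eq, h.integrable_deriv.prod_right_ae, Measure.ae_ae_of_ae_prod h0]
    with x h1 h2 h3
  refine ge_of_tendsto (tendsto_terminal_average hT h2 h1) ?_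
  filter_upwards [Ioo_mem_nhdsGT hT] with r hr
  refine mul_nonneg (inv_nonneg.2 hr.1.le) ?_
  rw [intervalIntegral.integral_of_le (by linarith [hr.1])]
  refine integral_nonneg_of_ae (ae_mono (Measure.restrict_mono ?_ le_rfl) h3)
  exact Ioc_subset_Icc_self.trans (Icc_subset_Icc_left (by linarith [hr.2]))

namespace Data

variable {𝒟 : Data d k}

theorem Assumptions.aestronglyMeasurable_φT (h : 𝒟.Assumptions) {P : ℝ → Vec k}
    (hP : AEStronglyMeasurable P (volume.restrict (Icc 0 𝒟.T))) :
    AEStronglyMeasurable (fun z => 𝒟.φT z.1 z.2 (P z.2)) (cylMeasure d 𝒟.T) := by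
  have h1 := (ContinuousLinearMap.adjoint (𝕜 := ℝ) (E := Vec d) (F := Vec k)).continuous
    |>.comp_aestronglyMeasurable h.aestronglyMeasurable_φ
  have h2 : AEStronglyMeasurable (fun z : Torus d × ℝ => P z.2) (cylMeasure d 𝒟.T) := hP.comp_snd
  exact isBoundedBilinearMap_apply.continuous.comp_aestronglyMeasurable (h1.prodMk h2)

theorem _root_.MFGC.W21p.aestronglyMeasurable_grad {T : ℝ} (u : W21p d T p) :
    AEStronglyMeasurable u.grad (cylMeasure d T) := by
  rw [← restrict_cyl]; exact u.memLp_grad.1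

theorem Assumptions.aestronglyMeasurable_hjb (h : 𝒟.Assumptions) (u : W21p d 𝒟.T p)
    {P : ℝ → Vec k} (hP : AEStronglyMeasurable P (volume.restrict (Icc 0 𝒟.T))) :
    AEStronglyMeasurable (𝒟.hjb u P) (cylMeasure d 𝒟.T) :=
  (u.ut_memLp.1.neg.sub (u.lap_memLp.1.const_mul _)).add
    (h.aestronglyMeasurable_H (u.aestronglyMeasurable_grad.add (h.aestronglyMeasurable_φT hP)))

variable {u m : W21p d 𝒟.T p} {v : Torus d × ℝ → Vec d} {P : ℝ → Vec k}

/-- Sign and mass are inherited from m₀ through the Fokker-Planck equation; essential boundedness of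
a slice comes from Morrey's inequality. -/
theorem IsSolution.ae_isDensity (h : 𝒟.Assumptions) (hp3 : 3 ≤ p) (hpd : (d : ℝ) < p)
    (hsol : 𝒟.IsSolution u m v P) :
    ∀ᵐ t ∂(volume.restrict (Icc 0 𝒟.T)), IsDensity fun x => m.toFun (x, t) := by
  have hp1 : (1 : ℝ≥0∞) ≤ ENNReal.ofReal p := by simpa using (by linarith : (1 : ℝ) ≤ p)
  have hv : MemLp v ⊤ (cylMeasure d 𝒟.T) := by rw [← restrict_cyl]; exact hsol.memLp_v
  obtain ⟨V, -, hV⟩ := ae_bound_of_memLp_top hv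
  have hfp := (hsol.ae_slice (by linarith)).2
  have h0 := ae_nonneg_of_fokkerPlanck h.T_pos h.σ_pos hp3 hpd (b := fun i z => v z i)
    (fun i => (MemLp.vec_apply hv i).1)
    (fun i => hV.mono fun z hz => (PiLp.norm_apply_le (v z) i).trans hz) hfp (by
      filter_upwards [hsol.initial, h.m₀_density.2.1] with x h1 h2
      rwa [h1])
  have h1 := ae_integral_eq_of_fokkerPlanck (b := fun i z => v z i) h.T_pos (by linarith) hfp
  rw [integral_congr_ae hsol.initial, h.m₀_density.2.2] at h1
  filter_upwards [h0, h1, m.ae_isGoodSlice (by linarith)] with t h2 h3 h4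
  obtain ⟨C, hC⟩ := ae_bounded_slice hpd (by linarith) (h4.memLp_toFun.integrable hp1)
    h4.memLp_grad h4.deriv_toFun
  exact ⟨memLp_top_of_bound h4.memLp_toFun.1 C hC, h2, h3⟩

theorem IsSolution.ae_nonneg (h : 𝒟.Assumptions) (hp3 : 3 ≤ p) (hpd : (d : ℝ) < p)
    (hsol : 𝒟.IsSolution u m v P) : ∀ᵐ z ∂(cylMeasure d 𝒟.T), 0 ≤ m.toFun z := by
  have := ae_prod_eq_of_ae_ae_swap (f := fun z => |m.toFun z|) (g := m.toFun)
    (μ := (volume : Measure (Torus d))) (ν := volume.restrict (Icc 0 𝒟.T))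
    m.toFun_memLp.1.norm m.toFun_memLp.1 (by
      filter_upwards [hsol.ae_isDensity h hp3 hpd] with t ht
      filter_upwards [ht.2.1] with x hx using abs_of_nonneg hx)
  exact this.mono fun z hz => abs_eq_self.1 hz

/-- Joint measurability of f(x,t,m(t)) is read off from the Hamilton-Jacobi-Bellman equation, whose
left-hand side is measurable. -/
theorem IsSolution.memLp_coupling (h : 𝒟.Assumptions) (hp3 : 3 ≤ p) (hpd : (d : ℝ) < p)
    (hsol : 𝒟.IsSolution u m v P) : MemLp (𝒟.coupling m.toFun) ⊤ (cylMeasure d 𝒟.T) := by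
  obtain ⟨C, -, hC⟩ := h.f_bounded
  have heq := hsol.hjb_eq
  rw [restrict_cyl] at heq
  refine memLp_top_of_bound
    ((h.aestronglyMeasurable_hjb u hsol.memLp_P.1).congr heq) C ?_
  have h1 : ∀ᵐ z ∂(cylMeasure d 𝒟.T), IsDensity fun x => m.toFun (x, z.2) :=
    Measure.quasiMeasurePreserving_snd.ae (hsol.ae_isDensity h hp3 hpd)
  filter_upwards [h1, ae_snd_mem_Icc] with z hz hz'
  exact hC _ _ hz' _ hz

theorem IsSolution.dualFeasible (h : 𝒟.Assumptions) (hp3 : 3 ≤ p) (hpd : (d : ℝ) < p)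
    (hsol : 𝒟.IsSolution u m v P) : 𝒟.DualFeasible u P (𝒟.coupling m.toFun) where
  memLp_P := hsol.memLp_P
  memLp_γ := by rw [restrict_cyl]; exact hsol.memLp_coupling h hp3 hpd
  hjb_le := hsol.hjb_eq.mono fun z hz => hz.le
  terminal_le := hsol.terminal.mono fun x hx => hx.le

/-- The aggregate control `∫ φ v m dx`. -/
def aggregate (𝒟 : Data d k) (m : Torus d × ℝ → ℝ) (v : Torus d × ℝ → Vec d) (t : ℝ) : Vec k :=
  ∫ x, m (x, t) • 𝒟.φ x t (v (x, t))

theorem IsSolution.integrable_flux (h : 𝒟.Assumptions) (hp : 1 ≤ p)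
    (hsol : 𝒟.IsSolution u m v P) :
    Integrable (fun z => m.toFun z • 𝒟.φ z.1 z.2 (v z)) (cylMeasure d 𝒟.T) := by
  have hp1 : (1 : ℝ≥0∞) ≤ ENNReal.ofReal p := by simpa using hp
  have hv : MemLp v ⊤ (cylMeasure d 𝒟.T) := by rw [← restrict_cyl]; exact hsol.memLp_v
  obtain ⟨V, hV0, hV⟩ := ae_bound_of_memLp_top hv
  obtain ⟨C, hC0, hC⟩ := h.exists_norm_φ_le
  have h1 : AEStronglyMeasurable (fun z => 𝒟.φ z.1 z.2 (v z)) (cylMeasure d 𝒟.T) :=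
    isBoundedBilinearMap_apply.continuous.comp_aestronglyMeasurable
      (h.aestronglyMeasurable_φ.prodMk hv.1)
  refine ((m.toFun_memLp.integrable hp1).norm.mul_const (C * V)).mono' (m.toFun_memLp.1.smul h1) ?_
  filter_upwards [hV, ae_snd_mem_Icc] with z h2 h3
  rw [norm_smul]
  refine mul_le_mul_of_nonneg_left ?_ (norm_nonneg _)
  exact ((𝒟.φ z.1 z.2).le_opNorm _).trans (mul_le_mul (hC _ _ h3) h2 (norm_nonneg _) hC0)

theorem IsSolution.memLp_aggregate (h : 𝒟.Assumptions) (hp3 : 3 ≤ p) (hpd : (d : ℝ) < p)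
    (hsol : 𝒟.IsSolution u m v P) :
    MemLp (𝒟.aggregate m.toFun v) ⊤ (volume.restrict (Icc 0 𝒟.T)) := by
  have hv : MemLp v ⊤ (cylMeasure d 𝒟.T) := by rw [← restrict_cyl]; exact hsol.memLp_v
  obtain ⟨V, hV0, hV⟩ := ae_bound_of_memLp_top hv
  obtain ⟨C, hC0, hC⟩ := h.exists_norm_φ_le
  refine memLp_top_of_bound
    (hsol.integrable_flux h (by linarith)).integral_prod_right.aestronglyMeasurable (C * V) ?_
  filter_upwards [hsol.ae_isDensity h hp3 hpd, ae_swap_of_ae_prod hV,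
    ae_restrict_mem measurableSet_Icc] with t h1 h2 h3
  have h4 : ∫ x, |m.toFun (x, t)| * (C * V) = C * V := by
    rw [integral_mul_const, h1.integral_abs, one_mul]
  refine (norm_integral_le_of_norm_le (h1.integrable.abs.mul_const (C * V)) ?_).trans_eq h4
  filter_upwards [h2] with x h5
  rw [norm_smul]
  refine mul_le_mul_of_nonneg_left ?_ (norm_nonneg _)
  exact ((𝒟.φ x t).le_opNorm _).trans (mul_le_mul (hC _ _ h3) h5 (norm_nonneg _) hC0)

theorem inner_φT (x : Torus d) (t : ℝ) (w : Vec d) (Q : Vec k) :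
    inner ℝ w (𝒟.φT x t Q) = inner ℝ (𝒟.φ x t w) Q :=
  ContinuousLinearMap.adjoint_inner_right _ _ _

/-- The linearised duality estimate on a slice. -/
theorem slice_duality {uu ubar : W21p d 𝒟.T p} {γ f : Torus d × ℝ → ℝ} {Q Qbar : Vec k} {t : ℝ}
    (hp : 2 ≤ p) (hu : uu.IsGoodSlice t) (hub : ubar.IsGoodSlice t) (hm : m.IsGoodSlice t)
    (hmd : IsDensity fun x => m.toFun (x, t))
    (hmv : ∀ i, MemLp (fun x => m.toFun (x, t) * v (x, t) i) (ENNReal.ofReal p) volume)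
    (hfp : ∀ n : Fin d → ℤ, ch (fun x => m.ut (x, t) - 𝒟.σ * m.lap (x, t)) n =
        ∑ i, (2 * Real.pi * Complex.I * n i) * ch (fun x => m.toFun (x, t) * v (x, t) i) n)
    (hflux : Integrable fun x => m.toFun (x, t) • 𝒟.φ x t (v (x, t)))
    (hγ : Integrable fun x => (γ (x, t) - f (x, t)) * m.toFun (x, t))
    (hineq : ∀ᵐ x, -(uu.ut (x, t) - ubar.ut (x, t)) - 𝒟.σ * (uu.lap (x, t) - ubar.lap (x, t))
      - inner ℝ (v (x, t)) (uu.grad (x, t) - ubar.grad (x, t) + 𝒟.φT x t (Q - Qbar)) ≤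
        γ (x, t) - f (x, t)) :
    -∫ x, ((uu.ut (x, t) - ubar.ut (x, t)) * m.toFun (x, t) +
        (uu.toFun (x, t) - ubar.toFun (x, t)) * m.ut (x, t)) ≤
      (∫ x, (γ (x, t) - f (x, t)) * m.toFun (x, t)) +
        inner ℝ (𝒟.aggregate m.toFun v t) (Q - Qbar) := by
  have h2 := fun {f : Torus d → ℝ} => memLp_two_of_le (d := d) (f := f) hp
  have hp1 : (1 : ℝ≥0∞) ≤ ENNReal.ofReal p := by simpa using (by linarith : (1 : ℝ) ≤ p)
  let w : Torus d → ℝ := fun x => uu.toFun (x, t) - ubar.toFun (x, t)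
  let wt : Torus d → ℝ := fun x => uu.ut (x, t) - ubar.ut (x, t)
  let wi : Fin d → Torus d → ℝ := fun i x => uu.grad (x, t) i - ubar.grad (x, t) i
  let wl : Torus d → ℝ := fun x => uu.lap (x, t) - ubar.lap (x, t)
  have hw2 : MemLp w 2 volume := h2 (hu.memLp_toFun.sub hub.memLp_toFun)
  have hwt2 : MemLp wt 2 volume := h2 (hu.memLp_ut.sub hub.memLp_ut)
  have hwi2 : ∀ i, MemLp (wi i) 2 volume := fun i => h2 ((hu.memLp_grad i).sub (hub.memLp_grad i))
  have hul : MemLp (fun x => uu.lap (x, t)) 2 volume :=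
    memLp_finsetSum _ fun i _ => h2 (hu.memLp_hess i i)
  have hubl : MemLp (fun x => ubar.lap (x, t)) 2 volume :=
    memLp_finsetSum _ fun i _ => h2 (hub.memLp_hess i i)
  have hml : MemLp (fun x => m.lap (x, t)) 2 volume :=
    memLp_finsetSum _ fun i _ => h2 (hm.memLp_hess i i)
  have hm2 := h2 hm.memLp_toFun
  have hmt2 := h2 hm.memLp_ut
  have hmi2 := fun i => h2 (hm.memLp_grad i)
  have hmv2 := fun i => h2 (hmv i)
  have hwd : ∀ i, HasTorusDeriv i w (wi i) := fun i =>
    (hu.deriv_toFun i).sub (hub.deriv_toFun i) (hu.memLp_toFun.integrable hp1)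
      (hub.memLp_toFun.integrable hp1) ((hu.memLp_grad i).integrable hp1)
      ((hub.memLp_grad i).integrable hp1)
  -- The Fokker-Planck equation tested against w = u − ū: this is what cancels the drift term in
  -- `key`.
  have e1 := integral_mul_eq_sum_of_ch_eq hfp hwd (hmt2.sub (hml.const_mul _)) hmv2 hw2 hwi2
  have e2 := hm.integral_lap_mul hp hwd hw2 hwi2
  have e3 := hu.integral_lap_mul hp hm.deriv_toFun hm2 hmi2
  have e4 := hub.integral_lap_mul hp hm.deriv_toFun hm2 hmi2
  have i1 : Integrable fun x => wt x * m.toFun (x, t) := integrable_mul_of_memLp_two hwt2 hm2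
  have i2 : Integrable fun x => w x * m.ut (x, t) := integrable_mul_of_memLp_two hw2 hmt2
  have i3 : Integrable fun x => wl x * m.toFun (x, t) :=
    integrable_mul_of_memLp_two (hul.sub hubl) hm2
  have i4 : ∀ i, Integrable fun x => m.toFun (x, t) * v (x, t) i * wi i x := fun i =>
    integrable_mul_of_memLp_two (hmv2 i) (hwi2 i)
  have i5 : Integrable fun x => inner ℝ (m.toFun (x, t) • 𝒟.φ x t (v (x, t))) (Q - Qbar) :=
    hflux.inner_const _
  have i6 : Integrable fun x => m.lap (x, t) * w x := integrable_mul_of_memLp_two hml hw2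
  have e5 : ∫ x, (m.ut (x, t) - 𝒟.σ * m.lap (x, t)) * w x =
      (∫ x, w x * m.ut (x, t)) - 𝒟.σ * ∫ x, m.lap (x, t) * w x := by
    rw [← integral_const_mul, ← integral_sub i2 (i6.const_mul _)]
    exact integral_congr_ae (.of_forall fun x => by ring)
  -- Symmetry of the Laplacian, through ∫ ∇w·∇m.
  have e6 : ∫ x, wl x * m.toFun (x, t) = ∫ x, m.lap (x, t) * w x := by
    have : ∫ x, wl x * m.toFun (x, t) = (∫ x, uu.lap (x, t) * m.toFun (x, t)) -
        ∫ x, ubar.lap (x, t) * m.toFun (x, t) := by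
      rw [← integral_sub (integrable_mul_of_memLp_two hul hm2)
        (integrable_mul_of_memLp_two hubl hm2)]
      exact integral_congr_ae (.of_forall fun x => by simp only [wl]; ring)
    rw [this, e3, e4, e2, neg_sub_neg, ← Finset.sum_sub_distrib, ← Finset.sum_neg_distrib]
    refine Finset.sum_congr rfl fun i _ => ?_
    rw [← integral_sub (integrable_mul_of_memLp_two (h2 (hub.memLp_grad i)) (hmi2 i))
      (integrable_mul_of_memLp_two (h2 (hu.memLp_grad i)) (hmi2 i)), ← integral_neg]
    exact integral_congr_ae (.of_forall fun x => by simp only [wi]; ring)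
  have e7 : inner ℝ (𝒟.aggregate m.toFun v t) (Q - Qbar) =
      ∫ x, inner ℝ (m.toFun (x, t) • 𝒟.φ x t (v (x, t))) (Q - Qbar) := by
    rw [real_inner_comm, aggregate, ← integral_inner hflux]
    exact integral_congr_ae (.of_forall fun x => real_inner_comm _ _)
  have e8 : ∫ x, ((uu.ut (x, t) - ubar.ut (x, t)) * m.toFun (x, t) +
        (uu.toFun (x, t) - ubar.toFun (x, t)) * m.ut (x, t)) =
      (∫ x, wt x * m.toFun (x, t)) + ∫ x, w x * m.ut (x, t) := integral_add i1 i2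
  have key : ∫ x, (-(wt x * m.toFun (x, t)) - 𝒟.σ * (wl x * m.toFun (x, t))
      - ∑ i, m.toFun (x, t) * v (x, t) i * wi i x) ≤
      ∫ x, ((γ (x, t) - f (x, t)) * m.toFun (x, t)
        + inner ℝ (m.toFun (x, t) • 𝒟.φ x t (v (x, t))) (Q - Qbar)) := by
    refine integral_mono_ae ((i1.neg.sub (i3.const_mul _)).sub
      (integrable_finsetSum _ fun i _ => i4 i)) (hγ.add i5) ?_
    filter_upwards [hineq, hmd.2.1] with x hx hx0
    -- Here nonnegativity of m is used; the adjoint of φ then turns the price term into an inner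
    -- product with the aggregate control.
    have := mul_le_mul_of_nonneg_right hx hx0
    rw [inner_add_right, inner_φT] at this
    have hi : inner ℝ (v (x, t)) (uu.grad (x, t) - ubar.grad (x, t)) =
        ∑ i, v (x, t) i * wi i x := by
      simp only [PiLp.inner_apply, PiLp.sub_apply, RCLike.inner_apply, conj_trivial, wi]
      exact Finset.sum_congr rfl fun i _ => mul_comm _ _
    have hs : ∑ i, m.toFun (x, t) * v (x, t) i * wi i x =
        m.toFun (x, t) * ∑ i, v (x, t) i * wi i x := by
      rw [Finset.mul_sum]; exact Finset.sum_congr rfl fun i _ => by ring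
    rw [hi] at this
    rw [hs, inner_smul_left]
    simp only [conj_trivial, wt, wl]
    linarith
  have i7 : Integrable fun x => -(wt x * m.toFun (x, t)) := i1.neg
  have i8 : Integrable fun x => -(wt x * m.toFun (x, t)) - 𝒟.σ * (wl x * m.toFun (x, t)) :=
    i7.sub (i3.const_mul _)
  rw [integral_sub i8 (integrable_finsetSum _ fun i _ => i4 i), integral_sub i7 (i3.const_mul _),
    integral_neg, integral_const_mul, integral_finsetSum _ fun i _ => i4 i, integral_add hγ i5,
    ← e7, ← e1, e5, e6] at key
  rw [e8]
  linarith

end Data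

end MFGC

namespace MFGC

variable {d k : ℕ} {p : ℝ}

namespace Data

variable {𝒟 : Data d k} {ubar m u : W21p d 𝒟.T p} {v : Torus d × ℝ → Vec d} {Pbar P : ℝ → Vec k}
  {γ : Torus d × ℝ → ℝ}

theorem IsSolution.integrable_coupling_gap (h : 𝒟.Assumptions) (hp3 : 3 ≤ p) (hpd : (d : ℝ) < p)
    (hsol : 𝒟.IsSolution ubar m v Pbar) (hγ : MemLp γ ⊤ (cylMeasure d 𝒟.T)) :
    Integrable (fun z => (γ z - 𝒟.coupling m.toFun z) * m.toFun z) (cylMeasure d 𝒟.T) := by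
  have hp1 : (1 : ℝ≥0∞) ≤ ENNReal.ofReal p := by simpa using (by linarith : (1 : ℝ) ≤ p)
  have h1 := hγ.sub (hsol.memLp_coupling h hp3 hpd)
  obtain ⟨C, -, hC⟩ := ae_bound_of_memLp_top h1
  exact (m.toFun_memLp.integrable hp1).bdd_mul (c := C) h1.1 hC

theorem IsSolution.integrable_price_gap (h : 𝒟.Assumptions) (hp3 : 3 ≤ p) (hpd : (d : ℝ) < p)
    (hsol : 𝒟.IsSolution ubar m v Pbar) (hP : MemLp P ⊤ (volume.restrict (Icc 0 𝒟.T))) :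
    Integrable (fun t => inner ℝ (𝒟.aggregate m.toFun v t) (P t - Pbar t))
      (volume.restrict (Icc 0 𝒟.T)) := by
  have hA := hsol.memLp_aggregate h hp3 hpd
  have h1 := hP.sub hsol.memLp_P
  obtain ⟨C, hC0, hC⟩ := ae_bound_of_memLp_top hA
  obtain ⟨B, -, hB⟩ := ae_bound_of_memLp_top h1
  refine Integrable.of_bound (hA.1.inner h1.1) (C * B) ?_
  filter_upwards [hC, hB] with t h2 h3
  exact (norm_inner_le_norm _ _).trans (mul_le_mul h2 h3 (norm_nonneg _) hC0)

/-- The linearised duality estimate. -/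
theorem IsSolution.duality_le (h : 𝒟.Assumptions) (hp3 : 3 ≤ p) (hpd : (d : ℝ) < p)
    (hsol : 𝒟.IsSolution ubar m v Pbar) (hfeas : 𝒟.DualFeasible u P γ) :
    (∫ x, initialValue u.toFun x * 𝒟.m₀ x) - (∫ x, initialValue ubar.toFun x * 𝒟.m₀ x) ≤
      ∫ t in Icc 0 𝒟.T, ((∫ x, (γ (x, t) - 𝒟.coupling m.toFun (x, t)) * m.toFun (x, t)) +
        inner ℝ (𝒟.aggregate m.toFun v t) (P t - Pbar t)) := by
  have hp1r : 1 ≤ p := by linarith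
  have hp1 : (1 : ℝ≥0∞) ≤ ENNReal.ofReal p := by simpa using hp1r
  have hT := h.T_pos
  have hγ : MemLp γ ⊤ (cylMeasure d 𝒟.T) := by rw [← restrict_cyl]; exact hfeas.memLp_γ
  have i1 := hsol.integrable_coupling_gap h hp3 hpd hγ
  have i2 := hsol.integrable_price_gap h hp3 hpd hfeas.memLp_P
  obtain ⟨tu, teu⟩ := u.hasTrace hp1r hT
  obtain ⟨tb, teb⟩ := ubar.hasTrace hp1r hT
  obtain ⟨tm, -⟩ := m.hasTrace hp1r hT
  have hL2 : ∀ {f : Torus d × ℝ → ℝ}, MemLp f (ENNReal.ofReal p) (cylMeasure d 𝒟.T) →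
      MemLp f 2 (cylMeasure d 𝒟.T) := fun {f} hf => hf.mono_exponent (by
    rw [show (2 : ℝ≥0∞) = ENNReal.ofReal 2 by simp]
    exact ENNReal.ofReal_le_ofReal (by linarith))
  obtain ⟨B, -, hB⟩ := ae_bound_of_memLp_top h.m₀_density.1
  have i0 : ∀ {a : Torus d → ℝ}, Integrable a → Integrable fun x => a x * 𝒟.m₀ x := fun {a} ha =>
    ha.mul_bdd (c := B) h.m₀_density.1.1 hB
  have j0 : ∀ {a : Torus d → ℝ}, (fun x => a x * 𝒟.m₀ x) =ᵐ[volume]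
      fun x => a x * initialValue m.toFun x := fun {a} => by
    filter_upwards [hsol.initial] with x hx
    rw [hx]
  have i3 : Integrable (fun z => (u.ut z - ubar.ut z) * m.toFun z +
      (u.toFun z - ubar.toFun z) * m.ut z) (cylMeasure d 𝒟.T) :=
    (integrable_mul_of_memLp_two ((hL2 u.ut_memLp).sub (hL2 ubar.ut_memLp)) (hL2 m.toFun_memLp)).add
      (integrable_mul_of_memLp_two ((hL2 u.toFun_memLp).sub (hL2 ubar.toFun_memLp))
        (hL2 m.ut_memLp))
  have hIBP := (tu.sub tb).integral_mul_eq hT tm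
    ((i0 (tu.integrable_initial.sub tb.integrable_initial)).congr j0) i3
  -- At time T, u ≤ g = ū and m̄ ≥ 0.
  have hterm : ∫ x, ((initialValue u.toFun x - initialValue ubar.toFun x) +
      ∫ s in 0..𝒟.T, (u.ut (x, s) - ubar.ut (x, s))) *
      (initialValue m.toFun x + ∫ s in 0..𝒟.T, m.ut (x, s)) ≤ 0 := by
    refine integral_nonpos_of_ae ?_
    filter_upwards [teu, teb, hfeas.terminal_le, hsol.terminal,
      terminalValue_nonneg hT tm (hsol.ae_nonneg h hp3 hpd),
      tu.integrable_deriv.prod_right_ae, tb.integrable_deriv.prod_right_ae]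
      with x h1 h2 h3 h4 h5 h6 h7
    have hTT : 𝒟.T ∈ Icc 0 𝒟.T := ⟨hT.le, le_rfl⟩
    refine mul_nonpos_of_nonpos_of_nonneg ?_ h5
    rw [intervalIntegral.integral_sub (intervalIntegrable_of_integrableOn_Icc h6 hTT)
      (intervalIntegrable_of_integrableOn_Icc h7 hTT)]
    linarith
  rw [hIBP] at hterm
  have e1 : ∫ x, (initialValue u.toFun x - initialValue ubar.toFun x) * initialValue m.toFun x =
      (∫ x, initialValue u.toFun x * 𝒟.m₀ x) - ∫ x, initialValue ubar.toFun x * 𝒟.m₀ x := by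
    rw [← integral_sub (i0 tu.integrable_initial) (i0 tb.integrable_initial)]
    refine integral_congr_ae ?_
    filter_upwards [hsol.initial] with x hx
    rw [hx]; ring
  have e2 : ∫ z, ((u.ut z - ubar.ut z) * m.toFun z + (u.toFun z - ubar.toFun z) * m.ut z)
      ∂(cylMeasure d 𝒟.T) = ∫ t in Icc 0 𝒟.T, ∫ x, ((u.ut (x, t) - ubar.ut (x, t)) *
        m.toFun (x, t) + (u.toFun (x, t) - ubar.toFun (x, t)) * m.ut (x, t)) :=
    integral_prod_symm _ i3
  have hslice := hsol.ae_slice hp1r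
  -- Linearisation: convexity of H at the equilibrium, where its gradient is −v̄.
  have hineq : ∀ᵐ z ∂(cylMeasure d 𝒟.T), -(u.ut z - ubar.ut z) - 𝒟.σ * (u.lap z - ubar.lap z)
      - inner ℝ (v z) (u.grad z - ubar.grad z + 𝒟.φT z.1 z.2 (P z.2 - Pbar z.2)) ≤
        γ z - 𝒟.coupling m.toFun z := by
    have h1 := hfeas.hjb_le
    have h2 := hsol.hjb_eq
    have h3 := hsol.control
    rw [restrict_cyl] at h1 h2 h3
    filter_upwards [h1, h2, h3, ae_snd_mem_Icc] with z h1 h2 h3 h4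
    have h5 := h.hamiltonian_subgradient (x := z.1) h4 (ubar.grad z + 𝒟.φT z.1 z.2 (Pbar z.2))
      (u.grad z + 𝒟.φT z.1 z.2 (P z.2))
    have h6 : 𝒟.φT z.1 z.2 (P z.2 - Pbar z.2) =
        𝒟.φT z.1 z.2 (P z.2) - 𝒟.φT z.1 z.2 (Pbar z.2) := map_sub _ _ _
    have h7 : u.grad z - ubar.grad z + 𝒟.φT z.1 z.2 (P z.2 - Pbar z.2) =
        u.grad z + 𝒟.φT z.1 z.2 (P z.2) - (ubar.grad z + 𝒟.φT z.1 z.2 (Pbar z.2)) := by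
      rw [h6]; abel
    rw [h3, h7, inner_neg_left]
    simp only [hjb] at h1 h2
    linarith
  have hle : -∫ t in Icc 0 𝒟.T, ∫ x, ((u.ut (x, t) - ubar.ut (x, t)) *
        m.toFun (x, t) + (u.toFun (x, t) - ubar.toFun (x, t)) * m.ut (x, t)) ≤
      ∫ t in Icc 0 𝒟.T, ((∫ x, (γ (x, t) - 𝒟.coupling m.toFun (x, t)) * m.toFun (x, t)) +
        inner ℝ (𝒟.aggregate m.toFun v t) (P t - Pbar t)) := by
    rw [← integral_neg]
    refine integral_mono_ae i3.integral_prod_right.neg (i1.integral_prod_right.add i2) ?_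
    filter_upwards [u.ae_isGoodSlice hp1r, ubar.ae_isGoodSlice hp1r, m.ae_isGoodSlice hp1r,
      hsol.ae_isDensity h hp3 hpd, hslice.2,
      ae_all_iff.2 fun i => MemLp.ae_slice (by linarith) (hslice.1 i),
      (hsol.integrable_flux h hp1r).prod_left_ae, i1.prod_left_ae, ae_swap_of_ae_prod hineq]
      with t h1 h2 h3 h4 h5 h6 h7 h8 h9
    exact slice_duality (by linarith) h1 h2 h3 h4 h6 h5 h7 h8 h9
  linarith

/-! ### The dual criterion -/

theorem dualValue_eq_bot {F : ℝ → (Torus d → ℝ) → ℝ}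
    (hN : ∫⁻ t in Icc 0 𝒟.T, (𝒟.Φstar t (P t)).toENNReal = ⊤) : 𝒟.dualValue F u P γ = ⊥ := by
  rw [dualValue, hN, EReal.coe_ennreal_top, EReal.sub_top, EReal.bot_sub]

theorem Assumptions.dualValue_eq_coe (h : 𝒟.Assumptions) {F : ℝ → (Torus d → ℝ) → ℝ}
    (hP : AEStronglyMeasurable P (volume.restrict (Icc 0 𝒟.T)))
    (hN : ∫⁻ t in Icc 0 𝒟.T, (𝒟.Φstar t (P t)).toENNReal ≠ ⊤) :
    Integrable (fun t => (𝒟.Φstar t (P t)).toENNReal.toReal) (volume.restrict (Icc 0 𝒟.T)) ∧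
    (∀ᵐ t ∂(volume.restrict (Icc 0 𝒟.T)),
      (((𝒟.Φstar t (P t)).toENNReal.toReal : ℝ) : EReal) = 𝒟.Φstar t (P t)) ∧
    𝒟.dualValue F u P γ = (((∫ x, initialValue u.toFun x * 𝒟.m₀ x)
      - (∫ t in Icc 0 𝒟.T, (𝒟.Φstar t (P t)).toENNReal.toReal)
      - (∫ t in Icc 0 𝒟.T, Fstar F t (fun x => γ (x, t))) : ℝ) : EReal) := by
  have hm := (h.aemeasurable_Φstar hP).ereal_toENNReal
  have hlt := ae_lt_top' hm hN
  refine ⟨integrable_toReal_of_lintegral_ne_top hm hN, ?_, ?_⟩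
  · filter_upwards [hlt, ae_restrict_mem measurableSet_Icc] with t h1 h2
    rw [EReal.coe_ennreal_toReal h1.ne, EReal.coe_toENNReal (h.Φstar_nonneg h2 _)]
  · rw [integral_toReal hm hlt, dualValue, ← EReal.coe_ennreal_toReal hN, EReal.coe_sub,
      EReal.coe_sub]

theorem IsSolution.Φstar_price (h : 𝒟.Assumptions) (hsol : 𝒟.IsSolution ubar m v Pbar) :
    ∀ᵐ t ∂(volume.restrict (Icc 0 𝒟.T)), 𝒟.Φstar t (Pbar t) =
      ((inner ℝ (Pbar t) (𝒟.aggregate m.toFun v t) -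
        𝒟.Φ t (𝒟.aggregate m.toFun v t) : ℝ) : EReal) := by
  filter_upwards [hsol.price, ae_restrict_mem measurableSet_Icc] with t h1 h2
  rw [h1]
  exact h.Φstar_Ψ h2 _

/-- At the equilibrium price Φ* equals ⟨P̄, a⟩ − Φ(t,a), and the tangent of Φ at 0 gives Φ(t,a) ≥
⟨Ψ(t,0), a⟩. Hence the bound (B + C)A. -/
theorem IsSolution.lintegral_Φstar_ne_top (h : 𝒟.Assumptions) (hp3 : 3 ≤ p) (hpd : (d : ℝ) < p)
    (hsol : 𝒟.IsSolution ubar m v Pbar) :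
    ∫⁻ t in Icc 0 𝒟.T, (𝒟.Φstar t (Pbar t)).toENNReal ≠ ⊤ := by
  obtain ⟨A, hA0, hA⟩ := ae_bound_of_memLp_top (hsol.memLp_aggregate h hp3 hpd)
  obtain ⟨B, hB0, hB⟩ := ae_bound_of_memLp_top hsol.memLp_P
  obtain ⟨C, hC0, hC⟩ := h.Ψ_growth
  refine ne_top_of_le_ne_top (b := ∫⁻ _ in Icc 0 𝒟.T, ENNReal.ofReal ((B + C) * A)) ?_ ?_
  · rw [lintegral_const]
    exact ENNReal.mul_ne_top (by simp) (by simp)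
  refine lintegral_mono_ae ?_
  filter_upwards [hA, hB, hsol.Φstar_price h, ae_restrict_mem measurableSet_Icc] with t h1 h2 h3 h4
  rw [h3, EReal.real_coe_toENNReal]
  refine ENNReal.ofReal_le_ofReal ?_
  set a := 𝒟.aggregate m.toFun v t
  have h5 := le_of_convexOn_of_hasGradientAt (h.Φ_convex t h4) (h.Φ_grad t h4 0) a
  rw [h.Φ_zero t h4, sub_zero, zero_add] at h5
  have h6 := hC t h4 0
  rw [norm_zero, mul_zero, zero_add] at h6
  have h7 := (real_inner_le_norm (Pbar t) a).trans (mul_le_mul h2 h1 (norm_nonneg _) hB0)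
  have h8 := (neg_le_of_abs_le (abs_real_inner_le_norm (𝒟.Ψ t 0) a))
  have h9 := mul_le_mul h6 h1 (norm_nonneg _) hC0.le
  rw [add_mul]
  linarith

/-- The dual criterion of the equilibrium dominates that of any admissible triple, with a gap that
controls the price. -/
theorem IsSolution.dualValue_le (h : 𝒟.Assumptions) {F : ℝ → (Torus d → ℝ) → ℝ}
    (hF : 𝒟.IsPotential F) (hp3 : 3 ≤ p) (hpd : (d : ℝ) < p)
    (hsol : 𝒟.IsSolution ubar m v Pbar) (hfeas : 𝒟.DualFeasible u P γ) :
    𝒟.dualValue F u P γ ≤ 𝒟.dualValue F ubar Pbar (𝒟.coupling m.toFun) ∧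
    (𝒟.dualValue F ubar Pbar (𝒟.coupling m.toFun) ≤ 𝒟.dualValue F u P γ →
      P =ᵐ[volume.restrict (Icc 0 𝒟.T)] Pbar) := by
  obtain ⟨I, -, hI⟩ := h.dualValue_eq_coe (u := ubar) (γ := 𝒟.coupling m.toFun) (F := F)
    hsol.memLp_P.1 (hsol.lintegral_Φstar_ne_top h hp3 hpd)
  rw [hI]
  by_cases hN : ∫⁻ t in Icc 0 𝒟.T, (𝒟.Φstar t (P t)).toENNReal = ⊤
  · rw [dualValue_eq_bot hN]
    exact ⟨bot_le, fun h => absurd (le_bot_iff.1 h) (EReal.coe_ne_bot _)⟩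
  obtain ⟨J, hJc, hJ⟩ := h.dualValue_eq_coe (u := u) (γ := γ) (F := F) hfeas.memLp_P.1 hN
  rw [hJ, EReal.coe_le_coe_iff, EReal.coe_le_coe_iff]
  have hγ : MemLp γ ⊤ (cylMeasure d 𝒟.T) := by rw [← restrict_cyl]; exact hfeas.memLp_γ
  have hf := hsol.memLp_coupling h hp3 hpd
  have i1 := (hsol.integrable_coupling_gap h hp3 hpd hγ).integral_prod_right
  have i2 := hsol.integrable_price_gap h hp3 hpd hfeas.memLp_P
  obtain ⟨K, hK⟩ := hF.Fstar_integrable h hγ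
  obtain ⟨K', -⟩ := hF.Fstar_integrable h hf
  have key := hsol.duality_le h hp3 hpd hfeas
  rw [integral_add i1 i2] at key
  -- Fenchel's inequality for γ at m̄(t), and its reverse for f̃; the values F(t, m̄(t)) cancel.
  have hF1 : ∫ t in Icc 0 𝒟.T, (∫ x, (γ (x, t) - 𝒟.coupling m.toFun (x, t)) * m.toFun (x, t)) ≤
      (∫ t in Icc 0 𝒟.T, Fstar F t fun x => γ (x, t)) -
        ∫ t in Icc 0 𝒟.T, Fstar F t fun x => 𝒟.coupling m.toFun (x, t) := by
    rw [← integral_sub K K']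
    refine integral_mono_ae i1 (K.sub K') ?_
    obtain ⟨B, -, hB⟩ := ae_bound_of_memLp_top hγ
    obtain ⟨B', -, hB'⟩ := ae_bound_of_memLp_top hf
    filter_upwards [hK, hF.Fstar_coupling h, hsol.ae_isDensity h hp3 hpd,
      ae_swap_of_ae_prod hB, ae_swap_of_ae_prod hB', hγ.1.prod_swap.prodMk_left,
      hf.1.prod_swap.prodMk_left] with t h1 h2 h3 h4 h5 h6 h7
    have h8 := h1 _ h3
    have h9 := h2 _ h3
    have h10 : ∫ x, (γ (x, t) - 𝒟.coupling m.toFun (x, t)) * m.toFun (x, t) =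
        (∫ x, γ (x, t) * m.toFun (x, t)) - ∫ x, 𝒟.coupling m.toFun (x, t) * m.toFun (x, t) := by
      have j1 : Integrable fun x => γ (x, t) * m.toFun (x, t) :=
        h3.integrable.bdd_mul (c := B) h6 h4
      have j2 : Integrable fun x => 𝒟.coupling m.toFun (x, t) * m.toFun (x, t) :=
        h3.integrable.bdd_mul (c := B') h7 h5
      rw [← integral_sub j1 j2]
      exact integral_congr_ae (.of_forall fun x => sub_mul _ _ _)
    simp only [coupling] at h10 ⊢
    linarith
  -- This is the Fenchel-Young defect of the pair (P(t), a(t)), since the defect of (P̄(t), a(t)) is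
  -- zero. The two dual values differ by at least its integral.
  let gap : ℝ → ℝ := fun t => (𝒟.Φstar t (P t)).toENNReal.toReal -
    (𝒟.Φstar t (Pbar t)).toENNReal.toReal - inner ℝ (𝒟.aggregate m.toFun v t) (P t - Pbar t)
  have hgi : Integrable gap (volume.restrict (Icc 0 𝒟.T)) := (J.sub I).sub i2
  have hge : ∫ t in Icc 0 𝒟.T, gap t = (∫ t in Icc 0 𝒟.T, (𝒟.Φstar t (P t)).toENNReal.toReal) -
      (∫ t in Icc 0 𝒟.T, (𝒟.Φstar t (Pbar t)).toENNReal.toReal) -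
      ∫ t in Icc 0 𝒟.T, inner ℝ (𝒟.aggregate m.toFun v t) (P t - Pbar t) := by
    have j1 : Integrable (fun t => (𝒟.Φstar t (P t)).toENNReal.toReal -
        (𝒟.Φstar t (Pbar t)).toENNReal.toReal) (volume.restrict (Icc 0 𝒟.T)) := J.sub I
    rw [← integral_sub J I, ← integral_sub j1 i2]
  have hgap : ∀ᵐ t ∂(volume.restrict (Icc 0 𝒟.T)), 0 ≤ gap t ∧ (gap t = 0 → P t = Pbar t) := by
    have hnn : ∀ᵐ t ∂(volume.restrict (Icc 0 𝒟.T)), t ∈ Icc 0 𝒟.T :=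
      ae_restrict_mem measurableSet_Icc
    filter_upwards [hJc, hsol.Φstar_price h, hsol.price, hnn] with t h1 h2 h3 h4
    have h5 : (𝒟.Φstar t (Pbar t)).toENNReal.toReal = inner ℝ (Pbar t)
        (𝒟.aggregate m.toFun v t) - 𝒟.Φ t (𝒟.aggregate m.toFun v t) := by
      have := h.Φstar_nonneg h4 (Pbar t)
      rw [h2] at this ⊢
      rw [EReal.real_coe_toENNReal, ENNReal.toReal_ofReal (EReal.coe_nonneg.1 this)]
    have h6 : gap t = (𝒟.Φstar t (P t)).toENNReal.toReal -
        (inner ℝ (P t) (𝒟.aggregate m.toFun v t) - 𝒟.Φ t (𝒟.aggregate m.toFun v t)) := by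
      simp only [gap]
      rw [h5, inner_sub_right, real_inner_comm (P t), real_inner_comm (Pbar t)]
      ring
    have h7 := coe_le_Φstar (𝒟 := 𝒟) t (P t) (𝒟.aggregate m.toFun v t)
    rw [← h1, EReal.coe_le_coe_iff] at h7
    refine ⟨by rw [h6]; linarith, fun h8 => ?_⟩
    rw [h3]
    refine h.eq_Ψ_of_Φstar_le h4 ?_
    change 𝒟.Φstar t (P t) ≤ ((inner ℝ (P t) (𝒟.aggregate m.toFun v t) -
      𝒟.Φ t (𝒟.aggregate m.toFun v t) : ℝ) : EReal)
    rw [← h1, EReal.coe_le_coe_iff]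
    linarith
  have hg0 : 0 ≤ ∫ t in Icc 0 𝒟.T, gap t := integral_nonneg_of_ae (hgap.mono fun t ht => ht.1)
  refine ⟨by linarith, fun hle => ?_⟩
  have hz : ∫ t in Icc 0 𝒟.T, gap t = 0 := le_antisymm (by linarith) hg0
  have hz' := (integral_eq_zero_iff_of_nonneg_ae (hgap.mono fun t ht => ht.1) hgi).1 hz
  filter_upwards [hz', hgap] with t h1 h2 using h2.2 h1

end Data

end MFGC

/-! ### Uniqueness for the Hamilton-Jacobi-Bellman equation -/

namespace MFGC

variable {d k : ℕ} {T p : ℝ}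

theorem measurePreserving_reflect : MeasurePreserving (fun t : ℝ => T - t)
    (volume.restrict (Icc 0 T)) (volume.restrict (Icc 0 T)) := by
  have := (Measure.measurePreserving_sub_left (volume : Measure ℝ) T).restrict_preimage
    (measurableSet_Icc (a := (0 : ℝ)) (b := T))
  simpa using this

/-- Grönwall's lemma, backwards in time. -/
theorem ae_le_zero_of_le_integral_terminal {y κ : ℝ → ℝ} (hκ : IntegrableOn κ (Icc 0 T))
    (hκ0 : ∀ t, 0 ≤ κ t) (hκy : IntegrableOn (fun t => κ t * y t) (Icc 0 T))
    (h : ∀ᵐ t ∂(volume.restrict (Icc 0 T)), y t ≤ ∫ s in t..T, κ s * y s) :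
    ∀ᵐ t ∂(volume.restrict (Icc 0 T)), y t ≤ 0 := by
  have hr := measurePreserving_reflect (T := T)
  have h1 := ae_le_zero_of_le_integral (T := T) (y := fun t => y (T - t))
    (κ := fun t => κ (T - t)) (hr.integrable_comp_of_integrable hκ) (fun t => hκ0 _)
    (hr.integrable_comp_of_integrable hκy) (by
      filter_upwards [hr.quasiMeasurePreserving.ae h] with t ht
      rw [intervalIntegral.integral_comp_sub_left (fun s => κ s * y s), sub_zero]
      exact ht)
  filter_upwards [hr.quasiMeasurePreserving.ae h1] with t ht
  simpa using ht

/-- For e ≥ 0 and p ≥ 2, e² ≤ 1 + eᵖ. The right-hand side is integrable in time for slices of a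
function in Lᵖ(Q), so the spatial Lᵖ norm is square integrable in time. -/
theorem sq_toReal_eLpNorm_le {f : Torus d → ℝ} (hp : 2 ≤ p)
    (hf : MemLp f (ENNReal.ofReal p) volume) :
    (eLpNorm f (ENNReal.ofReal p) volume).toReal ^ 2 ≤ 1 + ∫ x, ‖f x‖ ^ p := by
  have hp0 : 0 < p := by linarith
  have h1 : (eLpNorm f (ENNReal.ofReal p) volume).toReal ^ p = ∫ x, ‖f x‖ ^ p := by
    rw [toReal_eLpNorm hf.1, lpNorm_eq_integral_norm_rpow_toReal (by simpa using hp0) (by simp) hf.1,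
      ENNReal.toReal_ofReal hp0.le, ← Real.rpow_mul
        (integral_nonneg fun x => Real.rpow_nonneg (norm_nonneg _) _), inv_mul_cancel₀ hp0.ne',
      Real.rpow_one]
  rw [← h1]
  set e := (eLpNorm f (ENNReal.ofReal p) volume).toReal
  have he : 0 ≤ e := ENNReal.toReal_nonneg
  rcases le_total e 1 with h2 | h2
  · have := pow_le_one₀ (n := 2) he h2
    linarith [Real.rpow_nonneg he p]
  · have := Real.rpow_le_rpow_of_exponent_le h2 hp
    rw [Real.rpow_two] at this
    linarith

/-- The gradient of an element of `W^{2,1,p}(Q)` is square integrable in time with values in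
`L^∞`. -/
theorem W21p.exists_grad_bound (u : W21p d T p) (hp : 2 ≤ p) (hpd : (d : ℝ) < p) :
    ∃ κ : ℝ → ℝ, IntegrableOn κ (Icc 0 T) ∧ (∀ t, 0 ≤ κ t) ∧
      ∀ᵐ t ∂(volume.restrict (Icc 0 T)), ∀ᵐ x, ‖u.grad (x, t)‖ ^ 2 ≤ κ t := by
  have hp0 : 0 < p := by linarith
  have hp1 : (1 : ℝ≥0∞) ≤ ENNReal.ofReal p := by simpa using (by linarith : (1 : ℝ) ≤ p)
  set K := (morreyConst d p).toReal with hK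
  let G : (Torus d × ℝ → ℝ) → ℝ → ℝ := fun f t => ∫ x, ‖f (x, t)‖ ^ p
  have hG0 : ∀ f t, 0 ≤ G f t := fun f t =>
    integral_nonneg fun x => Real.rpow_nonneg (norm_nonneg _) _
  have hG : ∀ {f}, MemLp f (ENNReal.ofReal p) (cylMeasure d T) →
      IntegrableOn (fun t => 1 + G f t) (Icc 0 T) := fun {f} hf => by
    have := hf.integrable_norm_rpow (by simpa using hp0) (by simp)
    rw [ENNReal.toReal_ofReal hp0.le] at this
    exact (integrable_const 1).add this.integral_prod_right
  -- Morrey's inequality for each component of the gradient, squared: (a + b)² ≤ 2a² + 2b², and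
  -- Cauchy-Schwarz for the sum of d norms of second derivatives.
  refine ⟨fun t => ∑ i, (2 * (1 + G (fun z => u.grad z i) t) +
    2 * (K ^ 2 * (d * ∑ j, (1 + G (u.hess i j) t)))), ?_, fun t => ?_, ?_⟩
  · refine integrable_finsetSum _ fun i _ => ((hG (u.grad_memLp i)).const_mul 2).add ?_
    refine ((Integrable.const_mul ?_ _).const_mul _).const_mul _
    exact integrable_finsetSum _ fun j _ => hG (u.hess_memLp i j)
  · have := hG0
    refine Finset.sum_nonneg fun i _ => add_nonneg ?_ ?_
    · linarith [hG0 (fun z => u.grad z i) t]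
    · have : 0 ≤ ∑ j, (1 + G (u.hess i j) t) :=
        Finset.sum_nonneg fun j _ => by linarith [hG0 (u.hess i j) t]
      positivity
  filter_upwards [u.ae_isGoodSlice (by linarith)] with t ht
  have h1 : ∀ i, ∀ᵐ x, ‖u.grad (x, t) i‖ₑ ≤ ‖∫ x, u.grad (x, t) i‖ₑ +
      morreyConst d p * ∑ j, eLpNorm (fun x => u.hess i j (x, t)) (ENNReal.ofReal p) volume :=
    fun i => ae_enorm_le_of_hasTorusDeriv (by linarith) ((ht.memLp_grad i).integrable hp1)
      (ht.memLp_hess i) (ht.deriv_grad i)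
  filter_upwards [ae_all_iff.2 h1] with x hx
  rw [EuclideanSpace.norm_sq_eq]
  refine Finset.sum_le_sum fun i _ => ?_
  set e₀ := (eLpNorm (fun x => u.grad (x, t) i) (ENNReal.ofReal p) volume).toReal
  set e : Fin d → ℝ := fun j =>
    (eLpNorm (fun x => u.hess i j (x, t)) (ENNReal.ofReal p) volume).toReal with he
  have h2 : ‖u.grad (x, t) i‖ ≤ e₀ + K * ∑ j, e j := by
    have hmean : ‖∫ x, u.grad (x, t) i‖ₑ ≤
        eLpNorm (fun x => u.grad (x, t) i) (ENNReal.ofReal p) volume :=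
      (enorm_integral_le_lintegral_enorm _).trans ((eLpNorm_one_eq_lintegral_enorm).symm.le.trans
        (eLpNorm_le_eLpNorm_of_exponent_le hp1 (ht.memLp_grad i).1))
    have hs : ∑ j, eLpNorm (fun x => u.hess i j (x, t)) (ENNReal.ofReal p) volume ≠ ⊤ :=
      ENNReal.sum_ne_top.2 fun j _ => (ht.memLp_hess i j).2.ne
    have hm := ENNReal.mul_ne_top (morreyConst_ne_top hpd) hs
    have h3 := ENNReal.toReal_mono (ENNReal.add_ne_top.2 ⟨(ht.memLp_grad i).2.ne, hm⟩)
      ((hx i).trans (add_le_add_left hmean _))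
    rw [ENNReal.toReal_add (ht.memLp_grad i).2.ne hm, ENNReal.toReal_mul,
      ENNReal.toReal_sum fun j _ => (ht.memLp_hess i j).2.ne, toReal_enorm] at h3
    exact h3
  have h3 : (∑ j, e j) ^ 2 ≤ d * ∑ j, (1 + G (u.hess i j) t) := by
    refine sq_sum_le_card_mul_sum_sq.trans ?_
    rw [Finset.card_univ, Fintype.card_fin]
    gcongr with j
    exact sq_toReal_eLpNorm_le hp (ht.memLp_hess i j)
  have h4 := sq_toReal_eLpNorm_le hp (ht.memLp_grad i)
  calc ‖u.grad (x, t) i‖ ^ 2 ≤ (e₀ + K * ∑ j, e j) ^ 2 :=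
        pow_le_pow_left₀ (norm_nonneg _) h2 2
    _ ≤ 2 * (e₀ ^ 2 + (K * ∑ j, e j) ^ 2) := add_sq_le
    _ = 2 * e₀ ^ 2 + 2 * (K ^ 2 * (∑ j, e j) ^ 2) := by ring
    _ ≤ _ := by gcongr

/-- With w = u − ū, the diffusion produces −2σ∫|∇w|², and Young's inequality 2b|w||∇w| ≤ 2σ|∇w|² +
b²w²/(2σ) absorbs the drift. The sign is that of an equation solved backwards in time. -/
theorem W21p.IsGoodSlice.energy_le {u ubar : W21p d T p} {t σ b : ℝ} (hu : u.IsGoodSlice t)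
    (hub : ubar.IsGoodSlice t) (hp : 2 ≤ p) (hσ : 0 < σ)
    (h : ∀ᵐ x, |(u.ut (x, t) - ubar.ut (x, t)) + σ * (u.lap (x, t) - ubar.lap (x, t))| ≤
      b * ‖u.grad (x, t) - ubar.grad (x, t)‖) :
    -∫ x, 2 * (u.toFun (x, t) - ubar.toFun (x, t)) * (u.ut (x, t) - ubar.ut (x, t)) ≤
      b ^ 2 / (2 * σ) * ∫ x, (u.toFun (x, t) - ubar.toFun (x, t)) ^ 2 := by
  have h2 := fun {f : Torus d → ℝ} => memLp_two_of_le (d := d) (f := f) hp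
  have hp1 : (1 : ℝ≥0∞) ≤ ENNReal.ofReal p := by simpa using (by linarith : (1 : ℝ) ≤ p)
  let w : Torus d → ℝ := fun x => u.toFun (x, t) - ubar.toFun (x, t)
  let wt : Torus d → ℝ := fun x => u.ut (x, t) - ubar.ut (x, t)
  let wi : Fin d → Torus d → ℝ := fun i x => u.grad (x, t) i - ubar.grad (x, t) i
  let wl : Torus d → ℝ := fun x => u.lap (x, t) - ubar.lap (x, t)
  have hw2 : MemLp w 2 volume := h2 (hu.memLp_toFun.sub hub.memLp_toFun)
  have hwt2 : MemLp wt 2 volume := h2 (hu.memLp_ut.sub hub.memLp_ut)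
  have hwi2 : ∀ i, MemLp (wi i) 2 volume := fun i => h2 ((hu.memLp_grad i).sub (hub.memLp_grad i))
  have hul : MemLp (fun x => u.lap (x, t)) 2 volume :=
    memLp_finsetSum _ fun i _ => h2 (hu.memLp_hess i i)
  have hubl : MemLp (fun x => ubar.lap (x, t)) 2 volume :=
    memLp_finsetSum _ fun i _ => h2 (hub.memLp_hess i i)
  have hwd : ∀ i, HasTorusDeriv i w (wi i) := fun i =>
    (hu.deriv_toFun i).sub (hub.deriv_toFun i) (hu.memLp_toFun.integrable hp1)
      (hub.memLp_toFun.integrable hp1) ((hu.memLp_grad i).integrable hp1)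
      ((hub.memLp_grad i).integrable hp1)
  have e1 := hu.integral_lap_mul hp hwd hw2 hwi2
  have e2 := hub.integral_lap_mul hp hwd hw2 hwi2
  have i1 : Integrable fun x => w x * wt x := integrable_mul_of_memLp_two hw2 hwt2
  have i2 : Integrable fun x => wl x * w x := integrable_mul_of_memLp_two (hul.sub hubl) hw2
  have i3 : ∀ i, Integrable fun x => wi i x * wi i x := fun i =>
    integrable_mul_of_memLp_two (hwi2 i) (hwi2 i)
  have i4 : Integrable fun x => w x ^ 2 := hw2.integrable_sq
  have e3 : ∫ x, wl x * w x = -∑ i, ∫ x, wi i x * wi i x := by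
    have : ∫ x, wl x * w x = (∫ x, u.lap (x, t) * w x) - ∫ x, ubar.lap (x, t) * w x := by
      rw [← integral_sub (integrable_mul_of_memLp_two hul hw2)
        (integrable_mul_of_memLp_two hubl hw2)]
      exact integral_congr_ae (.of_forall fun x => by simp only [wl]; ring)
    rw [this, e1, e2, neg_sub_neg, ← Finset.sum_sub_distrib, ← Finset.sum_neg_distrib]
    refine Finset.sum_congr rfl fun i _ => ?_
    rw [← integral_sub (integrable_mul_of_memLp_two (h2 (hub.memLp_grad i)) (hwi2 i))
      (integrable_mul_of_memLp_two (h2 (hu.memLp_grad i)) (hwi2 i)), ← integral_neg]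
    exact integral_congr_ae (.of_forall fun x => by simp only [wi]; ring)
  have i5 : Integrable fun x => -2 * (w x * wt x) - 2 * σ * (wl x * w x) :=
    (i1.const_mul _).sub (i2.const_mul _)
  have key : ∫ x, ((-2 * (w x * wt x) - 2 * σ * (wl x * w x)) - 2 * σ * ∑ i, wi i x * wi i x) ≤
      ∫ x, b ^ 2 / (2 * σ) * w x ^ 2 := by
    refine integral_mono_ae (i5.sub ((integrable_finsetSum _ fun i _ => i3 i).const_mul _))
      (i4.const_mul _) ?_
    filter_upwards [h] with x hx
    set n := ‖u.grad (x, t) - ubar.grad (x, t)‖ with hn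
    have hn2 : ∑ i, wi i x * wi i x = n ^ 2 := by
      rw [hn, EuclideanSpace.norm_sq_eq]
      exact Finset.sum_congr rfl fun i _ => by
        rw [Real.norm_eq_abs, sq_abs, sq]; rfl
    rw [hn2]
    have h3 : -(w x * (wt x + σ * wl x)) ≤ |w x| * (b * n) := by
      refine (neg_le_abs _).trans ?_
      rw [abs_mul]
      exact mul_le_mul_of_nonneg_left hx (abs_nonneg _)
    have h4 : 2 * (|w x| * (b * n)) - 2 * σ * n ^ 2 ≤ b ^ 2 / (2 * σ) * w x ^ 2 := by
      have : b ^ 2 / (2 * σ) * |w x| ^ 2 - (2 * (|w x| * (b * n)) - 2 * σ * n ^ 2) =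
          (b * |w x| - 2 * σ * n) ^ 2 / (2 * σ) := by field_simp; ring
      have h0 : 0 ≤ (b * |w x| - 2 * σ * n) ^ 2 / (2 * σ) := by positivity
      rw [← sq_abs (w x)]
      linarith
    linarith
  rw [integral_sub i5 ((integrable_finsetSum _ fun i _ => i3 i).const_mul _),
    integral_sub (i1.const_mul _) (i2.const_mul _), integral_const_mul, integral_const_mul,
    integral_const_mul, integral_const_mul, integral_finsetSum _ fun i _ => i3 i, e3] at key
  have e4 : ∫ x, 2 * (u.toFun (x, t) - ubar.toFun (x, t)) * (u.ut (x, t) - ubar.ut (x, t)) =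
      2 * ∫ x, w x * wt x := by
    rw [← integral_const_mul]
    exact integral_congr_ae (.of_forall fun x => by simp only [w, wt]; ring)
  rw [e4]
  linarith

namespace Data

variable {𝒟 : Data d k}

/-- The difference of two solutions of the Hamilton-Jacobi-Bellman equation solves a linear
differential inequality, with a drift that is square integrable in time. -/
theorem Assumptions.exists_drift_bound (h : 𝒟.Assumptions) (hp : 2 ≤ p) (hpd : (d : ℝ) < p)
    {u ubar : W21p d 𝒟.T p} {P Pbar : ℝ → Vec k}
    (hP : MemLp P ⊤ (volume.restrict (Icc 0 𝒟.T)))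
    (hPP : P =ᵐ[volume.restrict (Icc 0 𝒟.T)] Pbar)
    (hhjb : 𝒟.hjb u P =ᵐ[cylMeasure d 𝒟.T] 𝒟.hjb ubar Pbar) :
    ∃ β : ℝ → ℝ, IntegrableOn (fun t => β t ^ 2) (Icc 0 𝒟.T) ∧
      ∀ᵐ t ∂(volume.restrict (Icc 0 𝒟.T)), ∀ᵐ x,
        |(u.ut (x, t) - ubar.ut (x, t)) + 𝒟.σ * (u.lap (x, t) - ubar.lap (x, t))| ≤
          β t * ‖u.grad (x, t) - ubar.grad (x, t)‖ := by
  obtain ⟨c, hc, M, hM⟩ := h.exists_hamiltonian_map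
  obtain ⟨κ, hκ, hκ0, hκb⟩ := u.exists_grad_bound hp hpd
  obtain ⟨κ', hκ', hκ0', hκb'⟩ := ubar.exists_grad_bound hp hpd
  obtain ⟨C, hC0, hC⟩ := h.exists_norm_φ_le
  obtain ⟨B, hB0, hB⟩ := ae_bound_of_memLp_top hP
  set N := |M| + 2 * (C * B) with hN
  -- The Lipschitz constant of H is at most c (|∇u| + |∇ū| + N), N collecting the constant and price
  -- contributions; its square is bounded by (a + a' + N)² ≤ 3 (a² + a'² + N²).
  let S : ℝ → ℝ := fun t => c ^ 2 * (3 * (κ t + κ' t + N ^ 2))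
  have hS0 : ∀ t, 0 ≤ S t := fun t => by
    have h1 := hκ0 t
    have h2 := hκ0' t
    positivity
  refine ⟨fun t => √(S t), ?_, ?_⟩
  · simp only [Real.sq_sqrt (hS0 _)]
    exact (((hκ.add hκ').add (integrable_const _)).const_mul _).const_mul _
  filter_upwards [hκb, hκb', hB, hPP, ae_restrict_mem measurableSet_Icc, ae_swap_of_ae_prod hhjb]
    with t h1 h2 h3 h4 h5 h6
  filter_upwards [h1, h2, h6] with x h1 h2 h6
  simp only [hjb, ← h4] at h6
  set q := u.grad (x, t) + 𝒟.φT x t (P t) with hq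
  set q' := ubar.grad (x, t) + 𝒟.φT x t (P t) with hq'
  have hdiff : u.grad (x, t) - ubar.grad (x, t) = q - q' := by rw [hq, hq']; abel
  have e1 : (u.ut (x, t) - ubar.ut (x, t)) + 𝒟.σ * (u.lap (x, t) - ubar.lap (x, t)) =
      𝒟.H x t q - 𝒟.H x t q' := by linarith
  rw [e1, hdiff]
  refine ((hM x t h5).2 q' q).trans (mul_le_mul_of_nonneg_right ?_ (norm_nonneg _))
  have hφ : ‖𝒟.φT x t (P t)‖ ≤ C * B := by
    refine (ContinuousLinearMap.le_opNorm _ _).trans ?_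
    rw [LinearIsometryEquiv.norm_map]
    exact mul_le_mul (hC x t h5) h3 (norm_nonneg _) hC0
  have e2 : ‖q‖ ≤ ‖u.grad (x, t)‖ + C * B := (norm_add_le _ _).trans (by gcongr)
  have e3 : ‖q'‖ ≤ ‖ubar.grad (x, t)‖ + C * B := (norm_add_le _ _).trans (by gcongr)
  set a := ‖u.grad (x, t)‖
  set a' := ‖ubar.grad (x, t)‖
  have e4 : ‖q'‖ + ‖q‖ + M ≤ a + a' + N := by
    rw [hN]; linarith [le_abs_self M]
  refine (mul_le_mul_of_nonneg_left e4 hc.le).trans (Real.le_sqrt_of_sq_le ?_)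
  rw [mul_pow]
  refine mul_le_mul_of_nonneg_left ?_ (sq_nonneg c)
  nlinarith [sq_nonneg (a - a'), sq_nonneg (a - N), sq_nonneg (a' - N)]

/-- Uniqueness for the Hamilton-Jacobi-Bellman equation. -/
theorem Assumptions.hjb_unique (h : 𝒟.Assumptions) (hp : 2 ≤ p) (hpd : (d : ℝ) < p)
    {u ubar : W21p d 𝒟.T p} {P Pbar : ℝ → Vec k}
    (hP : MemLp P ⊤ (volume.restrict (Icc 0 𝒟.T)))
    (hPP : P =ᵐ[volume.restrict (Icc 0 𝒟.T)] Pbar)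
    (hhjb : 𝒟.hjb u P =ᵐ[cylMeasure d 𝒟.T] 𝒟.hjb ubar Pbar)
    (hterm : terminalValue 𝒟.T u.toFun =ᵐ[volume] terminalValue 𝒟.T ubar.toFun) :
    u.toFun =ᵐ[cylMeasure d 𝒟.T] ubar.toFun := by
  obtain ⟨β, hβ, hβb⟩ := h.exists_drift_bound hp hpd hP hPP hhjb
  have hT := h.T_pos
  have hp1r : 1 ≤ p := by linarith
  obtain ⟨tu, teu⟩ := u.hasTrace hp1r hT
  obtain ⟨tb, teb⟩ := ubar.hasTrace hp1r hT
  have hL2 : ∀ {f : Torus d × ℝ → ℝ}, MemLp f (ENNReal.ofReal p) (cylMeasure d 𝒟.T) →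
      MemLp f 2 (cylMeasure d 𝒟.T) := fun {f} hf => hf.mono_exponent (by
    rw [show (2 : ℝ≥0∞) = ENNReal.ofReal 2 by simp]
    exact ENNReal.ofReal_le_ofReal hp)
  have hw2 := (hL2 u.toFun_memLp).sub (hL2 ubar.toFun_memLp)
  have hwt2 := (hL2 u.ut_memLp).sub (hL2 ubar.ut_memLp)
  have hder : deriv (fun s : ℝ => s ^ 2) = fun s => 2 * s := by
    funext s; simp
  have i1 : Integrable (fun z => (u.toFun z - ubar.toFun z) ^ 2) (cylMeasure d 𝒟.T) :=
    hw2.integrable_sq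
  have i2 : Integrable (fun z => 2 * (u.toFun z - ubar.toFun z) * (u.ut z - ubar.ut z))
      (cylMeasure d 𝒟.T) := by
    simpa only [mul_assoc, Pi.sub_apply] using (integrable_mul_of_memLp_two hw2 hwt2).const_mul 2
  obtain ⟨hE, hET⟩ := (tu.sub tb).integral_comp_eq hT (η := fun s => s ^ 2) (by fun_prop) i1
    (by simpa only [hder] using i2)
  simp only [hder] at hE hET
  have hz : ∫ x, ((initialValue u.toFun x - initialValue ubar.toFun x) +
      ∫ s in 0..𝒟.T, (u.ut (x, s) - ubar.ut (x, s))) ^ 2 = 0 := by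
    refine integral_eq_zero_of_ae ?_
    filter_upwards [teu, teb, hterm, tu.integrable_deriv.prod_right_ae,
      tb.integrable_deriv.prod_right_ae] with x h1 h2 h3 h4 h5
    have hTT : 𝒟.T ∈ Icc 0 𝒟.T := ⟨hT.le, le_rfl⟩
    rw [intervalIntegral.integral_sub (intervalIntegrable_of_integrableOn_Icc h4 hTT)
      (intervalIntegrable_of_integrableOn_Icc h5 hTT)]
    rw [h1, h2] at h3
    simp only [Pi.zero_apply, ne_eq, OfNat.ofNat_ne_zero, not_false_eq_true, pow_eq_zero_iff]
    linarith
  rw [hz] at hET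
  set a₀ := ∫ x, (initialValue u.toFun x - initialValue ubar.toFun x) ^ 2
  let E : ℝ → ℝ := fun t => ∫ x, (u.toFun (x, t) - ubar.toFun (x, t)) ^ 2
  let D : ℝ → ℝ := fun t => ∫ x, 2 * (u.toFun (x, t) - ubar.toFun (x, t)) *
    (u.ut (x, t) - ubar.ut (x, t))
  have hEi : IntegrableOn E (Icc 0 𝒟.T) := i1.integral_prod_right
  have hDi : IntegrableOn D (Icc 0 𝒟.T) := i2.integral_prod_right
  let κ : ℝ → ℝ := fun t => β t ^ 2 / (2 * 𝒟.σ)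
  have hσ := h.σ_pos
  have hκ : IntegrableOn κ (Icc 0 𝒟.T) := hβ.div_const _
  have hDint : ∀ {s t : ℝ}, s ∈ Icc 0 𝒟.T → t ∈ Icc 0 𝒟.T → IntervalIntegrable D volume s t :=
    fun {s t} hs ht => ((intervalIntegrable_of_integrableOn_Icc hDi hs).symm).trans
      (intervalIntegrable_of_integrableOn_Icc hDi ht)
  -- The coefficient κ is only integrable, so E must be bounded for κE to be integrable.
  have hEb : ∀ᵐ t ∂(volume.restrict (Icc 0 𝒟.T)),
      ‖E t‖ ≤ |a₀| + ∫ s in Icc 0 𝒟.T, ‖D s‖ := by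
    filter_upwards [hE, ae_restrict_mem measurableSet_Icc] with t h1 h2
    change ‖∫ x, (u.toFun (x, t) - ubar.toFun (x, t)) ^ 2‖ ≤ _
    rw [h1]
    refine (norm_add_le _ _).trans (add_le_add le_rfl ?_)
    refine (intervalIntegral.norm_integral_le_integral_norm h2.1).trans ?_
    rw [intervalIntegral.integral_of_le h2.1]
    exact setIntegral_mono_set hDi.norm (.of_forall fun s => norm_nonneg _)
      (Ioc_subset_Icc_self.trans (Icc_subset_Icc_right h2.2)).eventuallyLE
  have hκE : IntegrableOn (fun t => κ t * E t) (Icc 0 𝒟.T) :=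
    Integrable.mul_bdd hκ hEi.aestronglyMeasurable hEb
  have hslice : ∀ᵐ t ∂(volume.restrict (Icc 0 𝒟.T)), -D t ≤ κ t * E t := by
    filter_upwards [u.ae_isGoodSlice hp1r, ubar.ae_isGoodSlice hp1r, hβb] with t h1 h2 h3
    exact h1.energy_le h2 hp hσ h3
  have hgr := ae_le_zero_of_le_integral_terminal hκ (fun t => by positivity) hκE (by
    filter_upwards [hE, ae_restrict_mem measurableSet_Icc] with t h1 h2
    -- The energy vanishes at time T because the terminal values agree.
    have h3 : E t = ∫ s in t..𝒟.T, -D s := by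
      have h4 := intervalIntegral.integral_add_adjacent_intervals
        (hDint ⟨le_rfl, hT.le⟩ h2) (hDint h2 ⟨hT.le, le_rfl⟩)
      rw [intervalIntegral.integral_neg]
      change ∫ x, (u.toFun (x, t) - ubar.toFun (x, t)) ^ 2 = _
      rw [h1]
      change 0 = a₀ + ∫ s in 0..𝒟.T, D s at hET
      change a₀ + (∫ s in 0..t, D s) = _
      linarith
    rw [h3, intervalIntegral.integral_of_le h2.2, intervalIntegral.integral_of_le h2.2]
    have hsub : Ioc t 𝒟.T ⊆ Icc 0 𝒟.T := Ioc_subset_Icc_self.trans (Icc_subset_Icc_left h2.1)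
    exact setIntegral_mono_ae_restrict (hDi.neg.mono_set hsub) (hκE.mono_set hsub)
      (ae_mono (Measure.restrict_mono hsub le_rfl) hslice))
  refine ae_prod_eq_of_ae_ae_swap u.toFun_memLp.1 ubar.toFun_memLp.1 ?_
  filter_upwards [hgr, i1.prod_left_ae] with t h1 h2
  have h3 : E t = 0 := le_antisymm h1 (integral_nonneg fun x => sq_nonneg _)
  have h4 := (integral_eq_zero_iff_of_nonneg (fun x => sq_nonneg _) h2).1 h3
  filter_upwards [h4] with x hx
  have := (pow_eq_zero_iff two_ne_zero).1 hx
  linarith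

end Data

end MFGC

end

/-! ### The theorem -/

theorem mainTheorem4 {d k : ℕ} (hd : 1 ≤ d) (p : ℝ) (hp : (d : ℝ) + 2 < p)
    (𝒟 : MFGC.Data d k) (h𝒟 : 𝒟.Assumptions)
    (F : ℝ → (MFGC.Torus d → ℝ) → ℝ) (hF : 𝒟.IsPotential F)
    (ubar mbar : MFGC.W21p d 𝒟.T p) (vbar : MFGC.Torus d × ℝ → MFGC.Vec d)
    (Pbar : ℝ → MFGC.Vec k) (hsol : 𝒟.IsSolution ubar mbar vbar Pbar) :
    𝒟.IsDualSolution F ubar Pbar (𝒟.coupling mbar.toFun) ∧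
    ∀ (u : MFGC.W21p d 𝒟.T p) (P : ℝ → MFGC.Vec k) (γ : MFGC.Torus d × ℝ → ℝ),
      𝒟.IsDualSolution F u P γ →
        P =ᵐ[volume.restrict (Icc 0 𝒟.T)] Pbar ∧
        (γ =ᵐ[volume.restrict (MFGC.cyl d 𝒟.T)] 𝒟.coupling mbar.toFun →
          𝒟.hjb u P =ᵐ[volume.restrict (MFGC.cyl d 𝒟.T)] γ →
          MFGC.terminalValue 𝒟.T u.toFun =ᵐ[volume] 𝒟.g →
          u.toFun =ᵐ[volume.restrict (MFGC.cyl d 𝒟.T)] ubar.toFun) := by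
  have hd' : (1 : ℝ) ≤ d := by exact_mod_cast hd
  -- The positivity argument integrates cubes, hence p ≥ 3; Morrey's inequality needs p > d.
  have hp3 : 3 ≤ p := by linarith
  have hpd : (d : ℝ) < p := by linarith
  have hfeas := hsol.dualFeasible h𝒟 hp3 hpd
  refine ⟨⟨hfeas, fun u P γ h => (hsol.dualValue_le h𝒟 hF hp3 hpd h).1⟩, fun u P γ h => ?_⟩
  have hP := (hsol.dualValue_le h𝒟 hF hp3 hpd h.1).2 (h.2 _ _ _ hfeas)
  refine ⟨hP, fun hγ hhjb hterm => ?_⟩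
  have heq := (hhjb.trans hγ).trans (EventuallyEq.symm hsol.hjb_eq)
  rw [MFGC.restrict_cyl] at heq ⊢
  exact h𝒟.hjb_unique (by linarith) hpd h.1.memLp_P hP heq
    (hterm.trans (EventuallyEq.symm hsol.terminal))
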